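/- For an integer $d\ge 2$ let $c_d=3-\frac6d$ and let $V_d$ be the universal $N=2$ vertex operator superalgebra of central charge $c_d$, i.e. the vacuum module of the Neveu--Schwarz $N=2$ superconformal algebra at central charge $c_d$ with its vertex superalgebra structure, generated by the fields $T$ (energy-momentum tensor), $J$ and $G^\pm$ of conformal weights $2$, $1$ and $\frac32$. A conformal embedding is an injective homomorphism of vertex superalgebras that maps the conformal vector to the conformal vector. Let $d_1,d_2,d_3\ge 2$ be integers. We say that the diagonal map is a conformal embedding $V_{d_1}\hookrightarrow V_{d_2}\otimes V_{d_3}$ if the assignment $X\mapsto X\otimes 1+1\otimes X$ on the generators $X\in\{J,T,G^+,G^-\}$ extends to a conformal embedding. Then: 1. The diagonal map is a conformal embedding $V_{d_1}\hookrightarrow V_{d_2}\otimes V_{d_3}$ if and only if $c_{d_1}=c_{d_2}+c_{d_3}$. 2. $c_{d_1}=c_{d_2}+c_{d_3}$ if and only if $\frac1{d_2}+\frac1{d_3}-\frac1{d_1}=\frac12$. 3. If $d_2,d_3\ge 3$, the diagonal map is a conformal embedding if and only if, up to exchanging $d_2$ and $d_3$, we have $d_2=3$ and $(d_1,d_3)$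 is one of $(6,3)$, $(12,4)$, $(30,5)$. 4. In the degenerate case $d_2=2$ (where $c_{d_2}=0$) the diagonal map is a conformal embedding if and only if $d_1=d_3$; likewise, if $d_3=2$, if and only if $d_1=d_2$. -/

import Mathlib

open scoped TensorProduct VertexOperator

noncomputable section

namespace SuperVOA

section Fields

variable {V W : Type*} [AddCommGroup V] [Module ℂ V] [AddCommGroup W] [Module ℂ W]

theorem field_ext {A B : VertexOperator ℂ V} (h : ∀ n v, (A[[n]]) v = (B[[n]]) v) : A = B := by
  apply HVertexOperator.coeff_inj
  funext n
  rw [VertexOperator.coeff_eq_ncoeff, VertexOperator.coeff_eq_ncoeff]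
  exact LinearMap.ext (h _)

theorem field_trunc (A : VertexOperator ℂ V) (v : V) : ∃ N : ℤ, ∀ n ≥ N, (A[[n]]) v = 0 := by
  refine ⟨-HahnSeries.order ((HahnModule.of ℂ).symm (A v)), fun n hn => ?_⟩
  exact VertexOperator.ncoeff_eq_zero_of_lt_order A n v (by lia)

/-- The field `A(z) = ∑ₙ A₍ₙ₎ z⁻ⁿ⁻¹` with prescribed modes `A₍ₙ₎ = f n`. -/
def mkField (f : ℤ → Module.End ℂ V) (h : ∀ v, ∃ N : ℤ, ∀ n ≥ N, f n v = 0) :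
    VertexOperator ℂ V :=
  VertexOperator.of_coeff (fun n => f (-n - 1)) (fun v => by
    obtain ⟨N, hN⟩ := h v
    refine ⟨-N, fun n hn => ?_⟩
    by_contra hlt
    exact hn (hN _ (by lia)))

@[simp]
theorem mkField_ncoeff (f : ℤ → Module.End ℂ V) (h : ∀ v, ∃ N : ℤ, ∀ n ≥ N, f n v = 0) (n : ℤ) :
    (mkField f h)[[n]] = f n := by
  rw [mkField, VertexOperator.ncoeff_of_coeff]
  congr 1
  lia

theorem finsum_range {M : Type*} [AddCommMonoid M] {f : ℕ → M} {N : ℕ}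
    (h : ∀ j ≥ N, f j = 0) : ∑ᶠ j, f j = ∑ j ∈ Finset.range N, f j := by
  apply finsum_eq_sum_of_support_subset
  intro j hj
  by_contra hlt
  exact hj (h j (by simpa using hlt))

/-- The mode `∑_{j ≥ 0} (-1)ʲ (m choose j) A₍ₘ₋ⱼ₎ C₍ₖ₊ⱼ₎` applied to `v`. -/
def leftMode (A C : VertexOperator ℂ V) (m k : ℤ) (v : V) : V :=
  ∑ᶠ j : ℕ, ((-1) ^ j * Ring.choose m j : ℤ) • (A[[m - j]]) ((C[[k + j]]) v)

/-- The mode `∑_{j ≥ 0} (-1)^{m+j} (m choose j) C₍ₘ₊ₖ₋ⱼ₎ A₍ⱼ₎` applied to `v`. -/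
def rightMode (A C : VertexOperator ℂ V) (m k : ℤ) (v : V) : V :=
  ∑ᶠ j : ℕ, (((m + j).negOnePow : ℤ) * Ring.choose m j) • (C[[m + k - j]]) ((A[[(j : ℤ)]]) v)

theorem leftMode_eq {A C : VertexOperator ℂ V} {m k : ℤ} {v : V} {N : ℕ}
    (h : ∀ j ≥ N, (C[[k + (j : ℕ)]]) v = 0) : leftMode A C m k v =
      ∑ j ∈ Finset.range N,
        ((-1) ^ j * Ring.choose m j : ℤ) • (A[[m - j]]) ((C[[k + j]]) v) :=
  finsum_range fun j hj => by rw [h j hj, map_zero, smul_zero]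

theorem rightMode_eq {A C : VertexOperator ℂ V} {m k : ℤ} {v : V} {N : ℕ}
    (h : ∀ j ≥ N, (A[[((j : ℕ) : ℤ)]]) v = 0) : rightMode A C m k v =
      ∑ j ∈ Finset.range N,
        (((m + j).negOnePow : ℤ) * Ring.choose m j) • (C[[m + k - j]]) ((A[[(j : ℤ)]]) v) :=
  finsum_range fun j hj => by rw [h j hj, map_zero, smul_zero]

theorem exists_nat_bound (C : VertexOperator ℂ V) (k : ℤ) (v : V) :
    ∃ N : ℕ, ∀ j ≥ N, (C[[k + (j : ℕ)]]) v = 0 := by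
  obtain ⟨N, hN⟩ := field_trunc C v
  exact ⟨(N - k).toNat, fun j hj => hN _ (by lia)⟩

theorem exists_nat_bound' (C : VertexOperator ℂ V) (v : V) :
    ∃ N : ℕ, ∀ j ≥ N, (C[[((j : ℕ) : ℤ)]]) v = 0 := by
  obtain ⟨N, hN⟩ := exists_nat_bound C 0 v
  exact ⟨N, fun j hj => by simpa using hN j hj⟩

/-- `C(z) ↦ Res_w A(w) C(z) (w - z)ᵐ`, with `(w - z)ᵐ` expanded in the domain `|w| > |z|`. -/
def leftMul (A : VertexOperator ℂ V) (m : ℤ) : VertexOperator ℂ V →ₗ[ℂ] VertexOperator ℂ V where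
  toFun C := mkField
    (fun k =>
      { toFun := leftMode A C m k
        map_add' := fun v w => by
          obtain ⟨N₁, h₁⟩ := exists_nat_bound C k v
          obtain ⟨N₂, h₂⟩ := exists_nat_bound C k w
          rw [leftMode_eq (N := N₁ + N₂) (fun j hj => h₁ j (by lia)),
            leftMode_eq (N := N₁ + N₂) (fun j hj => h₂ j (by lia)),
            leftMode_eq (N := N₁ + N₂) (fun j hj => by
              rw [map_add, h₁ j (by lia), h₂ j (by lia), add_zero]), ← Finset.sum_add_distrib]
          simp only [map_add, smul_add]
        map_smul' := fun a v => by
          obtain ⟨N, h⟩ := exists_nat_bound C k v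
          rw [leftMode_eq h, leftMode_eq (N := N) (fun j hj => by
            rw [map_smul, h j hj, smul_zero]), RingHom.id_apply, Finset.smul_sum]
          simp only [map_smul, smul_comm a] })
    (fun v => by
      obtain ⟨N, hN⟩ := field_trunc C v
      refine ⟨N, fun n hn => ?_⟩
      change leftMode A C m n v = 0
      rw [leftMode_eq (N := 0) (fun j _ => hN _ (by lia)), Finset.sum_range_zero])
  map_add' C D := field_ext fun k v => by
    obtain ⟨N₁, h₁⟩ := exists_nat_bound C k v
    obtain ⟨N₂, h₂⟩ := exists_nat_bound D k v
    simp only [map_add, Pi.add_apply, LinearMap.add_apply, mkField_ncoeff, LinearMap.coe_mk,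
      AddHom.coe_mk]
    rw [leftMode_eq (N := N₁ + N₂) (fun j hj => h₁ j (by lia)),
      leftMode_eq (N := N₁ + N₂) (fun j hj => h₂ j (by lia)),
      leftMode_eq (N := N₁ + N₂) (fun j hj => by
        rw [map_add, Pi.add_apply, LinearMap.add_apply, h₁ j (by lia), h₂ j (by lia), add_zero]),
      ← Finset.sum_add_distrib]
    simp only [map_add, Pi.add_apply, LinearMap.add_apply, smul_add]
  map_smul' a C := field_ext fun k v => by
    obtain ⟨N, h⟩ := exists_nat_bound C k v
    simp only [map_smul, Pi.smul_apply, LinearMap.smul_apply, mkField_ncoeff, LinearMap.coe_mk,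
      AddHom.coe_mk, RingHom.id_apply]
    rw [leftMode_eq h, leftMode_eq (N := N) (fun j hj => by
      rw [map_smul, Pi.smul_apply, LinearMap.smul_apply, h j hj, smul_zero]), Finset.smul_sum]
    simp only [map_smul, Pi.smul_apply, LinearMap.smul_apply, smul_comm a]

/-- `C(z) ↦ Res_w C(z) A(w) (w - z)ᵐ`, with `(w - z)ᵐ` expanded in the domain `|z| > |w|`. -/
def rightMul (A : VertexOperator ℂ V) (m : ℤ) : VertexOperator ℂ V →ₗ[ℂ] VertexOperator ℂ V where
  toFun C := mkField
    (fun k =>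
      { toFun := rightMode A C m k
        map_add' := fun v w => by
          obtain ⟨N₁, h₁⟩ := exists_nat_bound' A v
          obtain ⟨N₂, h₂⟩ := exists_nat_bound' A w
          rw [rightMode_eq (N := N₁ + N₂) (fun j hj => h₁ j (by lia)),
            rightMode_eq (N := N₁ + N₂) (fun j hj => h₂ j (by lia)),
            rightMode_eq (N := N₁ + N₂) (fun j hj => by
              rw [map_add, h₁ j (by lia), h₂ j (by lia), add_zero]), ← Finset.sum_add_distrib]
          simp only [map_add, smul_add]
        map_smul' := fun a v => by
          obtain ⟨N, h⟩ := exists_nat_bound' A v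
          rw [rightMode_eq h, rightMode_eq (N := N) (fun j hj => by
            rw [map_smul, h j hj, smul_zero]), RingHom.id_apply, Finset.smul_sum]
          simp only [map_smul, smul_comm a] })
    (fun v => by
      obtain ⟨N, hN⟩ := exists_nat_bound' A v
      choose B hB using fun j : ℕ => field_trunc C ((A[[(j : ℤ)]]) v)
      refine ⟨∑ j ∈ Finset.range N, |B j| + N - m, fun n hn => ?_⟩
      change rightMode A C m n v = 0
      rw [rightMode_eq hN]
      refine Finset.sum_eq_zero fun j hj => ?_
      have h₁ : |B j| ≤ ∑ j ∈ Finset.range N, |B j| :=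
        Finset.single_le_sum (f := fun j => |B j|) (fun i _ => abs_nonneg _) hj
      have h₂ := le_abs_self (B j)
      have h₃ := Finset.mem_range.1 hj
      rw [hB j _ (by lia), smul_zero])
  map_add' C D := field_ext fun k v => by
    obtain ⟨N, h⟩ := exists_nat_bound' A v
    simp only [map_add, Pi.add_apply, LinearMap.add_apply, mkField_ncoeff, LinearMap.coe_mk,
      AddHom.coe_mk]
    rw [rightMode_eq h, rightMode_eq h, rightMode_eq h, ← Finset.sum_add_distrib]
    simp only [map_add, Pi.add_apply, LinearMap.add_apply, smul_add]
  map_smul' a C := field_ext fun k v => by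
    obtain ⟨N, h⟩ := exists_nat_bound' A v
    simp only [map_smul, Pi.smul_apply, LinearMap.smul_apply, mkField_ncoeff, LinearMap.coe_mk,
      AddHom.coe_mk, RingHom.id_apply]
    rw [rightMode_eq h, rightMode_eq h, Finset.smul_sum]
    simp only [map_smul, Pi.smul_apply, LinearMap.smul_apply, smul_comm a]

theorem leftMul_apply (A C : VertexOperator ℂ V) (m k : ℤ) (v : V) :
    ((leftMul A m C)[[k]]) v = leftMode A C m k v := by
  simp [leftMul]

theorem rightMul_apply (A C : VertexOperator ℂ V) (m k : ℤ) (v : V) :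
    ((rightMul A m C)[[k]]) v = rightMode A C m k v := by
  simp [rightMul]

end Fields

section Commutators

variable {V : Type*} [AddCommGroup V] [Module ℂ V]

theorem sum_square {M : Type*} [AddCommMonoid M] (f : ℕ → ℕ → M) (N : ℕ)
    (h : ∀ i j, N ≤ i + j → f i j = 0) :
    ∑ i ∈ Finset.range N, ∑ j ∈ Finset.range N, f i j =
      ∑ s ∈ Finset.range N, ∑ p ∈ Finset.HasAntidiagonal.antidiagonal s, f p.1 p.2 := by
  simp only [Finset.Nat.sum_antidiagonal_eq_sum_range_succ f]
  rw [Finset.sum_range_diag_flip]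
  refine Finset.sum_congr rfl fun i _ => ?_
  symm
  refine Finset.sum_subset (fun j hj => ?_) fun j _ hj => ?_
  · simp only [Finset.mem_range] at hj ⊢
    lia
  · simp only [Finset.mem_range] at hj
    exact h i j (by lia)

theorem choose_mul_choose_sub (m : ℤ) (i l : ℕ) :
    Ring.choose m i * Ring.choose (m - i) l = Ring.choose m l * Ring.choose (m - l) i := by
  have h₁ := Ring.choose_smul_choose m (n := i + l) (k := i) (by lia)
  have h₂ := Ring.choose_smul_choose m (n := i + l) (k := l) (by lia)
  have h₃ : (i + l).choose i = (i + l).choose l := Nat.choose_symm_add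
  rw [Nat.add_sub_cancel_left] at h₁
  rw [Nat.add_sub_cancel] at h₂
  rw [← h₁, ← h₂, h₃]

theorem vandermonde_left (m n : ℤ) (l s : ℕ) :
    ∑ p ∈ Finset.HasAntidiagonal.antidiagonal s, ((-1) ^ p.1 * Ring.choose m p.1 : ℤ) *
        ((-1) ^ p.2 * Ring.choose n p.2) * Ring.choose (m - p.1) l =
      Ring.choose m l * ((-1) ^ s * Ring.choose (m + n - l) s) := by
  have h : m + n - l = (m - l) + n := by ring
  rw [h, Ring.add_choose_eq s (Commute.all (m - l : ℤ) n), Finset.mul_sum, Finset.mul_sum]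
  refine Finset.sum_congr rfl fun p hp => ?_
  rw [← Finset.HasAntidiagonal.mem_antidiagonal.1 hp, pow_add]
  linear_combination ((-1) ^ p.1 * (-1) ^ p.2 * Ring.choose n p.2 : ℤ) *
    choose_mul_choose_sub m p.1 l

theorem sum_swap {M ι : Type*} [AddCommMonoid M] [Fintype ι] (N : ℕ) (F : ℕ → ℕ → ι → M) :
    ∑ i ∈ Finset.range N, ∑ j ∈ Finset.range N, ∑ t, F i j t =
      ∑ t, ∑ i ∈ Finset.range N, ∑ j ∈ Finset.range N, F i j t := by
  rw [Finset.sum_comm (s := Finset.univ)]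
  exact Finset.sum_congr rfl fun i _ => Finset.sum_comm

variable {ι : Type*} [Fintype ι] {A B : VertexOperator ℂ V} {ε : ℂ} {κ : ι → ℂ} {l : ι → ℕ}
  {D : ι → VertexOperator ℂ V}

theorem leftMul_comm
    (H : ∀ (m n : ℤ) (v : V), (A[[m]]) ((B[[n]]) v) - ε • (B[[n]]) ((A[[m]]) v) =
      ∑ t, κ t • Ring.choose m (l t) • ((D t)[[m + n - l t]]) v)
    (m n : ℤ) (C : VertexOperator ℂ V) :
    leftMul A m (leftMul B n C) - ε • leftMul B n (leftMul A m C) =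
      ∑ t, κ t • Ring.choose m (l t) • leftMul (D t) (m + n - l t) C := by
  refine field_ext fun k v => ?_
  obtain ⟨N, hN⟩ := exists_nat_bound C k v
  have key : ∀ (A B : VertexOperator ℂ V) (m n : ℤ),
      ((leftMul A m (leftMul B n C))[[k]]) v = ∑ i ∈ Finset.range N, ∑ j ∈ Finset.range N,
        (((-1) ^ i * Ring.choose m i : ℤ) * ((-1) ^ j * Ring.choose n j)) •
          (A[[m - i]]) ((B[[n - j]]) ((C[[k + (i + j : ℕ)]]) v)) := by
    intro A B m n
    have h₁ : ∀ i : ℕ, ((leftMul B n C)[[k + i]]) v = ∑ j ∈ Finset.range N,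
        ((-1) ^ j * Ring.choose n j : ℤ) • (B[[n - j]]) ((C[[k + (i + j : ℕ)]]) v) := by
      intro i
      rw [leftMul_apply, leftMode_eq (N := N)]
      · simp only [Nat.cast_add, add_assoc]
      · intro j hj
        have := hN (i + j) (by lia)
        rwa [Nat.cast_add, ← add_assoc] at this
    rw [leftMul_apply, leftMode_eq (N := N)]
    · simp only [h₁, map_sum, map_zsmul, Finset.smul_sum, smul_smul]
    · intro i hi
      rw [h₁]
      refine Finset.sum_eq_zero fun j _ => ?_
      rw [hN (i + j) (by lia), map_zero, smul_zero]
  simp only [map_sub, map_sum, map_smul, map_zsmul, Pi.sub_apply, Pi.smul_apply, Finset.sum_apply,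
    LinearMap.sub_apply, LinearMap.smul_apply, LinearMap.coe_sum, key]
  rw [Finset.sum_comm (s := Finset.range N) (t := Finset.range N) (f := fun i j =>
    (((-1) ^ i * Ring.choose n i : ℤ) * ((-1) ^ j * Ring.choose m j)) •
          (B[[n - i]]) ((A[[m - j]]) ((C[[k + (i + j : ℕ)]]) v)))]
  rw [Finset.smul_sum, ← Finset.sum_sub_distrib]
  simp only [Finset.smul_sum, ← Finset.sum_sub_distrib]
  have step : ∀ i j : ℕ,
      (((-1) ^ i * Ring.choose m i : ℤ) * ((-1) ^ j * Ring.choose n j)) •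
          (A[[m - i]]) ((B[[n - j]]) ((C[[k + (i + j : ℕ)]]) v)) -
      ε • (((-1) ^ j * Ring.choose n j : ℤ) * ((-1) ^ i * Ring.choose m i)) •
          (B[[n - j]]) ((A[[m - i]]) ((C[[k + (j + i : ℕ)]]) v)) =
      ∑ t, κ t • ((((-1) ^ i * Ring.choose m i : ℤ) * ((-1) ^ j * Ring.choose n j) *
        Ring.choose (m - i) (l t)) •
          ((D t)[[m + n - l t - (i + j : ℕ)]]) ((C[[k + (i + j : ℕ)]]) v)) := by
    intro i j
    rw [add_comm j i, mul_comm ((-1) ^ j * Ring.choose n j : ℤ), smul_comm ε, ← smul_sub, H,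
      Finset.smul_sum]
    refine Finset.sum_congr rfl fun t _ => ?_
    rw [smul_comm _ (κ t), smul_smul]
    have e : m - i + (n - j) - l t = m + n - l t - (i + j : ℕ) := by push_cast; ring
    rw [e]
  simp only [step]
  rw [sum_swap]
  refine Finset.sum_congr rfl fun t _ => ?_
  simp only [← Finset.smul_sum]
  congr 1
  rw [leftMul_apply, leftMode_eq hN, Finset.smul_sum, sum_square]
  · refine Finset.sum_congr rfl fun s _ => ?_
    rw [smul_smul, ← vandermonde_left, Finset.sum_smul]
    refine Finset.sum_congr rfl fun p hp => ?_
    rw [Finset.HasAntidiagonal.mem_antidiagonal.1 hp]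
  · intro i j hij
    rw [hN _ hij, map_zero, smul_zero]

theorem exists_nat_bound₂ (A B : VertexOperator ℂ V) (v : V) :
    ∃ N : ℕ, ∀ i j : ℕ, N ≤ i ∨ N ≤ j → (A[[(i : ℤ)]]) ((B[[(j : ℤ)]]) v) = 0 := by
  obtain ⟨N, hN⟩ := exists_nat_bound' B v
  choose K hK using fun j : ℕ => exists_nat_bound' A ((B[[(j : ℤ)]]) v)
  refine ⟨N + ∑ j ∈ Finset.range N, K j, fun i j hij => ?_⟩
  by_cases hj : N ≤ j
  · rw [hN j hj, map_zero]
  · have h : K j ≤ ∑ j ∈ Finset.range N, K j :=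
      Finset.single_le_sum (f := K) (fun _ _ => Nat.zero_le _) (by simpa using hj)
    exact hK j i (by lia)

theorem vandermonde_right (m n : ℤ) (l s : ℕ) :
    ∑ p ∈ Finset.HasAntidiagonal.antidiagonal (l + s),
        (((m + p.1).negOnePow : ℤ) * Ring.choose m p.1) *
        (((n + p.2).negOnePow : ℤ) * Ring.choose n p.2) * Ring.choose (p.1 : ℤ) l =
      Ring.choose m l * (((m + n - l + s).negOnePow : ℤ) * Ring.choose (m + n - l) s) := by
  have h₀ : m + n - l = (m - l) + n := by ring
  rw [Finset.Nat.sum_antidiagonal_eq_sum_range_succ (fun i j =>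
      (((m + i).negOnePow : ℤ) * Ring.choose m i) * (((n + j).negOnePow : ℤ) * Ring.choose n j) *
        Ring.choose (i : ℤ) l), Nat.succ_eq_add_one, add_assoc, Finset.sum_range_add,
    Finset.sum_eq_zero, zero_add, h₀, Ring.add_choose_eq s (Commute.all (m - l : ℤ) n),
    Finset.Nat.sum_antidiagonal_eq_sum_range_succ (fun i j =>
      Ring.choose (m - l : ℤ) i * Ring.choose n j), Finset.mul_sum, Finset.mul_sum]
  · refine Finset.sum_congr rfl fun x hx => ?_
    have hxs := Finset.mem_range.1 hx
    have e : l + s - (l + x) = s - x := by lia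
    have hs : (((m + (l + x : ℕ)).negOnePow : ℤ)) * ((n + (s - x : ℕ)).negOnePow : ℤ) =
        (((m - l) + n + s).negOnePow : ℤ) := by
      rw [← Units.val_mul, ← Int.negOnePow_add]
      congr 1
      rw [Int.negOnePow_eq_iff]
      exact ⟨l, by push_cast [Nat.le_of_lt_succ hxs]; ring⟩
    have hc := Ring.choose_smul_choose m (n := l + x) (k := l) (by lia)
    rw [Nat.add_sub_cancel_left, nsmul_eq_mul] at hc
    rw [e, ← hs, Ring.choose_natCast]
    linear_combination (((m + (l + x : ℕ)).negOnePow : ℤ)) * ((n + (s - x : ℕ)).negOnePow : ℤ) *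
      Ring.choose n (s - x) * hc
  · intro i hi
    rw [Ring.choose_natCast, Nat.choose_eq_zero_of_lt (Finset.mem_range.1 hi), Nat.cast_zero,
      mul_zero]

theorem vandermonde_right' (m n : ℤ) (l s : ℕ) (h : s < l) :
    ∑ p ∈ Finset.HasAntidiagonal.antidiagonal s,
        (((m + p.1).negOnePow : ℤ) * Ring.choose m p.1) *
        (((n + p.2).negOnePow : ℤ) * Ring.choose n p.2) * Ring.choose (p.1 : ℤ) l = 0 := by
  refine Finset.sum_eq_zero fun p hp => ?_
  have := Finset.HasAntidiagonal.mem_antidiagonal.1 hp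
  rw [Ring.choose_natCast, Nat.choose_eq_zero_of_lt (by lia), Nat.cast_zero, mul_zero]

theorem rightMul_comm
    (H : ∀ (m n : ℤ) (v : V), (A[[m]]) ((B[[n]]) v) - ε • (B[[n]]) ((A[[m]]) v) =
      ∑ t, κ t • Ring.choose m (l t) • ((D t)[[m + n - l t]]) v)
    (m n : ℤ) (C : VertexOperator ℂ V) :
    rightMul B n (rightMul A m C) - ε • rightMul A m (rightMul B n C) =
      ∑ t, κ t • Ring.choose m (l t) • rightMul (D t) (m + n - l t) C := by
  refine field_ext fun k v => ?_
  obtain ⟨N₁, h₁⟩ := exists_nat_bound₂ A B v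
  obtain ⟨N₂, h₂⟩ := exists_nat_bound₂ B A v
  obtain ⟨N₃, h₃⟩ := exists_nat_bound' A v
  obtain ⟨N₄, h₄⟩ := exists_nat_bound' B v
  choose K hK using fun t => exists_nat_bound' (D t) v
  obtain ⟨N, hN₁, hN₂, hN₃, hN₄, hN⟩ : ∃ N, N₁ ≤ N ∧ N₂ ≤ N ∧ N₃ ≤ N ∧ N₄ ≤ N ∧
      ∀ t, K t + l t ≤ N := by
    refine ⟨N₁ + N₂ + N₃ + N₄ + ∑ t, (K t + l t), by lia, by lia, by lia, by lia, fun t => ?_⟩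
    have : K t + l t ≤ ∑ t, (K t + l t) :=
      Finset.single_le_sum (f := fun t => K t + l t) (fun _ _ => Nat.zero_le _) (Finset.mem_univ t)
    lia
  have key : ∀ (A B : VertexOperator ℂ V) (m n : ℤ) (h : ∀ j ≥ N, (B[[((j : ℕ) : ℤ)]]) v = 0)
      (h' : ∀ i j : ℕ, N ≤ i ∨ N ≤ j → (A[[(i : ℤ)]]) ((B[[(j : ℤ)]]) v) = 0),
      ((rightMul B n (rightMul A m C))[[k]]) v = ∑ j ∈ Finset.range N, ∑ i ∈ Finset.range N,
        ((((n + j).negOnePow : ℤ) * Ring.choose n j) * (((m + i).negOnePow : ℤ) * Ring.choose m i)) •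
          (C[[m + n + k - (i + j : ℕ)]]) ((A[[(i : ℤ)]]) ((B[[(j : ℤ)]]) v)) := by
    intro A B m n h h'
    rw [rightMul_apply, rightMode_eq h]
    refine Finset.sum_congr rfl fun j _ => ?_
    rw [rightMul_apply, rightMode_eq (N := N) (fun i hi => h' i j (Or.inl hi)), Finset.smul_sum]
    refine Finset.sum_congr rfl fun i _ => ?_
    have e : m + (n + k - j) - i = m + n + k - (i + j : ℕ) := by push_cast; ring
    rw [smul_smul, e]
  simp only [map_sub, map_sum, map_smul, map_zsmul, Pi.sub_apply, Pi.smul_apply, Finset.sum_apply,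
    LinearMap.sub_apply, LinearMap.smul_apply, LinearMap.coe_sum]
  rw [key A B m n (fun j hj => h₄ j (by lia)) (fun i j hij => h₁ i j (by lia)),
    key B A n m (fun j hj => h₃ j (by lia)) (fun i j hij => h₂ i j (by lia)), Finset.sum_comm]
  rw [Finset.smul_sum, ← Finset.sum_sub_distrib]
  simp only [Finset.smul_sum, ← Finset.sum_sub_distrib]
  have step : ∀ i j : ℕ,
      ((((n + j).negOnePow : ℤ) * Ring.choose n j) * (((m + i).negOnePow : ℤ) * Ring.choose m i)) •
          (C[[m + n + k - (i + j : ℕ)]]) ((A[[(i : ℤ)]]) ((B[[(j : ℤ)]]) v)) -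
      ε • ((((m + i).negOnePow : ℤ) * Ring.choose m i) *
          (((n + j).negOnePow : ℤ) * Ring.choose n j)) •
          (C[[n + m + k - (j + i : ℕ)]]) ((B[[(j : ℤ)]]) ((A[[(i : ℤ)]]) v)) =
      ∑ t, κ t • (((((m + i).negOnePow : ℤ) * Ring.choose m i) *
          (((n + j).negOnePow : ℤ) * Ring.choose n j) * Ring.choose (i : ℤ) (l t)) •
          (C[[m + n + k - (i + j : ℕ)]]) (((D t)[[((i + j : ℕ) : ℤ) - l t]]) v)) := by
    intro i j
    rw [add_comm j i, add_comm n m, mul_comm (((n + j).negOnePow : ℤ) * Ring.choose n j),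
      smul_comm ε, ← smul_sub, ← map_smul (_ : Module.End ℂ V), ← map_sub (_ : Module.End ℂ V), H,
      map_sum, Finset.smul_sum]
    refine Finset.sum_congr rfl fun t _ => ?_
    rw [map_smul, map_zsmul, smul_comm _ (κ t), smul_smul, Nat.cast_add]
  simp only [step]
  rw [sum_swap]
  refine Finset.sum_congr rfl fun t _ => ?_
  simp only [← Finset.smul_sum]
  congr 1
  have hl : ∀ s, N ≤ s → ((D t)[[(s : ℤ) - l t]]) v = 0 := by
    intro s hs
    have := hN t
    have e : (s : ℤ) - l t = ((s - l t : ℕ) : ℤ) := by lia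
    rw [e]
    exact hK t _ (by lia)
  rw [sum_square]
  · obtain ⟨r, rfl⟩ : ∃ r, N = l t + r := ⟨N - l t, by have := hN t; lia⟩
    rw [rightMul_apply, rightMode_eq (N := r) (fun j hj => hK t j (by have := hN t; lia)),
      Finset.smul_sum, Finset.sum_range_add]
    have hfac : ∀ s : ℕ, (∑ p ∈ Finset.HasAntidiagonal.antidiagonal s,
        ((((m + p.1).negOnePow : ℤ) * Ring.choose m p.1) *
          (((n + p.2).negOnePow : ℤ) * Ring.choose n p.2) * Ring.choose (p.1 : ℤ) (l t)) •
          (C[[m + n + k - (p.1 + p.2 : ℕ)]]) (((D t)[[((p.1 + p.2 : ℕ) : ℤ) - l t]]) v)) =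
        (∑ p ∈ Finset.HasAntidiagonal.antidiagonal s,
          (((m + p.1).negOnePow : ℤ) * Ring.choose m p.1) *
          (((n + p.2).negOnePow : ℤ) * Ring.choose n p.2) * Ring.choose (p.1 : ℤ) (l t)) •
          (C[[m + n + k - s]]) (((D t)[[(s : ℤ) - l t]]) v) := by
      intro s
      rw [Finset.sum_smul]
      refine Finset.sum_congr rfl fun p hp => ?_
      rw [Finset.HasAntidiagonal.mem_antidiagonal.1 hp]
    simp only [hfac]
    rw [Finset.sum_eq_zero, zero_add]
    · refine Finset.sum_congr rfl fun s _ => ?_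
      rw [vandermonde_right, smul_smul]
      have e₁ : m + n + k - (l t + s : ℕ) = m + n - l t + k - s := by push_cast; ring
      have e₂ : ((l t + s : ℕ) : ℤ) - l t = s := by push_cast; ring
      rw [e₁, e₂]
    · intro s hs
      rw [vandermonde_right' _ _ _ _ (Finset.mem_range.1 hs), zero_smul]
  · intro i j hij
    rw [hl _ hij, map_zero, smul_zero]

theorem leftMul_rightMul (A B C : VertexOperator ℂ V) (m n : ℤ) :
    leftMul A m (rightMul B n C) = rightMul B n (leftMul A m C) := by
  refine field_ext fun k v => ?_
  obtain ⟨N₁, h₁⟩ := exists_nat_bound' B v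
  choose K hK using fun j : ℕ => exists_nat_bound C (n + k - j) ((B[[(j : ℤ)]]) v)
  obtain ⟨N, hN₁, hN⟩ : ∃ N, N₁ ≤ N ∧ ∀ j < N₁, K j ≤ N := by
    refine ⟨N₁ + ∑ j ∈ Finset.range N₁, K j, by lia, fun j hj => ?_⟩
    have h : K j ≤ ∑ j ∈ Finset.range N₁, K j :=
      Finset.single_le_sum (f := K) (fun _ _ => Nat.zero_le _) (by simpa using hj)
    lia
  have hC : ∀ i j : ℕ, N ≤ i → (C[[n + k - j + i]]) ((B[[(j : ℤ)]]) v) = 0 := by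
    intro i j hi
    by_cases hj : j < N₁
    · exact hK j i (by have := hN j hj; lia)
    · rw [h₁ j (by lia), map_zero]
  have e : ∀ i : ℕ, ((rightMul B n C)[[k + i]]) v = ∑ j ∈ Finset.range N,
      (((n + j).negOnePow : ℤ) * Ring.choose n j) •
        (C[[n + k - j + i]]) ((B[[(j : ℤ)]]) v) := by
    intro i
    rw [rightMul_apply, rightMode_eq (N := N) (fun j hj => h₁ j (by lia))]
    refine Finset.sum_congr rfl fun j _ => ?_
    have e : n + (k + i) - j = n + k - j + i := by ring
    rw [e]
  rw [leftMul_apply, leftMode_eq (N := N), rightMul_apply,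
    rightMode_eq (N := N) (fun j hj => h₁ j (by lia))]
  · simp only [e]
    simp only [map_sum, map_zsmul, Finset.smul_sum]
    rw [Finset.sum_comm]
    refine Finset.sum_congr rfl fun j _ => ?_
    rw [leftMul_apply, leftMode_eq (fun i hi => hC i j hi), Finset.smul_sum]
    exact Finset.sum_congr rfl fun i _ => smul_comm _ _ _
  · intro i hi
    rw [e]
    exact Finset.sum_eq_zero fun j _ => by rw [hC i j hi, smul_zero]

end Commutators

section Twist

variable {V : Type*} [AddCommGroup V] [Module ℂ V]

/-- Conjugation `C(z) ↦ σ C(z) σ` of fields by a linear map `σ`. -/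
def twist (σ : V →ₗ[ℂ] V) : VertexOperator ℂ V →ₗ[ℂ] VertexOperator ℂ V where
  toFun C := mkField (fun n => σ ∘ₗ (C[[n]]) ∘ₗ σ) (fun v => by
    obtain ⟨N, hN⟩ := field_trunc C (σ v)
    exact ⟨N, fun n hn => by simp [hN n hn]⟩)
  map_add' C D := field_ext fun n v => by simp
  map_smul' a C := field_ext fun n v => by simp

/-- The `m`-th product `C ↦ A₍ₘ₎C` with a field `A` of parity `p`:
`A₍ₘ₎C (z) = Res_w (A(w) C(z) (w - z)ᵐ - (-1)^{p |C|} C(z) A(w) (w - z)ᵐ)`, where the two powers are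
expanded in the domains `|w| > |z|` and `|z| > |w|`. -/
def fieldProduct (σ : V →ₗ[ℂ] V) (p : ℕ) (A : VertexOperator ℂ V) (m : ℤ) :
    Module.End ℂ (VertexOperator ℂ V) :=
  leftMul A m - rightMul A m ∘ₗ (twist σ) ^ p

/-- The identity field. -/
def oneField (V : Type*) [AddCommGroup V] [Module ℂ V] : VertexOperator ℂ V :=
  mkField (fun n => if n = -1 then LinearMap.id else 0)
    (fun v => ⟨0, fun n hn => by rw [if_neg (by lia), LinearMap.zero_apply]⟩)

theorem oneField_apply (n : ℤ) (v : V) : ((oneField V)[[n]]) v = if n = -1 then v else 0 := by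
  rw [oneField, mkField_ncoeff]
  split <;> rfl

/-- The derivative of a field. -/
def derivField (A : VertexOperator ℂ V) : VertexOperator ℂ V :=
  mkField (fun n => (-n) • (A[[n - 1]])) (fun v => by
    obtain ⟨N, hN⟩ := field_trunc A v
    exact ⟨N + 1, fun n hn => by rw [LinearMap.smul_apply, hN _ (by lia), smul_zero]⟩)

theorem derivField_apply (A : VertexOperator ℂ V) (n : ℤ) (v : V) :
    ((derivField A)[[n]]) v = (-n) • (A[[n - 1]]) v := by
  rw [derivField, mkField_ncoeff, LinearMap.smul_apply]

variable {σ : V →ₗ[ℂ] V}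

theorem twist_apply (C : VertexOperator ℂ V) (n : ℤ) (v : V) :
    ((twist σ C)[[n]]) v = σ ((C[[n]]) (σ v)) := by
  simp [twist]

theorem twist_sq (hσ : ∀ v, σ (σ v) = v) : (twist σ) ^ 2 = 1 := by
  refine LinearMap.ext fun C => field_ext fun n v => ?_
  rw [pow_two, Module.End.mul_apply, twist_apply, twist_apply, hσ, hσ, Module.End.one_apply]

theorem twist_oneField (hσ : ∀ v, σ (σ v) = v) : twist σ (oneField V) = oneField V := by
  refine field_ext fun n v => ?_
  rw [twist_apply, oneField_apply, oneField_apply]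
  split
  · exact hσ v
  · exact map_zero σ

theorem twist_leftMul {A : VertexOperator ℂ V} {s : ℂ}
    (hA : ∀ n v, σ ((A[[n]]) v) = s • (A[[n]]) (σ v)) (m : ℤ) (C : VertexOperator ℂ V) :
    twist σ (leftMul A m C) = s • leftMul A m (twist σ C) := by
  refine field_ext fun k v => ?_
  obtain ⟨N, hN⟩ := exists_nat_bound C k (σ v)
  rw [twist_apply, leftMul_apply, leftMode_eq hN, map_sum, map_smul, Pi.smul_apply,
    LinearMap.smul_apply, leftMul_apply, leftMode_eq (N := N)
      (fun j hj => by rw [twist_apply, hN j hj, map_zero]), Finset.smul_sum]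
  refine Finset.sum_congr rfl fun j _ => ?_
  rw [map_zsmul, hA, twist_apply, smul_comm s]

theorem twist_rightMul {A : VertexOperator ℂ V} {s : ℂ} (hs : s * s = 1)
    (hA : ∀ n v, σ ((A[[n]]) v) = s • (A[[n]]) (σ v)) (m : ℤ) (C : VertexOperator ℂ V) :
    twist σ (rightMul A m C) = s • rightMul A m (twist σ C) := by
  have hA' : ∀ n v, (A[[n]]) (σ v) = s • σ ((A[[n]]) v) := fun n v => by
    rw [hA, smul_smul, hs, one_smul]
  refine field_ext fun k v => ?_
  obtain ⟨N, hN⟩ := exists_nat_bound' A v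
  rw [twist_apply, rightMul_apply, rightMode_eq (N := N)
    (fun j hj => by rw [hA', hN j hj, map_zero, smul_zero]), map_sum, map_smul, Pi.smul_apply,
    LinearMap.smul_apply, rightMul_apply, rightMode_eq hN, Finset.smul_sum]
  refine Finset.sum_congr rfl fun j _ => ?_
  rw [map_zsmul, hA', map_smul, map_smul, twist_apply, smul_comm s]

theorem twist_pow_leftMul {A : VertexOperator ℂ V} {s : ℂ}
    (hA : ∀ n v, σ ((A[[n]]) v) = s • (A[[n]]) (σ v)) (m : ℤ) (p : ℕ) (C : VertexOperator ℂ V) :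
    (twist σ ^ p) (leftMul A m C) = s ^ p • leftMul A m ((twist σ ^ p) C) := by
  induction p with
  | zero => simp
  | succ p ih =>
    rw [pow_succ', Module.End.mul_apply, ih, map_smul, twist_leftMul hA, smul_smul,
      Module.End.mul_apply, pow_succ]

theorem twist_pow_rightMul {A : VertexOperator ℂ V} {s : ℂ}
    (hs : s * s = 1) (hA : ∀ n v, σ ((A[[n]]) v) = s • (A[[n]]) (σ v)) (m : ℤ) (p : ℕ)
    (C : VertexOperator ℂ V) :
    (twist σ ^ p) (rightMul A m C) = s ^ p • rightMul A m ((twist σ ^ p) C) := by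
  induction p with
  | zero => simp
  | succ p ih =>
    rw [pow_succ', Module.End.mul_apply, ih, map_smul, twist_rightMul hs hA, smul_smul,
      Module.End.mul_apply, pow_succ]

theorem fieldProduct_apply (σ : V →ₗ[ℂ] V) (p : ℕ) (A : VertexOperator ℂ V) (m : ℤ)
    (C : VertexOperator ℂ V) :
    fieldProduct σ p A m C = leftMul A m C - rightMul A m ((twist σ ^ p) C) := rfl

theorem fieldProduct_comm {ι : Type*} [Fintype ι]
    {A B : VertexOperator ℂ V} {p q : ℕ} {κ : ι → ℂ} {l : ι → ℕ} {D : ι → VertexOperator ℂ V}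
    (hA : ∀ n v, σ ((A[[n]]) v) = (-1 : ℂ) ^ p • (A[[n]]) (σ v))
    (hB : ∀ n v, σ ((B[[n]]) v) = (-1 : ℂ) ^ q • (B[[n]]) (σ v))
    (H : ∀ (m n : ℤ) (v : V),
      (A[[m]]) ((B[[n]]) v) - (-1 : ℂ) ^ (p * q) • (B[[n]]) ((A[[m]]) v) =
      ∑ t, κ t • Ring.choose m (l t) • ((D t)[[m + n - l t]]) v) (m n : ℤ) :
    fieldProduct σ p A m * fieldProduct σ q B n -
        (-1 : ℂ) ^ (p * q) • (fieldProduct σ q B n * fieldProduct σ p A m) =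
      ∑ t, κ t • Ring.choose m (l t) • fieldProduct σ (p + q) (D t) (m + n - l t) := by
  refine LinearMap.ext fun C => ?_
  have sq : ∀ r : ℕ, (-1 : ℂ) ^ r * (-1) ^ r = 1 := fun r => by
    rw [← mul_pow]; simp
  have h₁ := leftMul_comm H m n C
  have h₂ := rightMul_comm H m n ((twist σ ^ (p + q)) C)
  have e₁ : (twist σ ^ (p + q)) C = (twist σ ^ p) ((twist σ ^ q) C) := by
    rw [pow_add, Module.End.mul_apply]
  have e₂ : (twist σ ^ (p + q)) C = (twist σ ^ q) ((twist σ ^ p) C) := by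
    rw [add_comm, pow_add, Module.End.mul_apply]
  simp only [LinearMap.sub_apply, LinearMap.smul_apply, Module.End.mul_apply, LinearMap.coe_sum,
    Finset.sum_apply, fieldProduct_apply, smul_sub, Finset.sum_sub_distrib]
  rw [← h₁, ← h₂]
  simp only [map_sub, twist_pow_leftMul hA, twist_pow_leftMul hB,
    twist_pow_rightMul (sq p) hA, twist_pow_rightMul (sq q) hB, map_smul, ← e₁, ← e₂,
    leftMul_rightMul, smul_sub, smul_smul, ← pow_mul, mul_comm q p, sq]
  module

theorem leftMul_derivField (A C : VertexOperator ℂ V) (m : ℤ) :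
    leftMul (derivField A) m C = (-m) • leftMul A (m - 1) C := by
  refine field_ext fun k v => ?_
  obtain ⟨N, hN⟩ := exists_nat_bound C k v
  rw [leftMul_apply, leftMode_eq hN, map_zsmul, Pi.smul_apply, LinearMap.smul_apply, leftMul_apply,
    leftMode_eq hN, Finset.smul_sum]
  refine Finset.sum_congr rfl fun j _ => ?_
  have h := choose_mul_choose_sub m j 1
  rw [Ring.choose_one_right, Ring.choose_one_right] at h
  have e : m - j - 1 = m - 1 - j := by ring
  rw [derivField_apply, smul_smul, smul_smul, e]
  congr 1
  rw [Nat.cast_one] at h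
  linear_combination (-(-1) ^ j : ℤ) * h

theorem rightMul_derivField (A C : VertexOperator ℂ V) (m : ℤ) :
    rightMul (derivField A) m C = (-m) • rightMul A (m - 1) C := by
  refine field_ext fun k v => ?_
  obtain ⟨N, hN⟩ := exists_nat_bound' A v
  have h' : ∀ j ≥ N + 1, ((derivField A)[[((j : ℕ) : ℤ)]]) v = 0 := by
    intro j hj
    have e : (j : ℤ) - 1 = ((j - 1 : ℕ) : ℤ) := by lia
    rw [derivField_apply, e, hN _ (by lia), smul_zero]
  rw [rightMul_apply, rightMode_eq h', map_zsmul, Pi.smul_apply, LinearMap.smul_apply,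
    rightMul_apply, rightMode_eq hN, Finset.smul_sum, Finset.sum_range_succ']
  rw [derivField_apply]
  simp only [Nat.cast_zero, neg_zero, zero_smul, map_zero, smul_zero, add_zero]
  refine Finset.sum_congr rfl fun j _ => ?_
  have h := Ring.choose_smul_choose m (n := j + 1) (k := 1) (by lia)
  rw [Ring.choose_one_right, Nat.choose_one_right, Nat.add_sub_cancel, nsmul_eq_mul,
    Nat.cast_one] at h
  have e₁ : m + k - (j + 1 : ℕ) = m - 1 + k - j := by push_cast; ring
  have e₂ : ((j + 1 : ℕ) : ℤ) - 1 = j := by push_cast; ring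
  have e₃ : ((m + (j + 1 : ℕ)).negOnePow : ℤ) = ((m - 1 + j).negOnePow : ℤ) := by
    congr 1
    rw [Int.negOnePow_eq_iff]
    exact ⟨1, by push_cast; ring⟩
  rw [derivField_apply, e₁, e₂, e₃, map_zsmul, smul_smul, smul_smul]
  congr 1
  linear_combination (-((m - 1 + j).negOnePow : ℤ)) * h

theorem fieldProduct_derivField (p : ℕ) (A : VertexOperator ℂ V) (m : ℤ) :
    fieldProduct σ p (derivField A) m = (-m) • fieldProduct σ p A (m - 1) := by
  refine LinearMap.ext fun C => ?_
  rw [fieldProduct_apply, LinearMap.smul_apply, fieldProduct_apply, leftMul_derivField,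
    rightMul_derivField, smul_sub]

theorem leftMul_oneField (C : VertexOperator ℂ V) (m : ℤ) :
    leftMul (oneField V) m C = if m = -1 then C else 0 := by
  refine field_ext fun k v => ?_
  obtain ⟨N, hN⟩ := exists_nat_bound C k v
  rw [leftMul_apply, leftMode_eq (N := N + 1) (fun j hj => hN j (by lia))]
  simp only [oneField_apply]
  split_ifs with hm
  · subst hm
    rw [Finset.sum_eq_single_of_mem 0 (by simp)]
    · simp
    · intro j _ hj
      rw [if_neg (by lia), smul_zero]
  · rw [map_zero, Pi.zero_apply, LinearMap.zero_apply]
    refine Finset.sum_eq_zero fun j _ => ?_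
    split_ifs with h
    · obtain ⟨i, rfl⟩ : ∃ i : ℕ, m = i := ⟨(j - 1 : ℕ), by lia⟩
      rw [Ring.choose_natCast, Nat.choose_eq_zero_of_lt (by lia), Nat.cast_zero, mul_zero,
        zero_smul]
    · rw [smul_zero]

theorem rightMul_oneField (C : VertexOperator ℂ V) (m : ℤ) : rightMul (oneField V) m C = 0 := by
  refine field_ext fun k v => ?_
  rw [rightMul_apply, rightMode_eq (N := 0)
    (fun j _ => by rw [oneField_apply, if_neg (by lia)])]
  simp

theorem fieldProduct_oneField (p : ℕ) (m : ℤ) :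
    fieldProduct σ p (oneField V) m = if m = -1 then 1 else 0 := by
  refine LinearMap.ext fun C => ?_
  rw [fieldProduct_apply, leftMul_oneField, rightMul_oneField, sub_zero]
  split <;> rfl

theorem fieldProduct_apply_oneField (hσ : ∀ v, σ (σ v) = v) (p : ℕ) (A : VertexOperator ℂ V)
    {m : ℤ} (hm : 0 ≤ m) : fieldProduct σ p A m (oneField V) = 0 := by
  have htw : (twist σ ^ p) (oneField V) = oneField V := by
    induction p with
    | zero => rfl
    | succ p ih => rw [pow_succ', Module.End.mul_apply, ih, twist_oneField hσ]
  obtain ⟨m, rfl⟩ := Int.eq_ofNat_of_zero_le hm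
  rw [fieldProduct_apply, htw, sub_eq_zero]
  refine field_ext fun k v => ?_
  obtain ⟨N, hN⟩ := exists_nat_bound' A v
  obtain ⟨N', hN'⟩ := exists_nat_bound (oneField V) k v
  rw [leftMul_apply, rightMul_apply,
    leftMode_eq (N := N' + m + 1) (fun j hj => hN' j (by lia)),
    rightMode_eq (N := N + m + 1) (fun j hj => hN j (by lia))]
  simp only [oneField_apply, Ring.choose_natCast]
  by_cases hk : k ≤ -1 ∧ 0 ≤ m + k + 1
  · obtain ⟨i, hi⟩ : ∃ i : ℕ, k = -1 - i := ⟨(-1 - k).toNat, by lia⟩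
    subst hi
    have him : i ≤ m := by lia
    rw [Finset.sum_eq_single_of_mem i (by simp; lia), Finset.sum_eq_single_of_mem (m - i) (by simp; lia)]
    · rw [if_pos (by ring), if_pos (by push_cast [him]; ring), Nat.choose_symm him]
      have e₁ : (((m : ℤ) + (m - i : ℕ)).negOnePow : ℤ) = (-1) ^ i := by
        have e : ((m : ℤ) + (m - i : ℕ)).negOnePow = (i : ℤ).negOnePow := by
          rw [Int.negOnePow_eq_iff]
          exact ⟨m - i, by push_cast [him]; ring⟩
        rw [e, Int.negOnePow_def, zpow_natCast]
        simp
      rw [e₁, Nat.cast_sub him]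
    · intro j _ hj
      rw [if_neg (by lia), smul_zero]
    · intro j _ hj
      rw [if_neg (by lia), map_zero, smul_zero]
  · rw [Finset.sum_eq_zero, Finset.sum_eq_zero]
    · intro j _
      by_cases h : m < j
      · rw [Nat.choose_eq_zero_of_lt h, Nat.cast_zero, mul_zero, zero_smul]
      · rw [if_neg (by lia), smul_zero]
    · intro j _
      by_cases h : m < j
      · rw [Nat.choose_eq_zero_of_lt h, Nat.cast_zero, mul_zero, zero_smul]
      · rw [if_neg (by lia), map_zero, smul_zero]

end Twist

/-- The modes of the fields `T`, `J`, `G⁺`, `G⁻` in the Neveu-Schwarz sector: `L m = Lₘ`,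
`J m = Jₘ`, `Gp m = G⁺_{m+1/2}` and `Gm m = G⁻_{m+1/2}`, for `m : ℤ`. -/
inductive Mode where
  | L (m : ℤ)
  | J (m : ℤ)
  | Gp (m : ℤ)
  | Gm (m : ℤ)

section Algebra

open FreeAlgebra

/-- The scalar `z` of the free algebra if `n = 0`, and `0` otherwise. -/
def central (n : ℤ) (z : ℂ) : FreeAlgebra ℂ Mode := if n = 0 then algebraMap ℂ _ z else 0

/-- The (anti)commutation relations of the Neveu-Schwarz `N = 2` superconformal algebra, with the
central element acting as the number `c`. In terms of `r = m + 1/2` and `s = n + 1/2` the relations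
with `G^±` read `[Lₘ, G^±ₛ] = (m/2 - s) G^±ₘ₊ₛ`, `[Jₘ, G^±ₛ] = ± G^±ₘ₊ₛ`, `{G^±ᵣ, G^±ₛ} = 0` and
`{G⁺ᵣ, G⁻ₛ} = 2 Lᵣ₊ₛ + (r - s) Jᵣ₊ₛ + (c/3) (r² - 1/4) δ_{r+s,0}`. -/
inductive N2Rel (c : ℂ) : FreeAlgebra ℂ Mode → FreeAlgebra ℂ Mode → Prop
  | L_L (m n : ℤ) : N2Rel c (ι ℂ (.L m) * ι ℂ (.L n) - ι ℂ (.L n) * ι ℂ (.L m))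
      ((m - n : ℂ) • ι ℂ (.L (m + n)) + central (m + n) (c / 12 * (m ^ 3 - m)))
  | L_J (m n : ℤ) : N2Rel c (ι ℂ (.L m) * ι ℂ (.J n) - ι ℂ (.J n) * ι ℂ (.L m))
      ((-n : ℂ) • ι ℂ (.J (m + n)))
  | L_Gp (m n : ℤ) : N2Rel c (ι ℂ (.L m) * ι ℂ (.Gp n) - ι ℂ (.Gp n) * ι ℂ (.L m))
      ((m / 2 - (n + 1 / 2) : ℂ) • ι ℂ (.Gp (m + n)))
  | L_Gm (m n : ℤ) : N2Rel c (ι ℂ (.L m) * ι ℂ (.Gm n) - ι ℂ (.Gm n) * ι ℂ (.L m))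
      ((m / 2 - (n + 1 / 2) : ℂ) • ι ℂ (.Gm (m + n)))
  | J_J (m n : ℤ) : N2Rel c (ι ℂ (.J m) * ι ℂ (.J n) - ι ℂ (.J n) * ι ℂ (.J m))
      (central (m + n) (c / 3 * m))
  | J_Gp (m n : ℤ) : N2Rel c (ι ℂ (.J m) * ι ℂ (.Gp n) - ι ℂ (.Gp n) * ι ℂ (.J m))
      (ι ℂ (.Gp (m + n)))
  | J_Gm (m n : ℤ) : N2Rel c (ι ℂ (.J m) * ι ℂ (.Gm n) - ι ℂ (.Gm n) * ι ℂ (.J m))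
      (-ι ℂ (.Gm (m + n)))
  | Gp_Gp (m n : ℤ) : N2Rel c (ι ℂ (.Gp m) * ι ℂ (.Gp n) + ι ℂ (.Gp n) * ι ℂ (.Gp m)) 0
  | Gm_Gm (m n : ℤ) : N2Rel c (ι ℂ (.Gm m) * ι ℂ (.Gm n) + ι ℂ (.Gm n) * ι ℂ (.Gm m)) 0
  | Gp_Gm (m n : ℤ) : N2Rel c (ι ℂ (.Gp m) * ι ℂ (.Gm n) + ι ℂ (.Gm n) * ι ℂ (.Gp m))
      ((2 : ℂ) • ι ℂ (.L (m + n + 1)) + (m - n : ℂ) • ι ℂ (.J (m + n + 1)) +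
        central (m + n + 1) (c / 3 * ((m + 1 / 2) ^ 2 - 1 / 4)))

end Algebra

/-- The mode algebra: the universal enveloping algebra of the Neveu-Schwarz `N = 2` superconformal
algebra, with the central element set to `c`. -/
def N2Algebra (c : ℂ) : Type := RingQuot (N2Rel c)

instance (c : ℂ) : Ring (N2Algebra c) := inferInstanceAs (Ring (RingQuot (N2Rel c)))

instance (c : ℂ) : Algebra ℂ (N2Algebra c) := inferInstanceAs (Algebra ℂ (RingQuot (N2Rel c)))

/-- The quotient map from the free algebra on the modes. -/
def N2Algebra.mk (c : ℂ) : FreeAlgebra ℂ Mode →ₐ[ℂ] N2Algebra c := RingQuot.mkAlgHom ℂ (N2Rel c)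

/-- A mode, as an element of the mode algebra. -/
def mode (c : ℂ) (x : Mode) : N2Algebra c := N2Algebra.mk c (FreeAlgebra.ι ℂ x)

/-- The names of the four generating fields. -/
inductive Gen where
  | T
  | J
  | Gp
  | Gm

/-- The coefficient `X₍ₙ₎` of `z⁻ⁿ⁻¹` in the field `X(z)`; that is, `T(z) = ∑ Lₙ z⁻ⁿ⁻²`,
`J(z) = ∑ Jₙ z⁻ⁿ⁻¹` and `G^±(z) = ∑ G^±ᵣ z^{-r-3/2}`. -/
def Gen.mode : Gen → ℤ → Mode
  | .T, n => .L (n - 1)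
  | .J, n => .J n
  | .Gp, n => .Gp (n - 1)
  | .Gm, n => .Gm (n - 1)

/-- `T` and `J` are even, `G⁺` and `G⁻` are odd. -/
def Gen.parity : Gen → ℕ
  | .T => 0
  | .J => 0
  | .Gp => 1
  | .Gm => 1

/-- The left ideal generated by the modes `X₍ₙ₎` with `n ≥ 0`, that is, by `Lₘ` with `m ≥ -1`, `Jₘ`
with `m ≥ 0` and `G^±ᵣ` with `r ≥ -1/2`. -/
def vacuumIdeal (c : ℂ) : Submodule (N2Algebra c) (N2Algebra c) :=
  Submodule.span _ {u | ∃ (X : Gen) (n : ℤ), 0 ≤ n ∧ u = mode c (X.mode n)}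

/-- The vacuum module of the `N = 2` superconformal algebra of central charge `c`. -/
def VacuumModule (c : ℂ) : Type := N2Algebra c ⧸ vacuumIdeal c

namespace VacuumModule

variable (c : ℂ)

instance : AddCommGroup (VacuumModule c) :=
  inferInstanceAs (AddCommGroup (N2Algebra c ⧸ vacuumIdeal c))

instance : Module (N2Algebra c) (VacuumModule c) :=
  inferInstanceAs (Module (N2Algebra c) (N2Algebra c ⧸ vacuumIdeal c))

instance : Module ℂ (VacuumModule c) :=
  inferInstanceAs (Module ℂ (N2Algebra c ⧸ vacuumIdeal c))

instance : IsScalarTower ℂ (N2Algebra c) (VacuumModule c) :=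
  inferInstanceAs (IsScalarTower ℂ (N2Algebra c) (N2Algebra c ⧸ vacuumIdeal c))

/-- The vacuum vector. -/
def vac : VacuumModule c := Submodule.Quotient.mk (p := vacuumIdeal c) 1

end VacuumModule

section Relations

variable (c : ℂ)

theorem rel_mk {x y : FreeAlgebra ℂ Mode} (h : N2Rel c x y) :
    N2Algebra.mk c x = N2Algebra.mk c y :=
  RingQuot.mkAlgHom_rel ℂ h

theorem map_central {A : Type*} [Ring A] [Algebra ℂ A] (φ : FreeAlgebra ℂ Mode →ₐ[ℂ] A) (n : ℤ)
    (z : ℂ) : φ (central n z) = (if n = 0 then z else 0) • (1 : A) := by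
  rw [central]
  split
  · rw [AlgHom.commutes, Algebra.algebraMap_eq_smul_one]
  · rw [map_zero, zero_smul]

theorem rel_L_L (m n : ℤ) : mode c (.L m) * mode c (.L n) - mode c (.L n) * mode c (.L m) =
    (m - n : ℂ) • mode c (.L (m + n)) +
      (if m + n = 0 then c / 12 * (m ^ 3 - m) else 0) • (1 : N2Algebra c) := by
  simpa only [map_sub, map_add, map_mul, map_smul, map_central, mode] using rel_mk c (.L_L m n)

theorem rel_L_J (m n : ℤ) : mode c (.L m) * mode c (.J n) - mode c (.J n) * mode c (.L m) =
    (-n : ℂ) • mode c (.J (m + n)) := by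
  simpa only [map_sub, map_add, map_mul, map_smul, map_central, mode] using rel_mk c (.L_J m n)

theorem rel_L_Gp (m n : ℤ) : mode c (.L m) * mode c (.Gp n) - mode c (.Gp n) * mode c (.L m) =
    (m / 2 - (n + 1 / 2) : ℂ) • mode c (.Gp (m + n)) := by
  simpa only [map_sub, map_add, map_mul, map_smul, map_central, mode] using rel_mk c (.L_Gp m n)

theorem rel_L_Gm (m n : ℤ) : mode c (.L m) * mode c (.Gm n) - mode c (.Gm n) * mode c (.L m) =
    (m / 2 - (n + 1 / 2) : ℂ) • mode c (.Gm (m + n)) := by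
  simpa only [map_sub, map_add, map_mul, map_smul, map_central, mode] using rel_mk c (.L_Gm m n)

theorem rel_J_J (m n : ℤ) : mode c (.J m) * mode c (.J n) - mode c (.J n) * mode c (.J m) =
    (if m + n = 0 then c / 3 * m else 0) • (1 : N2Algebra c) := by
  simpa only [map_sub, map_add, map_mul, map_smul, map_central, mode] using rel_mk c (.J_J m n)

theorem rel_J_Gp (m n : ℤ) : mode c (.J m) * mode c (.Gp n) - mode c (.Gp n) * mode c (.J m) =
    mode c (.Gp (m + n)) := by
  simpa only [map_sub, map_add, map_mul, map_smul, map_central, mode] using rel_mk c (.J_Gp m n)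

theorem rel_J_Gm (m n : ℤ) : mode c (.J m) * mode c (.Gm n) - mode c (.Gm n) * mode c (.J m) =
    -mode c (.Gm (m + n)) := by
  simpa only [map_sub, map_add, map_neg, map_mul, map_smul, map_central, mode]
    using rel_mk c (.J_Gm m n)

theorem rel_Gp_Gp (m n : ℤ) :
    mode c (.Gp m) * mode c (.Gp n) + mode c (.Gp n) * mode c (.Gp m) = 0 := by
  simpa only [map_zero, map_add, map_mul, map_smul, map_central, mode] using rel_mk c (.Gp_Gp m n)

theorem rel_Gm_Gm (m n : ℤ) :
    mode c (.Gm m) * mode c (.Gm n) + mode c (.Gm n) * mode c (.Gm m) = 0 := by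
  simpa only [map_zero, map_add, map_mul, map_smul, map_central, mode] using rel_mk c (.Gm_Gm m n)

theorem rel_Gp_Gm (m n : ℤ) :
    mode c (.Gp m) * mode c (.Gm n) + mode c (.Gm n) * mode c (.Gp m) =
      (2 : ℂ) • mode c (.L (m + n + 1)) + (m - n : ℂ) • mode c (.J (m + n + 1)) +
        (if m + n + 1 = 0 then c / 3 * ((m + 1 / 2) ^ 2 - 1 / 4) else 0) •
          (1 : N2Algebra c) := by
  simpa only [map_zero, map_add, map_mul, map_smul, map_central, mode] using rel_mk c (.Gp_Gm m n)

end Relations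

section GeneratingFields

variable (c : ℂ)

theorem mode_comm_mem (X Y : Gen) (n k : ℤ) (h : 3 ≤ n + k) :
    mode c (X.mode n) * mode c (Y.mode k) -
        (-1 : ℂ) ^ (X.parity * Y.parity) • (mode c (Y.mode k) * mode c (X.mode n)) ∈
      Submodule.span ℂ {u | ∃ (Z : Gen) (j : ℤ), n + k - 1 ≤ j ∧ u = mode c (Z.mode j)} := by
  have memT : ∀ (j : ℤ) (z : ℂ), n + k - 2 ≤ j → z • mode c (.L j) ∈
      Submodule.span ℂ {u | ∃ (Z : Gen) (j : ℤ), n + k - 1 ≤ j ∧ u = mode c (Z.mode j)} :=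
    fun j z hj => Submodule.smul_mem _ _ (Submodule.subset_span ⟨.T, j + 1, by lia, by
      rw [Gen.mode, add_sub_cancel_right]⟩)
  have memJ : ∀ (j : ℤ) (z : ℂ), n + k - 1 ≤ j → z • mode c (.J j) ∈
      Submodule.span ℂ {u | ∃ (Z : Gen) (j : ℤ), n + k - 1 ≤ j ∧ u = mode c (Z.mode j)} :=
    fun j z hj => Submodule.smul_mem _ _ (Submodule.subset_span ⟨.J, j, by lia, rfl⟩)
  have memP : ∀ (j : ℤ) (z : ℂ), n + k - 2 ≤ j → z • mode c (.Gp j) ∈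
      Submodule.span ℂ {u | ∃ (Z : Gen) (j : ℤ), n + k - 1 ≤ j ∧ u = mode c (Z.mode j)} :=
    fun j z hj => Submodule.smul_mem _ _ (Submodule.subset_span ⟨.Gp, j + 1, by lia, by
      rw [Gen.mode, add_sub_cancel_right]⟩)
  have memM : ∀ (j : ℤ) (z : ℂ), n + k - 2 ≤ j → z • mode c (.Gm j) ∈
      Submodule.span ℂ {u | ∃ (Z : Gen) (j : ℤ), n + k - 1 ≤ j ∧ u = mode c (Z.mode j)} :=
    fun j z hj => Submodule.smul_mem _ _ (Submodule.subset_span ⟨.Gm, j + 1, by lia, by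
      rw [Gen.mode, add_sub_cancel_right]⟩)
  generalize Submodule.span ℂ {u | ∃ (Z : Gen) (j : ℤ), n + k - 1 ≤ j ∧ u = mode c (Z.mode j)} = S
    at memT memJ memP memM ⊢
  cases X <;> cases Y <;>
    simp only [Gen.mode, Gen.parity, mul_zero, mul_one, pow_zero, pow_one, one_smul,
      neg_smul, sub_neg_eq_add]
  · rw [rel_L_L, if_neg (by lia), zero_smul, add_zero]
    exact memT _ _ (by lia)
  · rw [rel_L_J]
    exact memJ _ _ (by lia)
  · rw [rel_L_Gp]
    exact memP _ _ (by lia)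
  · rw [rel_L_Gm]
    exact memM _ _ (by lia)
  · rw [← neg_sub, rel_L_J, ← neg_smul]
    exact memJ _ _ (by lia)
  · rw [rel_J_J, if_neg (by lia), zero_smul]
    exact zero_mem _
  · rw [rel_J_Gp, ← one_smul ℂ (mode c (.Gp _))]
    exact memP _ _ (by lia)
  · rw [rel_J_Gm, ← neg_one_smul ℂ (mode c (.Gm _))]
    exact memM _ _ (by lia)
  · rw [← neg_sub, rel_L_Gp, ← neg_smul]
    exact memP _ _ (by lia)
  · rw [← neg_sub, rel_J_Gp, ← neg_one_smul ℂ (mode c (.Gp _))]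
    exact memP _ _ (by lia)
  · rw [rel_Gp_Gp]
    exact zero_mem _
  · rw [rel_Gp_Gm, if_neg (by lia), zero_smul, add_zero]
    exact add_mem (memT _ _ (by lia)) (memJ _ _ (by lia))
  · rw [← neg_sub, rel_L_Gm, ← neg_smul]
    exact memM _ _ (by lia)
  · rw [← neg_sub, rel_J_Gm, neg_neg, ← one_smul ℂ (mode c (.Gm _))]
    exact memM _ _ (by lia)
  · rw [add_comm, rel_Gp_Gm, if_neg (by lia), zero_smul, add_zero]
    exact add_mem (memT _ _ (by lia)) (memJ _ _ (by lia))
  · rw [rel_Gm_Gm]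
    exact zero_mem _

theorem gen_mode_surj (x : Mode) : ∃ (X : Gen) (n : ℤ), x = X.mode n := by
  rcases x with m | m | m | m
  · exact ⟨.T, m + 1, by rw [Gen.mode, add_sub_cancel_right]⟩
  · exact ⟨.J, m, rfl⟩
  · exact ⟨.Gp, m + 1, by rw [Gen.mode, add_sub_cancel_right]⟩
  · exact ⟨.Gm, m + 1, by rw [Gen.mode, add_sub_cancel_right]⟩

theorem VacuumModule.smul_vac_surjective (v : VacuumModule c) :
    ∃ u : N2Algebra c, v = u • vac c := by
  obtain ⟨u, rfl⟩ := Submodule.Quotient.mk_surjective (vacuumIdeal c) v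
  exact ⟨u, by rw [vac]; exact ((congrArg _ (mul_one u)).symm : _)⟩

theorem VacuumModule.mode_smul_vac (X : Gen) {n : ℤ} (hn : 0 ≤ n) :
    mode c (X.mode n) • vac c = 0 := by
  have h : mode c (X.mode n) • vac c =
      Submodule.Quotient.mk (p := vacuumIdeal c) (mode c (X.mode n) • 1) := rfl
  rw [h, smul_eq_mul, mul_one]
  exact (Submodule.Quotient.mk_eq_zero _).2 (Submodule.subset_span ⟨X, n, hn, rfl⟩)

/-- Induction over the vacuum module: it is spanned by the vacuum and what the modes make of it. -/
theorem VacuumModule.induction {P : VacuumModule c → Prop} (v : VacuumModule c)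
    (hvac : P (vac c)) (hadd : ∀ v w, P v → P w → P (v + w)) (hsmul : ∀ (a : ℂ) v, P v → P (a • v))
    (hmode : ∀ (X : Gen) (n : ℤ) v, P v → P (mode c (X.mode n) • v)) : P v := by
  obtain ⟨u, rfl⟩ := smul_vac_surjective c v
  obtain ⟨f, rfl⟩ := RingQuot.mkAlgHom_surjective ℂ (N2Rel c) u
  have key : ∀ w : VacuumModule c, P w → P (N2Algebra.mk c f • w) := by
    induction f using FreeAlgebra.induction with
    | grade0 r =>
      intro w hw
      rw [AlgHom.commutes, algebraMap_smul]
      exact hsmul r w hw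
    | grade1 x =>
      intro w hw
      obtain ⟨X, n, rfl⟩ := gen_mode_surj x
      exact hmode X n w hw
    | mul a b ha hb =>
      intro w hw
      rw [map_mul, mul_smul]
      exact ha _ (hb _ hw)
    | add a b ha hb =>
      intro w hw
      rw [map_add, add_smul]
      exact hadd _ _ (ha _ hw) (hb _ hw)
  exact key _ hvac

theorem mode_trunc (v : VacuumModule c) :
    ∃ N : ℤ, ∀ (X : Gen), ∀ n ≥ N, mode c (X.mode n) • v = 0 := by
  refine VacuumModule.induction c
    (P := fun v => ∃ N : ℤ, ∀ (X : Gen), ∀ n ≥ N, mode c (X.mode n) • v = 0) v ?_ ?_ ?_ ?_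
  · exact ⟨0, fun X n hn => VacuumModule.mode_smul_vac c X hn⟩
  · rintro v w ⟨N, hN⟩ ⟨M, hM⟩
    refine ⟨max N M, fun X n hn => ?_⟩
    rw [smul_add, hN X n (by lia), hM X n (by lia), add_zero]
  · rintro a v ⟨N, hN⟩
    refine ⟨N, fun X n hn => ?_⟩
    rw [smul_comm, hN X n hn, smul_zero]
  · rintro Y k v ⟨N, hN⟩
    refine ⟨max N (max (3 - k) (N - k + 1)), fun X n hn => ?_⟩
    have kill : ∀ u ∈ Submodule.span ℂ
        {u | ∃ (Z : Gen) (j : ℤ), n + k - 1 ≤ j ∧ u = mode c (Z.mode j)}, u • v = 0 := by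
      intro u hu
      induction hu using Submodule.span_induction with
      | mem u hu =>
        obtain ⟨Z, j, hj, rfl⟩ := hu
        exact hN Z j (by lia)
      | zero => exact zero_smul _ _
      | add a b _ _ ha hb => rw [add_smul, ha, hb, add_zero]
      | smul a b _ hb => rw [smul_assoc, hb, smul_zero]
    have h := kill _ (mode_comm_mem c X Y n k (by lia))
    rw [sub_smul, smul_assoc, mul_smul, mul_smul, hN X n (by lia), smul_zero, smul_zero,
      sub_zero] at h
    exact h

/-- The generating field `X(z) = ∑ₙ X₍ₙ₎ z⁻ⁿ⁻¹` acting on the vacuum module. -/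
def genField (X : Gen) : VertexOperator ℂ (VacuumModule c) :=
  mkField (fun n => Module.toModuleEnd ℂ (VacuumModule c) (mode c (X.mode n))) (fun v => by
    obtain ⟨N, hN⟩ := mode_trunc c v
    exact ⟨N, fun n hn => hN X n hn⟩)

theorem genField_apply (X : Gen) (n : ℤ) (v : VacuumModule c) :
    ((genField c X)[[n]]) v = mode c (X.mode n) • v := by
  rw [genField, mkField_ncoeff]
  rfl

end GeneratingFields

theorem choose_two (m : ℤ) : 2 * Ring.choose m 2 = m * (m - 1) := by
  have h := Ring.choose_smul_choose m (n := 2) (k := 1) (by lia)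
  rw [Nat.choose_one_right, Ring.choose_one_right, Nat.cast_one, Ring.choose_one_right,
    nsmul_eq_mul] at h
  exact_mod_cast h

theorem choose_three (m : ℤ) : 6 * Ring.choose m 3 = m * (m - 1) * (m - 2) := by
  have h := Ring.choose_smul_choose m (n := 3) (k := 1) (by lia)
  have h₂ := choose_two (m - 1)
  rw [Nat.choose_one_right, Ring.choose_one_right, Nat.cast_one, nsmul_eq_mul] at h
  push_cast at h
  linear_combination 2 * h + m * h₂

section Construction

variable (c : ℂ)

theorem N2Algebra.mk_surjective : Function.Surjective (N2Algebra.mk c) :=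
  RingQuot.mkAlgHom_surjective ℂ (N2Rel c)

/-- The algebra map out of the mode algebra with prescribed images of the modes. -/
def N2Algebra.lift {A : Type*} [Ring A] [Algebra ℂ A] (f : Mode → A)
    (h : ∀ x y, N2Rel c x y → FreeAlgebra.lift ℂ f x = FreeAlgebra.lift ℂ f y) :
    N2Algebra c →ₐ[ℂ] A :=
  RingQuot.liftAlgHom ℂ ⟨FreeAlgebra.lift ℂ f, fun {x y} hxy => h x y hxy⟩

theorem N2Algebra.lift_mode {A : Type*} [Ring A] [Algebra ℂ A] (f : Mode → A)
    (h : ∀ x y, N2Rel c x y → FreeAlgebra.lift ℂ f x = FreeAlgebra.lift ℂ f y) (x : Mode) :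
    N2Algebra.lift c f h (mode c x) = f x := by
  have h₁ : N2Algebra.lift c f h (mode c x) = FreeAlgebra.lift ℂ f (FreeAlgebra.ι ℂ x) :=
    RingQuot.liftAlgHom_mkAlgHom_apply ..
  rw [h₁, FreeAlgebra.lift_ι_apply]

/-- The linear map out of the vacuum module induced by a linear map that kills the left ideal. -/
def VacuumModule.lift {M : Type*} [AddCommGroup M] [Module ℂ M] (f : N2Algebra c →ₗ[ℂ] M)
    (h : ∀ u ∈ vacuumIdeal c, f u = 0) : VacuumModule c →ₗ[ℂ] M :=
  ((vacuumIdeal c).restrictScalars ℂ).liftQ f h ∘ₗ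
    ((Submodule.Quotient.restrictScalarsEquiv ℂ (vacuumIdeal c)).symm :
      (N2Algebra c ⧸ vacuumIdeal c) →ₗ[ℂ] _)

theorem VacuumModule.lift_smul_vac {M : Type*} [AddCommGroup M] [Module ℂ M]
    (f : N2Algebra c →ₗ[ℂ] M) (h : ∀ u ∈ vacuumIdeal c, f u = 0) (u : N2Algebra c) :
    VacuumModule.lift c f h (u • vac c) = f u := by
  have h₁ : u • vac c = Submodule.Quotient.mk (p := vacuumIdeal c) (u • 1) := rfl
  rw [h₁, smul_eq_mul, mul_one]
  rfl

/-- The parity of a mode. -/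
def Mode.parity : Mode → ℕ
  | .L _ => 0
  | .J _ => 0
  | .Gp _ => 1
  | .Gm _ => 1

theorem Gen.parity_mode (X : Gen) (n : ℤ) : (X.mode n).parity = X.parity := by cases X <;> rfl

/-- The parity automorphism of the mode algebra. -/
def algParity : N2Algebra c →ₐ[ℂ] N2Algebra c :=
  N2Algebra.lift c (fun x => (-1 : ℂ) ^ x.parity • mode c x) (by
    intro x y h
    cases h <;>
      simp only [map_sub, map_add, map_neg, map_mul, map_smul, map_zero, FreeAlgebra.lift_ι_apply,
        Mode.parity, pow_zero, pow_one, one_smul, neg_smul, neg_mul, mul_neg, neg_neg, rel_L_L,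
        rel_L_J, rel_J_J, rel_Gp_Gp, rel_Gm_Gm, rel_Gp_Gm, map_central]
    · rw [neg_sub_neg, ← neg_sub, rel_L_Gp, smul_neg]
    · rw [neg_sub_neg, ← neg_sub, rel_L_Gm, smul_neg]
    · rw [neg_sub_neg, ← neg_sub, rel_J_Gp]
    · rw [neg_sub_neg, ← neg_sub, rel_J_Gm, neg_neg])

theorem algParity_mode (x : Mode) : algParity c (mode c x) = (-1 : ℂ) ^ x.parity • mode c x :=
  N2Algebra.lift_mode ..

/-- The parity involution of the vacuum module, `+1` on the even and `-1` on the odd vectors. -/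
def VacuumModule.parity : VacuumModule c →ₗ[ℂ] VacuumModule c :=
  VacuumModule.lift c
    ((LinearMap.toSpanSingleton (N2Algebra c) (VacuumModule c) (vac c)).restrictScalars ℂ ∘ₗ
      (algParity c).toLinearMap) (by
    intro u hu
    change algParity c u • vac c = 0
    induction hu using Submodule.span_induction with
    | mem u hu =>
      obtain ⟨X, n, hn, rfl⟩ := hu
      rw [algParity_mode, smul_assoc, mode_smul_vac c X hn, smul_zero]
    | zero => rw [map_zero, zero_smul]
    | add a b _ _ ha hb => rw [map_add, add_smul, ha, hb, add_zero]
    | smul a b _ hb => rw [smul_eq_mul, map_mul, mul_smul, hb, smul_zero])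

theorem VacuumModule.parity_smul_vac (u : N2Algebra c) :
    parity c (u • vac c) = algParity c u • vac c :=
  VacuumModule.lift_smul_vac ..

theorem VacuumModule.parity_vac : parity c (vac c) = vac c := by
  have h := parity_smul_vac c 1
  rwa [map_one, one_smul] at h

theorem VacuumModule.parity_smul (u : N2Algebra c) (v : VacuumModule c) :
    parity c (u • v) = algParity c u • parity c v := by
  obtain ⟨w, rfl⟩ := smul_vac_surjective c v
  rw [← mul_smul, parity_smul_vac, parity_smul_vac, map_mul, mul_smul]

theorem VacuumModule.parity_mode_smul (X : Gen) (n : ℤ) (v : VacuumModule c) :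
    parity c (mode c (X.mode n) • v) = (-1 : ℂ) ^ X.parity • mode c (X.mode n) • parity c v := by
  rw [parity_smul, algParity_mode, Gen.parity_mode, smul_assoc]

theorem VacuumModule.parity_parity (v : VacuumModule c) : parity c (parity c v) = v := by
  refine VacuumModule.induction c (P := fun v => parity c (parity c v) = v) v ?_ ?_ ?_ ?_
  · rw [parity_vac, parity_vac]
  · intro v w hv hw
    rw [map_add, map_add, hv, hw]
  · intro a v hv
    rw [map_smul, map_smul, hv]
  · intro X n v hv
    rw [parity_mode_smul, map_smul, parity_mode_smul, hv, smul_smul, ← mul_pow]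
    simp

theorem parity_genField (X : Gen) (n : ℤ) (v : VacuumModule c) :
    VacuumModule.parity c (((genField c X)[[n]]) v) =
      (-1 : ℂ) ^ X.parity • ((genField c X)[[n]]) (VacuumModule.parity c v) := by
  rw [genField_apply, genField_apply, VacuumModule.parity_mode_smul]

/-- The `n`-th product with a generating field, on all fields on the vacuum module. -/
def genProduct (X : Gen) (n : ℤ) : Module.End ℂ (VertexOperator ℂ (VacuumModule c)) :=
  fieldProduct (VacuumModule.parity c) X.parity (genField c X) n

theorem genProduct_T (n : ℤ) :
    fieldProduct (VacuumModule.parity c) 0 (genField c .T) n = genProduct c .T n := rfl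

theorem genProduct_J (n : ℤ) :
    fieldProduct (VacuumModule.parity c) 0 (genField c .J) n = genProduct c .J n := rfl

theorem genProduct_Gp (n : ℤ) :
    fieldProduct (VacuumModule.parity c) 1 (genField c .Gp) n = genProduct c .Gp n := rfl

theorem genProduct_Gm (n : ℤ) :
    fieldProduct (VacuumModule.parity c) 1 (genField c .Gm) n = genProduct c .Gm n := rfl

theorem genProduct_comm {X Y : Gen} {k : ℕ} {κ : Fin k → ℂ} {l : Fin k → ℕ}
    {D : Fin k → VertexOperator ℂ (VacuumModule c)}
    (H : ∀ (m n : ℤ) (v : VacuumModule c),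
      mode c (X.mode m) • mode c (Y.mode n) • v -
        (-1 : ℂ) ^ (X.parity * Y.parity) • mode c (Y.mode n) • mode c (X.mode m) • v =
      ∑ t, (κ t * Ring.choose m (l t) : ℂ) • ((D t)[[m + n - l t]]) v) (m n : ℤ) :
    genProduct c X m * genProduct c Y n -
        (-1 : ℂ) ^ (X.parity * Y.parity) • (genProduct c Y n * genProduct c X m) =
      ∑ t, (κ t * Ring.choose m (l t) : ℂ) •
        fieldProduct (VacuumModule.parity c) (X.parity + Y.parity) (D t) (m + n - l t) := by
  have h := fieldProduct_comm (parity_genField c X) (parity_genField c Y) (κ := κ) (l := l) (D := D)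
    (fun m n v => by
      simp only [genField_apply, H, mul_smul, Int.cast_smul_eq_zsmul]) m n
  refine h.trans (Finset.sum_congr rfl fun t _ => ?_)
  rw [mul_smul]
  congr 1

theorem derivField_apply' (A : VertexOperator ℂ (VacuumModule c)) (n : ℤ) (v : VacuumModule c) :
    ((derivField A)[[n]]) v = (-n : ℂ) • (A[[n - 1]]) v := by
  rw [derivField_apply, ← Int.cast_smul_eq_zsmul ℂ, Int.cast_neg]

theorem fieldProduct_derivField' (p : ℕ) (A : VertexOperator ℂ (VacuumModule c)) (n : ℤ) :
    fieldProduct (VacuumModule.parity c) p (derivField A) n =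
      (-n : ℂ) • fieldProduct (VacuumModule.parity c) p A (n - 1) := by
  rw [fieldProduct_derivField, ← Int.cast_neg]
  exact (Int.cast_smul_eq_zsmul ℂ (-n)
    (fieldProduct (VacuumModule.parity c) p A (n - 1))).symm

end Construction

set_option linter.unusedSimpArgs false

section Representation

variable (c : ℂ)

theorem comm_smul {x y z : N2Algebra c} (h : x * y - y * x = z) (v : VacuumModule c) :
    x • y • v - y • x • v = z • v := by
  rw [← h, sub_smul, mul_smul, mul_smul]

theorem anticomm_smul {x y z : N2Algebra c} (h : x * y + y * x = z) (v : VacuumModule c) :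
    x • y • v + y • x • v = z • v := by
  rw [← h, add_smul, mul_smul, mul_smul]

theorem fieldProduct_gen_two (A : VertexOperator ℂ (VacuumModule c)) (n : ℤ) :
    fieldProduct (VacuumModule.parity c) 2 A n = fieldProduct (VacuumModule.parity c) 0 A n := by
  rw [fieldProduct, fieldProduct, twist_sq (VacuumModule.parity_parity c), pow_zero]

theorem sub_neg_one_smul' (x y : Module.End ℂ (VertexOperator ℂ (VacuumModule c))) :
    x - (-1 : ℂ) • y = x + y := by module

theorem genProduct_T_T (m n : ℤ) :
    genProduct c .T m * genProduct c .T n - genProduct c .T n * genProduct c .T m =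
      (m - n : ℂ) • genProduct c .T (m + n - 1) +
        (if m + n = 2 then c / 12 * ((m - 1) ^ 3 - (m - 1)) else 0) • (1 : Module.End ℂ (VertexOperator ℂ (VacuumModule c))) := by
  have hc : ∀ m : ℤ, (6 : ℂ) * Ring.choose m 3 = m * (m - 1) * (m - 2) := fun m => by
    exact_mod_cast choose_three m
  have h := genProduct_comm c (X := .T) (Y := .T) (κ := ![1, 2, c / 2]) (l := ![0, 1, 3])
    (D := ![derivField (genField c .T), genField c .T, oneField _]) (by
      intro m n v
      have h := comm_smul c (rel_L_L c (m - 1) (n - 1)) v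
      have e0 : m - 1 + (n - 1) = m + n - 1 - 1 := by ring
      simp only [Fin.sum_univ_three, Matrix.cons_val_zero, Matrix.cons_val_one, Matrix.cons_val,
        Matrix.cons_val_fin_one, Gen.mode, Gen.parity, mul_zero, zero_mul, mul_one, pow_zero, pow_one, one_smul,
        derivField_apply', genField_apply, oneField_apply, Ring.choose_zero_right,
        Ring.choose_one_right, Nat.cast_zero, sub_zero, Nat.cast_one, Int.cast_one, add_smul,
        neg_smul, sub_neg_eq_add, smul_assoc, e0] at h ⊢
      rw [h]
      by_cases h0 : m + n = 2
      · rw [if_pos (by lia), if_pos (by push_cast; lia)]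
        push_cast
        generalize mode c (.L (m + n - 1 - 1)) • v = w0
        match_scalars
        · ring
        · linear_combination (-c / 12) * hc m
      · rw [if_neg (by lia), if_neg (by push_cast; lia)]
        push_cast
        generalize mode c (.L (m + n - 1 - 1)) • v = w0
        module) m n
  simp only [Fin.sum_univ_three, Matrix.cons_val_zero, Matrix.cons_val_one, Matrix.cons_val,
    Matrix.cons_val_fin_one, Gen.parity, mul_zero, zero_mul, mul_one, pow_zero, pow_one, one_smul, fieldProduct_derivField',
    fieldProduct_oneField, Ring.choose_zero_right, Ring.choose_one_right, Nat.cast_zero, sub_zero,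
    Nat.cast_one, Int.cast_one, add_zero, zero_add, neg_smul, sub_neg_eq_add, genProduct_T,
    genProduct_J, genProduct_Gp, genProduct_Gm] at h
  rw [h]
  by_cases h0 : m + n = 2
  · rw [if_pos (by push_cast; lia), if_pos (by lia)]
    push_cast
    match_scalars
    · ring
    · linear_combination (c / 12) * hc m
  · rw [if_neg (by push_cast; lia), if_neg (by lia)]
    push_cast
    module

theorem genProduct_T_J (m n : ℤ) :
    genProduct c .T m * genProduct c .J n - genProduct c .J n * genProduct c .T m =
      (-n : ℂ) • genProduct c .J (m + n - 1) := by
  have h := genProduct_comm c (X := .T) (Y := .J) (κ := ![1, 1]) (l := ![0, 1])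
    (D := ![derivField (genField c .J), genField c .J]) (by
      intro m n v
      have h := comm_smul c (rel_L_J c (m - 1) (n)) v
      have e0 : m - 1 + n = m + n - 1 := by ring
      simp only [Fin.sum_univ_two, Matrix.cons_val_zero, Matrix.cons_val_one, Matrix.cons_val,
        Matrix.cons_val_fin_one, Gen.mode, Gen.parity, mul_zero, zero_mul, mul_one, pow_zero, pow_one, one_smul,
        derivField_apply', genField_apply, oneField_apply, Ring.choose_zero_right,
        Ring.choose_one_right, Nat.cast_zero, sub_zero, Nat.cast_one, Int.cast_one, add_smul,
        neg_smul, sub_neg_eq_add, smul_assoc, e0] at h ⊢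
      rw [h]
      push_cast
      generalize mode c (.J (m + n - 1)) • v = w0
      module) m n
  simp only [Fin.sum_univ_two, Matrix.cons_val_zero, Matrix.cons_val_one, Matrix.cons_val,
    Matrix.cons_val_fin_one, Gen.parity, mul_zero, zero_mul, mul_one, pow_zero, pow_one, one_smul, fieldProduct_derivField',
    fieldProduct_oneField, Ring.choose_zero_right, Ring.choose_one_right, Nat.cast_zero, sub_zero,
    Nat.cast_one, Int.cast_one, add_zero, zero_add, neg_smul, sub_neg_eq_add, genProduct_T,
    genProduct_J, genProduct_Gp, genProduct_Gm] at h
  rw [h]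
  push_cast
  module

theorem genProduct_T_Gp (m n : ℤ) :
    genProduct c .T m * genProduct c .Gp n - genProduct c .Gp n * genProduct c .T m =
      (m / 2 - n : ℂ) • genProduct c .Gp (m + n - 1) := by
  have h := genProduct_comm c (X := .T) (Y := .Gp) (κ := ![1, 3 / 2]) (l := ![0, 1])
    (D := ![derivField (genField c .Gp), genField c .Gp]) (by
      intro m n v
      have h := comm_smul c (rel_L_Gp c (m - 1) (n - 1)) v
      have e0 : m - 1 + (n - 1) = m + n - 1 - 1 := by ring
      simp only [Fin.sum_univ_two, Matrix.cons_val_zero, Matrix.cons_val_one, Matrix.cons_val,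
        Matrix.cons_val_fin_one, Gen.mode, Gen.parity, mul_zero, zero_mul, mul_one, pow_zero, pow_one, one_smul,
        derivField_apply', genField_apply, oneField_apply, Ring.choose_zero_right,
        Ring.choose_one_right, Nat.cast_zero, sub_zero, Nat.cast_one, Int.cast_one, add_smul,
        neg_smul, sub_neg_eq_add, smul_assoc, e0] at h ⊢
      rw [h]
      push_cast
      generalize mode c (.Gp (m + n - 1 - 1)) • v = w0
      module) m n
  simp only [Fin.sum_univ_two, Matrix.cons_val_zero, Matrix.cons_val_one, Matrix.cons_val,
    Matrix.cons_val_fin_one, Gen.parity, mul_zero, zero_mul, mul_one, pow_zero, pow_one, one_smul, fieldProduct_derivField',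
    fieldProduct_oneField, Ring.choose_zero_right, Ring.choose_one_right, Nat.cast_zero, sub_zero,
    Nat.cast_one, Int.cast_one, add_zero, zero_add, neg_smul, sub_neg_eq_add, genProduct_T,
    genProduct_J, genProduct_Gp, genProduct_Gm] at h
  rw [h]
  push_cast
  module

theorem genProduct_T_Gm (m n : ℤ) :
    genProduct c .T m * genProduct c .Gm n - genProduct c .Gm n * genProduct c .T m =
      (m / 2 - n : ℂ) • genProduct c .Gm (m + n - 1) := by
  have h := genProduct_comm c (X := .T) (Y := .Gm) (κ := ![1, 3 / 2]) (l := ![0, 1])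
    (D := ![derivField (genField c .Gm), genField c .Gm]) (by
      intro m n v
      have h := comm_smul c (rel_L_Gm c (m - 1) (n - 1)) v
      have e0 : m - 1 + (n - 1) = m + n - 1 - 1 := by ring
      simp only [Fin.sum_univ_two, Matrix.cons_val_zero, Matrix.cons_val_one, Matrix.cons_val,
        Matrix.cons_val_fin_one, Gen.mode, Gen.parity, mul_zero, zero_mul, mul_one, pow_zero, pow_one, one_smul,
        derivField_apply', genField_apply, oneField_apply, Ring.choose_zero_right,
        Ring.choose_one_right, Nat.cast_zero, sub_zero, Nat.cast_one, Int.cast_one, add_smul,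
        neg_smul, sub_neg_eq_add, smul_assoc, e0] at h ⊢
      rw [h]
      push_cast
      generalize mode c (.Gm (m + n - 1 - 1)) • v = w0
      module) m n
  simp only [Fin.sum_univ_two, Matrix.cons_val_zero, Matrix.cons_val_one, Matrix.cons_val,
    Matrix.cons_val_fin_one, Gen.parity, mul_zero, zero_mul, mul_one, pow_zero, pow_one, one_smul, fieldProduct_derivField',
    fieldProduct_oneField, Ring.choose_zero_right, Ring.choose_one_right, Nat.cast_zero, sub_zero,
    Nat.cast_one, Int.cast_one, add_zero, zero_add, neg_smul, sub_neg_eq_add, genProduct_T,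
    genProduct_J, genProduct_Gp, genProduct_Gm] at h
  rw [h]
  push_cast
  module

theorem genProduct_J_J (m n : ℤ) :
    genProduct c .J m * genProduct c .J n - genProduct c .J n * genProduct c .J m =
      (if m + n = 0 then c / 3 * m else 0) • (1 : Module.End ℂ (VertexOperator ℂ (VacuumModule c))) := by
  have h := genProduct_comm c (X := .J) (Y := .J) (κ := ![c / 3]) (l := ![1])
    (D := ![oneField _]) (by
      intro m n v
      have h := comm_smul c (rel_J_J c (m) (n)) v
      simp only [Fin.sum_univ_one, Matrix.cons_val_zero, Matrix.cons_val_one, Matrix.cons_val,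
        Matrix.cons_val_fin_one, Gen.mode, Gen.parity, mul_zero, zero_mul, mul_one, pow_zero, pow_one, one_smul,
        derivField_apply', genField_apply, oneField_apply, Ring.choose_zero_right,
        Ring.choose_one_right, Nat.cast_zero, sub_zero, Nat.cast_one, Int.cast_one, add_smul,
        neg_smul, sub_neg_eq_add, smul_assoc] at h ⊢
      rw [h]
      by_cases h0 : m + n = 0
      · rw [if_pos (by lia), if_pos (by lia)]
      · rw [if_neg (by lia), if_neg (by lia)]
        module) m n
  simp only [Fin.sum_univ_one, Matrix.cons_val_zero, Matrix.cons_val_one, Matrix.cons_val,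
    Matrix.cons_val_fin_one, Gen.parity, mul_zero, zero_mul, mul_one, pow_zero, pow_one, one_smul, fieldProduct_derivField',
    fieldProduct_oneField, Ring.choose_zero_right, Ring.choose_one_right, Nat.cast_zero, sub_zero,
    Nat.cast_one, Int.cast_one, add_zero, zero_add, neg_smul, sub_neg_eq_add, genProduct_T,
    genProduct_J, genProduct_Gp, genProduct_Gm] at h
  rw [h]
  by_cases h0 : m + n = 0
  · rw [if_pos (by lia), if_pos (by lia)]
  · rw [if_neg (by lia), if_neg (by lia)]
    module

theorem genProduct_J_Gp (m n : ℤ) :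
    genProduct c .J m * genProduct c .Gp n - genProduct c .Gp n * genProduct c .J m =
      genProduct c .Gp (m + n) := by
  have h := genProduct_comm c (X := .J) (Y := .Gp) (κ := ![1]) (l := ![0])
    (D := ![genField c .Gp]) (by
      intro m n v
      have h := comm_smul c (rel_J_Gp c (m) (n - 1)) v
      have e0 : m + (n - 1) = m + n - 1 := by ring
      simp only [Fin.sum_univ_one, Matrix.cons_val_zero, Matrix.cons_val_one, Matrix.cons_val,
        Matrix.cons_val_fin_one, Gen.mode, Gen.parity, mul_zero, zero_mul, mul_one, pow_zero, pow_one, one_smul,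
        derivField_apply', genField_apply, oneField_apply, Ring.choose_zero_right,
        Ring.choose_one_right, Nat.cast_zero, sub_zero, Nat.cast_one, Int.cast_one, add_smul,
        neg_smul, sub_neg_eq_add, smul_assoc, e0] at h ⊢
      rw [h]) m n
  simp only [Fin.sum_univ_one, Matrix.cons_val_zero, Matrix.cons_val_one, Matrix.cons_val,
    Matrix.cons_val_fin_one, Gen.parity, mul_zero, zero_mul, mul_one, pow_zero, pow_one, one_smul, fieldProduct_derivField',
    fieldProduct_oneField, Ring.choose_zero_right, Ring.choose_one_right, Nat.cast_zero, sub_zero,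
    Nat.cast_one, Int.cast_one, add_zero, zero_add, neg_smul, sub_neg_eq_add, genProduct_T,
    genProduct_J, genProduct_Gp, genProduct_Gm] at h
  rw [h]

theorem genProduct_J_Gm (m n : ℤ) :
    genProduct c .J m * genProduct c .Gm n - genProduct c .Gm n * genProduct c .J m =
      -genProduct c .Gm (m + n) := by
  have h := genProduct_comm c (X := .J) (Y := .Gm) (κ := ![-1]) (l := ![0])
    (D := ![genField c .Gm]) (by
      intro m n v
      have h := comm_smul c (rel_J_Gm c (m) (n - 1)) v
      have e0 : m + (n - 1) = m + n - 1 := by ring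
      simp only [Fin.sum_univ_one, Matrix.cons_val_zero, Matrix.cons_val_one, Matrix.cons_val,
        Matrix.cons_val_fin_one, Gen.mode, Gen.parity, mul_zero, zero_mul, mul_one, pow_zero, pow_one, one_smul,
        derivField_apply', genField_apply, oneField_apply, Ring.choose_zero_right,
        Ring.choose_one_right, Nat.cast_zero, sub_zero, Nat.cast_one, Int.cast_one, add_smul,
        neg_smul, sub_neg_eq_add, smul_assoc, e0] at h ⊢
      rw [h]) m n
  simp only [Fin.sum_univ_one, Matrix.cons_val_zero, Matrix.cons_val_one, Matrix.cons_val,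
    Matrix.cons_val_fin_one, Gen.parity, mul_zero, zero_mul, mul_one, pow_zero, pow_one, one_smul, fieldProduct_derivField',
    fieldProduct_oneField, Ring.choose_zero_right, Ring.choose_one_right, Nat.cast_zero, sub_zero,
    Nat.cast_one, Int.cast_one, add_zero, zero_add, neg_smul, sub_neg_eq_add, genProduct_T,
    genProduct_J, genProduct_Gp, genProduct_Gm] at h
  rw [h]
  module

theorem genProduct_Gp_Gm (m n : ℤ) :
    genProduct c .Gp m * genProduct c .Gm n + genProduct c .Gm n * genProduct c .Gp m =
      (2 : ℂ) • genProduct c .T (m + n) + (m - n : ℂ) • genProduct c .J (m + n - 1) +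
        (if m + n = 1 then c / 3 * (m ^ 2 - m) else 0) • (1 : Module.End ℂ (VertexOperator ℂ (VacuumModule c))) := by
  have hc : ∀ m : ℤ, (2 : ℂ) * Ring.choose m 2 = m * (m - 1) := fun m => by
    exact_mod_cast choose_two m
  have h := genProduct_comm c (X := .Gp) (Y := .Gm) (κ := ![2, 1, 2, 2 * c / 3]) (l := ![0, 0, 1, 2])
    (D := ![genField c .T, derivField (genField c .J), genField c .J, oneField _]) (by
      intro m n v
      have h := anticomm_smul c (rel_Gp_Gm c (m - 1) (n - 1)) v
      have e0 : m - 1 + (n - 1) + 1 = m + n - 1 := by ring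
      simp only [Fin.sum_univ_four, Matrix.cons_val_zero, Matrix.cons_val_one, Matrix.cons_val,
        Matrix.cons_val_fin_one, Gen.mode, Gen.parity, mul_zero, zero_mul, mul_one, pow_zero, pow_one, one_smul,
        derivField_apply', genField_apply, oneField_apply, Ring.choose_zero_right,
        Ring.choose_one_right, Nat.cast_zero, sub_zero, Nat.cast_one, Int.cast_one, add_smul,
        neg_smul, sub_neg_eq_add, smul_assoc, e0] at h ⊢
      rw [h]
      by_cases h0 : m + n = 1
      · rw [if_pos (by lia), if_pos (by push_cast; lia)]
        push_cast
        generalize mode c (.L (m + n - 1)) • v = w0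
        generalize mode c (.J (m + n - 1)) • v = w1
        match_scalars
        · ring
        · ring
        · linear_combination (-c / 3) * hc m
      · rw [if_neg (by lia), if_neg (by push_cast; lia)]
        push_cast
        generalize mode c (.L (m + n - 1)) • v = w0
        generalize mode c (.J (m + n - 1)) • v = w1
        module) m n
  simp only [Fin.sum_univ_four, Matrix.cons_val_zero, Matrix.cons_val_one, Matrix.cons_val,
    Matrix.cons_val_fin_one, Gen.parity, mul_zero, zero_mul, mul_one, pow_zero, pow_one, one_smul, fieldProduct_derivField',
    fieldProduct_oneField, Ring.choose_zero_right, Ring.choose_one_right, Nat.cast_zero, sub_zero,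
    Nat.cast_one, Int.cast_one, add_zero, zero_add, neg_smul, sub_neg_eq_add,
    one_add_one_eq_two, sub_neg_one_smul', fieldProduct_gen_two, genProduct_T, genProduct_J] at h
  rw [h]
  by_cases h0 : m + n = 1
  · rw [if_pos (by push_cast; lia), if_pos (by lia)]
    push_cast
    match_scalars
    · ring
    · ring
    · linear_combination (c / 3) * hc m
  · rw [if_neg (by push_cast; lia), if_neg (by lia)]
    push_cast
    module

theorem genProduct_Gp_Gp (m n : ℤ) :
    genProduct c .Gp m * genProduct c .Gp n + genProduct c .Gp n * genProduct c .Gp m = 0 := by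
  have h := genProduct_comm c (X := .Gp) (Y := .Gp) (κ := ![]) (l := ![]) (D := ![]) (by
    intro m n v
    have h := anticomm_smul c (rel_Gp_Gp c (m - 1) (n - 1)) v
    simpa [Gen.mode, Gen.parity] using h) m n
  simpa only [Gen.parity, mul_one, pow_one, sub_neg_one_smul', Finset.univ_eq_empty,
    Finset.sum_empty] using h

theorem genProduct_Gm_Gm (m n : ℤ) :
    genProduct c .Gm m * genProduct c .Gm n + genProduct c .Gm n * genProduct c .Gm m = 0 := by
  have h := genProduct_comm c (X := .Gm) (Y := .Gm) (κ := ![]) (l := ![]) (D := ![]) (by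
    intro m n v
    have h := anticomm_smul c (rel_Gm_Gm c (m - 1) (n - 1)) v
    simpa [Gen.mode, Gen.parity] using h) m n
  simpa only [Gen.parity, mul_one, pow_one, sub_neg_one_smul', Finset.univ_eq_empty,
    Finset.sum_empty] using h

end Representation

section StateField

variable (c : ℂ)

theorem map_central' (φ : FreeAlgebra ℂ Mode →ₐ[ℂ]
    Module.End ℂ (VertexOperator ℂ (VacuumModule c))) (n : ℤ) (z : ℂ) :
    φ (central n z) = (if n = 0 then z else 0) •
      (1 : Module.End ℂ (VertexOperator ℂ (VacuumModule c))) := by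
  rw [central]
  split
  · rw [AlgHom.commutes, Algebra.algebraMap_eq_smul_one]
  · rw [map_zero, zero_smul]

/-- The action of the mode algebra on all fields on the vacuum module in which a mode `X₍ₙ₎` acts
as the `n`-th product with the generating field `X(z)`. -/
def fieldAction : N2Algebra c →ₐ[ℂ] Module.End ℂ (VertexOperator ℂ (VacuumModule c)) :=
  N2Algebra.lift c
    (fun x => match x with
      | .L m => genProduct c .T (m + 1)
      | .J m => genProduct c .J m
      | .Gp m => genProduct c .Gp (m + 1)
      | .Gm m => genProduct c .Gm (m + 1)) (by
    intro x y h
    cases h with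
    | L_L m n =>
      simp only [map_sub, map_add, map_mul, map_smul, FreeAlgebra.lift_ι_apply, map_central']
      rw [genProduct_T_T, show m + 1 + (n + 1) - 1 = m + n + 1 by ring]
      by_cases h : m + n = 0
      · rw [if_pos (by lia), if_pos h]
        push_cast
        module
      · rw [if_neg (by lia), if_neg h]
        push_cast
        module
    | L_J m n =>
      simp only [map_sub, map_mul, map_smul, FreeAlgebra.lift_ι_apply]
      rw [genProduct_T_J, show m + 1 + n - 1 = m + n by ring]
    | L_Gp m n =>
      simp only [map_sub, map_mul, map_smul, FreeAlgebra.lift_ι_apply]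
      rw [genProduct_T_Gp, show m + 1 + (n + 1) - 1 = m + n + 1 by ring]
      push_cast
      module
    | L_Gm m n =>
      simp only [map_sub, map_mul, map_smul, FreeAlgebra.lift_ι_apply]
      rw [genProduct_T_Gm, show m + 1 + (n + 1) - 1 = m + n + 1 by ring]
      push_cast
      module
    | J_J m n =>
      simp only [map_sub, map_mul, FreeAlgebra.lift_ι_apply, map_central']
      rw [genProduct_J_J]
    | J_Gp m n =>
      simp only [map_sub, map_mul, FreeAlgebra.lift_ι_apply]
      rw [genProduct_J_Gp, add_assoc]
    | J_Gm m n =>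
      simp only [map_sub, map_mul, map_neg, FreeAlgebra.lift_ι_apply]
      rw [genProduct_J_Gm, add_assoc]
    | Gp_Gp m n =>
      simp only [map_add, map_mul, map_zero, FreeAlgebra.lift_ι_apply]
      rw [genProduct_Gp_Gp]
    | Gm_Gm m n =>
      simp only [map_add, map_mul, map_zero, FreeAlgebra.lift_ι_apply]
      rw [genProduct_Gm_Gm]
    | Gp_Gm m n =>
      simp only [map_add, map_mul, map_smul, FreeAlgebra.lift_ι_apply, map_central']
      rw [genProduct_Gp_Gm, show m + 1 + (n + 1) - 1 = m + n + 1 by ring,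
        show m + 1 + (n + 1) = m + n + 1 + 1 by ring]
      by_cases h : m + n + 1 = 0
      · rw [if_pos (by lia), if_pos h]
        push_cast
        module
      · rw [if_neg (by lia), if_neg h]
        push_cast
        module)

theorem fieldAction_mode (X : Gen) (n : ℤ) :
    fieldAction c (mode c (X.mode n)) = genProduct c X n := by
  rw [fieldAction, N2Algebra.lift_mode]
  cases X <;> simp [Gen.mode]

/-- The state-field correspondence of the vacuum module: the linear map with `Y(vac) = id` and
`Y(X₍ₙ₎ v) = X(z)₍ₙ₎ Y(v)`, the `n`-th product of fields, for all generators `X`, all `n` and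
all `v`. -/
def VacuumModule.Y : VacuumModule c →ₗ[ℂ] VertexOperator ℂ (VacuumModule c) :=
  VacuumModule.lift c
    ((LinearMap.applyₗ (R := ℂ) (oneField (VacuumModule c))) ∘ₗ (fieldAction c).toLinearMap) (by
    intro u hu
    change fieldAction c u (oneField _) = 0
    induction hu using Submodule.span_induction with
    | mem u hu =>
      obtain ⟨X, n, hn, rfl⟩ := hu
      rw [fieldAction_mode]
      exact fieldProduct_apply_oneField (parity_parity c) _ _ hn
    | zero => rw [map_zero, LinearMap.zero_apply]
    | add a b _ _ ha hb => rw [map_add, LinearMap.add_apply, ha, hb, add_zero]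
    | smul a b _ hb => rw [smul_eq_mul, map_mul, Module.End.mul_apply, hb, map_zero])

theorem VacuumModule.Y_vac : Y c (vac c) = oneField (VacuumModule c) := by
  have h : Y c ((1 : N2Algebra c) • vac c) = fieldAction c 1 (oneField _) :=
    lift_smul_vac ..
  rwa [one_smul, map_one, Module.End.one_apply] at h

theorem VacuumModule.Y_mode_smul (X : Gen) (n : ℤ) (v : VacuumModule c) :
    Y c (mode c (X.mode n) • v) =
      fieldProduct (parity c) X.parity (genField c X) n (Y c v) := by
  obtain ⟨u, rfl⟩ := smul_vac_surjective c v
  have h : ∀ u : N2Algebra c, Y c (u • vac c) = fieldAction c u (oneField _) :=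
    fun u => lift_smul_vac ..
  rw [← mul_smul, h, h, map_mul, fieldAction_mode]
  rfl

end StateField

/-- The data of a conformal vertex superalgebra on a complex vector space `V`. -/
structure VertexData (V : Type*) [AddCommGroup V] [Module ℂ V] where
  /-- The parity involution: `+1` on even vectors and `-1` on odd vectors. -/
  parity : V →ₗ[ℂ] V
  /-- The vacuum vector. -/
  vac : V
  /-- The state-field correspondence `a ↦ Y(a, z) = ∑ₙ a₍ₙ₎ z⁻ⁿ⁻¹`; the mode `a₍ₙ₎` is
  `(Y a)[[n]]`. -/
  Y : V →ₗ[ℂ] VertexOperator ℂ V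
  /-- The conformal vector, with `Y(ω, z)` the energy-momentum tensor. -/
  conformal : V

/-- The state `X = X₍₋₁₎ vac` of a generating field `X(z)`. -/
def genState (c : ℂ) (X : Gen) : VacuumModule c := mode c (X.mode (-1)) • VacuumModule.vac c

/-- The universal `N = 2` superconformal vertex operator superalgebra of central charge `c`. -/
def universalN2 (c : ℂ) : VertexData (VacuumModule c) where
  parity := VacuumModule.parity c
  vac := VacuumModule.vac c
  Y := VacuumModule.Y c
  conformal := genState c .T

section Tensor

variable {V W : Type*} [AddCommGroup V] [Module ℂ V] [AddCommGroup W] [Module ℂ W]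

/-- The value `∑_{k + l = n - 1} A₍ₖ₎ v ⊗ B₍ₗ₎ w` on `v ⊗ w` of the `n`-th mode of the field
`A(z) ⊗ B(z)`. -/
def boxMode (A : VertexOperator ℂ V) (B : VertexOperator ℂ W) (n : ℤ) (v : V) (w : W) : V ⊗[ℂ] W :=
  ∑ᶠ k : ℤ, (A[[k]]) v ⊗ₜ[ℂ] (B[[n - 1 - k]]) w

theorem boxMode_eq {A : VertexOperator ℂ V} {B : VertexOperator ℂ W} {n : ℤ} {v : V} {w : W}
    {M N : ℤ} (hA : ∀ k ≥ M, (A[[k]]) v = 0) (hB : ∀ k ≥ N, (B[[k]]) w = 0) :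
    boxMode A B n v w =
      ∑ k ∈ Finset.Icc (n - N) M, (A[[k]]) v ⊗ₜ[ℂ] (B[[n - 1 - k]]) w := by
  apply finsum_eq_sum_of_support_subset
  intro k hk
  by_contra hlt
  rw [Finset.mem_coe, Finset.mem_Icc, not_and_or] at hlt
  refine hk ?_
  rcases hlt with h | h
  · change _ ⊗ₜ[ℂ] _ = _
    rw [hB _ (by lia), TensorProduct.tmul_zero]
  · change _ ⊗ₜ[ℂ] _ = _
    rw [hA _ (by lia), TensorProduct.zero_tmul]

theorem boxMode_add_left (A A' : VertexOperator ℂ V) (B : VertexOperator ℂ W) (n : ℤ) (v : V)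
    (w : W) : boxMode (A + A') B n v w = boxMode A B n v w + boxMode A' B n v w := by
  obtain ⟨M, hM⟩ := field_trunc A v
  obtain ⟨M', hM'⟩ := field_trunc A' v
  obtain ⟨N, hN⟩ := field_trunc B w
  rw [boxMode_eq (M := max M M') (fun k hk => hM k (by lia)) hN,
    boxMode_eq (M := max M M') (fun k hk => hM' k (by lia)) hN,
    boxMode_eq (M := max M M') (fun k hk => by
      rw [map_add, Pi.add_apply, LinearMap.add_apply, hM k (by lia), hM' k (by lia), add_zero]) hN,
    ← Finset.sum_add_distrib]
  simp only [map_add, Pi.add_apply, LinearMap.add_apply, TensorProduct.add_tmul]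

theorem boxMode_smul_left (a : ℂ) (A : VertexOperator ℂ V) (B : VertexOperator ℂ W) (n : ℤ) (v : V)
    (w : W) : boxMode (a • A) B n v w = a • boxMode A B n v w := by
  obtain ⟨M, hM⟩ := field_trunc A v
  obtain ⟨N, hN⟩ := field_trunc B w
  rw [boxMode_eq hM hN, boxMode_eq (M := M) (fun k hk => by
      rw [map_smul, Pi.smul_apply, LinearMap.smul_apply, hM k hk, smul_zero]) hN, Finset.smul_sum]
  simp only [map_smul, Pi.smul_apply, LinearMap.smul_apply, TensorProduct.smul_tmul']

theorem boxMode_add_right (A : VertexOperator ℂ V) (B B' : VertexOperator ℂ W) (n : ℤ) (v : V)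
    (w : W) : boxMode A (B + B') n v w = boxMode A B n v w + boxMode A B' n v w := by
  obtain ⟨M, hM⟩ := field_trunc A v
  obtain ⟨N, hN⟩ := field_trunc B w
  obtain ⟨N', hN'⟩ := field_trunc B' w
  rw [boxMode_eq hM (N := max N N') (fun k hk => hN k (by lia)),
    boxMode_eq hM (N := max N N') (fun k hk => hN' k (by lia)),
    boxMode_eq hM (N := max N N') (fun k hk => by
      rw [map_add, Pi.add_apply, LinearMap.add_apply, hN k (by lia), hN' k (by lia), add_zero]),
    ← Finset.sum_add_distrib]
  simp only [map_add, Pi.add_apply, LinearMap.add_apply, TensorProduct.tmul_add]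

theorem boxMode_smul_right (a : ℂ) (A : VertexOperator ℂ V) (B : VertexOperator ℂ W) (n : ℤ)
    (v : V) (w : W) : boxMode A (a • B) n v w = a • boxMode A B n v w := by
  obtain ⟨M, hM⟩ := field_trunc A v
  obtain ⟨N, hN⟩ := field_trunc B w
  rw [boxMode_eq hM hN, boxMode_eq hM (N := N) (fun k hk => by
      rw [map_smul, Pi.smul_apply, LinearMap.smul_apply, hN k hk, smul_zero]), Finset.smul_sum]
  simp only [map_smul, Pi.smul_apply, LinearMap.smul_apply, TensorProduct.tmul_smul]

/-- The field `A(z) ⊗ B(z)` on `V ⊗ W`, without signs. -/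
def box (A : VertexOperator ℂ V) (B : VertexOperator ℂ W) : VertexOperator ℂ (V ⊗[ℂ] W) :=
  mkField
    (fun n => TensorProduct.lift (LinearMap.mk₂ ℂ (boxMode A B n)
      (fun v v' w => by
        obtain ⟨M, hM⟩ := field_trunc A v
        obtain ⟨M', hM'⟩ := field_trunc A v'
        obtain ⟨N, hN⟩ := field_trunc B w
        rw [boxMode_eq (M := max M M') (fun k hk => hM k (by lia)) hN,
          boxMode_eq (M := max M M') (fun k hk => hM' k (by lia)) hN,
          boxMode_eq (M := max M M') (fun k hk => by
            rw [map_add, hM k (by lia), hM' k (by lia), add_zero]) hN, ← Finset.sum_add_distrib]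
        simp only [map_add, TensorProduct.add_tmul])
      (fun a v w => by
        obtain ⟨M, hM⟩ := field_trunc A v
        obtain ⟨N, hN⟩ := field_trunc B w
        rw [boxMode_eq hM hN, boxMode_eq (M := M) (fun k hk => by
            rw [map_smul, hM k hk, smul_zero]) hN, Finset.smul_sum]
        simp only [map_smul, TensorProduct.smul_tmul'])
      (fun v w w' => by
        obtain ⟨M, hM⟩ := field_trunc A v
        obtain ⟨N, hN⟩ := field_trunc B w
        obtain ⟨N', hN'⟩ := field_trunc B w'
        rw [boxMode_eq hM (N := max N N') (fun k hk => hN k (by lia)),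
          boxMode_eq hM (N := max N N') (fun k hk => hN' k (by lia)),
          boxMode_eq hM (N := max N N') (fun k hk => by
            rw [map_add, hN k (by lia), hN' k (by lia), add_zero]), ← Finset.sum_add_distrib]
        simp only [map_add, TensorProduct.tmul_add])
      (fun a v w => by
        obtain ⟨M, hM⟩ := field_trunc A v
        obtain ⟨N, hN⟩ := field_trunc B w
        rw [boxMode_eq hM hN, boxMode_eq hM (N := N) (fun k hk => by
            rw [map_smul, hN k hk, smul_zero]), Finset.smul_sum]
        simp only [map_smul, TensorProduct.tmul_smul])))
    (fun x => by
      induction x using TensorProduct.induction_on with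
      | zero => exact ⟨0, fun n _ => map_zero _⟩
      | tmul v w =>
        obtain ⟨M, hM⟩ := field_trunc A v
        obtain ⟨N, hN⟩ := field_trunc B w
        refine ⟨M + N + 1, fun n hn => ?_⟩
        rw [TensorProduct.lift.tmul, LinearMap.mk₂_apply, boxMode_eq hM hN,
          Finset.Icc_eq_empty (by lia), Finset.sum_empty]
      | add x y hx hy =>
        obtain ⟨M, hM⟩ := hx
        obtain ⟨N, hN⟩ := hy
        refine ⟨max M N, fun n hn => ?_⟩
        rw [map_add, hM n (by lia), hN n (by lia), add_zero])

theorem box_apply (A : VertexOperator ℂ V) (B : VertexOperator ℂ W) (n : ℤ) (v : V) (w : W) :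
    ((box A B)[[n]]) (v ⊗ₜ[ℂ] w) = boxMode A B n v w := by
  rw [box, mkField_ncoeff, TensorProduct.lift.tmul, LinearMap.mk₂_apply]

theorem field_ext_tmul {A B : VertexOperator ℂ (V ⊗[ℂ] W)}
    (h : ∀ n v w, (A[[n]]) (v ⊗ₜ[ℂ] w) = (B[[n]]) (v ⊗ₜ[ℂ] w)) : A = B := by
  refine field_ext fun n x => ?_
  induction x using TensorProduct.induction_on with
  | zero => rw [map_zero, map_zero]
  | tmul v w => exact h n v w
  | add x y hx hy => rw [map_add, map_add, hx, hy]

/-- `A(z) ⊗ B(z)` as a bilinear function of the two fields. -/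
def boxBilin :
    VertexOperator ℂ V →ₗ[ℂ] VertexOperator ℂ W →ₗ[ℂ] VertexOperator ℂ (V ⊗[ℂ] W) :=
  LinearMap.mk₂ ℂ box
    (fun A A' B => field_ext_tmul fun n v w => by
      rw [map_add, Pi.add_apply, LinearMap.add_apply, box_apply, box_apply, box_apply,
        boxMode_add_left])
    (fun a A B => field_ext_tmul fun n v w => by
      rw [map_smul, Pi.smul_apply, LinearMap.smul_apply, box_apply, box_apply, boxMode_smul_left])
    (fun A B B' => field_ext_tmul fun n v w => by
      rw [map_add, Pi.add_apply, LinearMap.add_apply, box_apply, box_apply, box_apply,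
        boxMode_add_right])
    (fun a A B => field_ext_tmul fun n v w => by
      rw [map_smul, Pi.smul_apply, LinearMap.smul_apply, box_apply, box_apply, boxMode_smul_right])

namespace VertexData

/-- The even part of a vector. -/
def evenPart (S : VertexData V) : V →ₗ[ℂ] V := (1 / 2 : ℂ) • (LinearMap.id + S.parity)

/-- The odd part of a vector. -/
def oddPart (S : VertexData V) : V →ₗ[ℂ] V := (1 / 2 : ℂ) • (LinearMap.id - S.parity)

/-- The state-field correspondence of a tensor product: `Y(a ⊗ b) = Y(a) ⊗ Y(b)` with the Koszul
sign, `(a ⊗ b)₍ₙ₎ (v ⊗ w) = (-1)^{|b||v|} ∑_{k + l = n - 1} a₍ₖ₎ v ⊗ b₍ₗ₎ w`. -/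
def tensorY (S : VertexData V) (S' : VertexData W) :
    V ⊗[ℂ] W →ₗ[ℂ] VertexOperator ℂ (V ⊗[ℂ] W) :=
  TensorProduct.lift (LinearMap.mk₂ ℂ
    (fun a b => boxBilin (S.Y a) (S'.Y (S'.evenPart b)) +
      boxBilin (S.Y a ∘ₗ S.parity) (S'.Y (S'.oddPart b)))
    (fun a a' b => by
      simp only [map_add, LinearMap.add_apply, LinearMap.add_comp]
      abel)
    (fun r a b => by
      simp only [map_smul, LinearMap.smul_apply, LinearMap.smul_comp, smul_add])
    (fun a b b' => by
      simp only [map_add]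
      abel)
    (fun r a b => by
      simp only [map_smul, smul_add]))

/-- The tensor product of two vertex operator superalgebras. -/
def tensor (S : VertexData V) (S' : VertexData W) : VertexData (V ⊗[ℂ] W) where
  parity := TensorProduct.map S.parity S'.parity
  vac := S.vac ⊗ₜ[ℂ] S'.vac
  Y := tensorY S S'
  conformal := S.conformal ⊗ₜ[ℂ] S'.vac + S.vac ⊗ₜ[ℂ] S'.conformal

/-- A conformal embedding: an injective homomorphism of vertex superalgebras that maps the
conformal vector to the conformal vector. -/
structure IsConformalEmbedding (S : VertexData V) (S' : VertexData W) (f : V →ₗ[ℂ] W) : Prop where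
  injective : Function.Injective f
  map_parity : ∀ a, f (S.parity a) = S'.parity (f a)
  map_vac : f S.vac = S'.vac
  map_conformal : f S.conformal = S'.conformal
  map_product : ∀ (a b : V) (n : ℤ), f (((S.Y a)[[n]]) b) = ((S'.Y (f a))[[n]]) (f b)

end VertexData

end Tensor

/-- The central charge `c_d = 3 - 6/d`. -/
def centralCharge (d : ℕ) : ℂ := 3 - 6 / d

/-- The universal `N = 2` vertex operator superalgebra `V_d` of central charge `3 - 6/d`. -/
def universalVOA (d : ℕ) : VertexData (VacuumModule (centralCharge d)) :=
  universalN2 (centralCharge d)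

/-- The diagonal map `X ↦ X ⊗ 1 + 1 ⊗ X` on the generators `X ∈ {J, T, G⁺, G⁻}` extends to a
conformal embedding of `V_{d₁}` into `V_{d₂} ⊗ V_{d₃}`. -/
def DiagonalIsConformalEmbedding (d₁ d₂ d₃ : ℕ) : Prop :=
  ∃ f : VacuumModule (centralCharge d₁) →ₗ[ℂ]
      VacuumModule (centralCharge d₂) ⊗[ℂ] VacuumModule (centralCharge d₃),
    VertexData.IsConformalEmbedding (universalVOA d₁)
      ((universalVOA d₂).tensor (universalVOA d₃)) f ∧
    ∀ X : Gen, f (genState _ X) =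
      genState _ X ⊗ₜ[ℂ] (universalVOA d₃).vac + (universalVOA d₂).vac ⊗ₜ[ℂ] genState _ X

end SuperVOA

end

/-!
The tensor product of modules of central charges `c₂` and `c₃` carries, with Koszul signs, the
diagonal action of the `N = 2` algebra of central charge `c₂ + c₃` (`diagonalAction`). The
vector `vac ⊗ vac` is killed by the annihilation modes, so there is a unique map of modules
`diagonalMap` out of the vacuum module of central charge `c₂ + c₃` that preserves the vacuum.

It is a homomorphism of vertex superalgebras because the state-field correspondence of the tensor
product turns the diagonal action of a mode `X₍ₘ₎` into the `m`-th product with the diagonal field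
`X(z) ⊗ 1 + 1 ⊗ X(z)` (`tensorY_diagonalMode`), exactly as the state-field correspondence of the
vacuum module turns `X₍ₘ₎` into the `m`-th product with `X(z)`; an induction over the vacuum module
compares the two.

It is injective for a reason that needs no Poincaré-Birkhoff-Witt theorem. Let `𝔤₋` be the span of the
creation modes. Its enveloping algebra `U(𝔤₋)` acts on `Hom(𝔤, U(𝔤₋))`, where `𝔤` is the centrally
extended `N = 2` algebra, and acting with `u` on the linear map that is the identity on the creation
modes, `0` on the annihilation modes and `c` on the central element gives the map `x ↦ x u` of an
action of `𝔤` on `U(𝔤₋)` (`CreationAlgebra.act_supercommutator`). Hence every vacuum module, whatever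
its central charge, is a free module of rank one over `U(𝔤₋)`. In particular the second factor of the
tensor product has an augmentation `ε` that vanishes on `𝔤₋` times the module. The map
`v ⊗ w ↦ ε(w) v` to `U(𝔤₋)` is `𝔤₋`-linear and sends `vac ⊗ vac` to `1`, so composed with the
diagonal map it is the identification of the vacuum module with `U(𝔤₋)` (`diagonalMap_injective`).

Conversely, `J₍₁₎J = (c / 3) vac`, and a diagonal embedding forces the central charges to add up.
What remains is the equation `1/d₂ + 1/d₃ = 1/2 + 1/d₁` in positive integers: if `3 ≤ d₂ ≤ d₃` then
`1/d₂ + 1/d₃ > 1/2` leaves `d₂ = 3` and `d₃ < 6`.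
-/

noncomputable section

namespace SuperVOA

/-! ### The bracket of the `N = 2` algebra -/

section Bracket

variable {M N : Type*} [AddCommGroup M] [Module ℂ M] [AddCommGroup N] [Module ℂ N]

/-- The bracket of two modes, modulo the central element: `bracket f x y` is the value on `[x, y]`
of the linear extension of `f`. -/
def bracket (f : Mode → M) : Mode → Mode → M
  | .L m, .L n => (m - n : ℂ) • f (.L (m + n))
  | .L m, .J n => (-n : ℂ) • f (.J (m + n))
  | .L m, .Gp n => (m / 2 - (n + 1 / 2) : ℂ) • f (.Gp (m + n))
  | .L m, .Gm n => (m / 2 - (n + 1 / 2) : ℂ) • f (.Gm (m + n))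
  | .J m, .L n => (m : ℂ) • f (.J (m + n))
  | .J _, .J _ => 0
  | .J m, .Gp n => f (.Gp (m + n))
  | .J m, .Gm n => -f (.Gm (m + n))
  | .Gp m, .L n => (m + 1 / 2 - n / 2 : ℂ) • f (.Gp (m + n))
  | .Gp m, .J n => -f (.Gp (m + n))
  | .Gp _, .Gp _ => 0
  | .Gp m, .Gm n => (2 : ℂ) • f (.L (m + n + 1)) + (m - n : ℂ) • f (.J (m + n + 1))
  | .Gm m, .L n => (m + 1 / 2 - n / 2 : ℂ) • f (.Gm (m + n))
  | .Gm m, .J n => f (.Gm (m + n))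
  | .Gm m, .Gp n => (2 : ℂ) • f (.L (m + n + 1)) + (n - m : ℂ) • f (.J (m + n + 1))
  | .Gm _, .Gm _ => 0

/-- The central part of the bracket of two modes, with the central element acting as `c`. -/
def cocycle (c : ℂ) : Mode → Mode → ℂ
  | .L m, .L n => if m + n = 0 then c / 12 * (m ^ 3 - m) else 0
  | .J m, .J n => if m + n = 0 then c / 3 * m else 0
  | .Gp m, .Gm n => if m + n + 1 = 0 then c / 3 * ((m + 1 / 2) ^ 2 - 1 / 4) else 0
  | .Gm m, .Gp n => if m + n + 1 = 0 then c / 3 * ((n + 1 / 2) ^ 2 - 1 / 4) else 0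
  | _, _ => 0

/-- The sign `(-1)^{|x||y|}` of exchanging two modes. -/
def koszul (x y : Mode) : ℂ := (-1) ^ (x.parity * y.parity)

theorem koszul_comm (x y : Mode) : koszul x y = koszul y x := by rw [koszul, koszul, mul_comm]

theorem koszul_mul_self (x y : Mode) : koszul x y * koszul x y = 1 := by
  rw [koszul, ← mul_pow]; simp

theorem map_bracket (φ : M →ₗ[ℂ] N) (f : Mode → M) (x y : Mode) :
    φ (bracket f x y) = bracket (fun z => φ (f z)) x y := by
  cases x <;> cases y <;> simp [bracket]

theorem bracket_add (f g : Mode → M) (x y : Mode) :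
    bracket (fun z => f z + g z) x y = bracket f x y + bracket g x y := by
  cases x <;> cases y <;> simp only [bracket] <;> module

theorem bracket_smul (a : ℂ) (f : Mode → M) (x y : Mode) :
    bracket (fun z => a • f z) x y = a • bracket f x y := by
  cases x <;> cases y <;> simp only [bracket] <;> module

theorem bracket_smul_const (f : Mode → ℂ) (a : M) (x y : Mode) :
    bracket (fun z => f z • a) x y = bracket f x y • a :=
  (map_bracket (LinearMap.toSpanSingleton ℂ M a) f x y).symm

/-- The bracket of two modes has the sum of their parities. -/
theorem bracket_koszul (f : Mode → M) (x y w : Mode) :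
    bracket (fun z => koszul z w • f z) x y = (koszul x w * koszul y w) • bracket f x y := by
  cases x <;> cases y <;> cases w <;> simp [bracket, koszul, Mode.parity]

/-- The cocycle pairs only modes of equal parity. -/
theorem cocycle_koszul (c : ℂ) (x y w : Mode) :
    koszul x w * koszul y w * cocycle c x y = cocycle c x y := by
  cases x <;> cases y <;> cases w <;> simp [cocycle, koszul, Mode.parity]

theorem bracket_swap (f : Mode → M) (x y : Mode) :
    bracket f y x = -(koszul x y • bracket f x y) := by
  cases x <;> cases y <;>
    simp only [bracket, koszul, Mode.parity, mul_zero, mul_one, pow_zero, pow_one,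
      add_comm _ (_ : ℤ)] <;> module

theorem cocycle_swap (c : ℂ) (x y : Mode) :
    cocycle c y x = -(koszul x y * cocycle c x y) := by
  cases x <;> cases y <;>
    simp only [cocycle, koszul, Mode.parity, mul_zero, mul_one, pow_zero, pow_one]
  all_goals try simp only [neg_zero]
  case L.L m n =>
    by_cases h : m + n = 0
    · obtain rfl : n = -m := by lia
      rw [if_pos (by lia), if_pos (by lia)]; push_cast; ring
    · rw [if_neg (by lia), if_neg (by lia)]; simp
  case J.J m n =>
    by_cases h : m + n = 0
    · obtain rfl : n = -m := by lia
      rw [if_pos (by lia), if_pos (by lia)]; push_cast; ring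
    · rw [if_neg (by lia), if_neg (by lia)]; simp
  case Gp.Gm m n | Gm.Gp m n =>
    by_cases h : m + n + 1 = 0
    · rw [if_pos (by lia), if_pos (by lia)]; ring
    · rw [if_neg (by lia), if_neg (by lia)]; simp

set_option maxHeartbeats 1600000 in
/-- The Jacobi identity of the `N = 2` algebra modulo the centre. -/
theorem bracket_jacobi (f : Mode → M) (x y w : Mode) :
    bracket (fun z => bracket f z w) x y - koszul y w • bracket (fun z => bracket f z y) x w =
      bracket (fun z => bracket f x z) y w := by
  rcases x with x | x | x | x <;> rcases y with y | y | y | y <;> rcases w with w | w | w | w <;>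
    simp only [bracket, koszul, Mode.parity, mul_zero, mul_one, pow_zero, pow_one,
      smul_zero, sub_zero, add_zero, neg_zero] <;>
    push_cast <;>
    ring_nf <;> try module

set_option maxHeartbeats 1600000 in
/-- The cocycle identity, that is, the central part of the Jacobi identity. -/
theorem cocycle_jacobi (c : ℂ) (x y w : Mode) :
    bracket (fun z => cocycle c z w) x y - koszul y w * bracket (fun z => cocycle c z y) x w =
      bracket (fun z => cocycle c x z) y w := by
  rcases x with x | x | x | x <;> rcases y with y | y | y | y <;> rcases w with w | w | w | w <;>
    simp only [bracket, cocycle, koszul, Mode.parity, mul_zero, mul_one, pow_zero, pow_one,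
      sub_zero, zero_add, add_zero, neg_zero, smul_eq_mul, sub_self]
  all_goals
    try
      split_ifs <;>
      first
      | (exfalso; lia)
      | (simp only [mul_zero, sub_zero, neg_zero])
      -- The central terms survive only if the three modes have total degree zero; with half-integral
      -- labels written as `m + 1/2` this is one of two conditions on the integer labels.
      | (have hw : x + y + w = 0 ∨ x + y + w + 1 = 0 := by lia
         rcases hw with hw | hw
         · first
           | (exfalso; lia)
           | (obtain rfl : w = -x - y := by lia
              push_cast; ring)
         · first
           | (exfalso; lia)
           | (obtain rfl : w = -x - y - 1 := by lia
              push_cast; ring))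

end Bracket

/-! ### Creation and annihilation modes -/

section ModeRelations

variable (c : ℂ)

/-- The relations of the mode algebra in uniform notation. -/
theorem mode_supercommutator (x y : Mode) :
    mode c x * mode c y - koszul x y • (mode c y * mode c x) =
      bracket (mode c) x y + cocycle c x y • (1 : N2Algebra c) := by
  have swap : ∀ a b z : N2Algebra c, a * b - b * a = z → b * a - a * b = -z := fun a b z h => by
    rw [← h, neg_sub]
  cases x <;> cases y <;>
    simp only [bracket, cocycle, koszul, Mode.parity, mul_zero, mul_one, pow_zero, pow_one,
      one_smul, neg_smul, sub_neg_eq_add, zero_smul, add_zero, zero_add]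
  case L.L m n => exact rel_L_L c m n
  case L.J m n => rw [rel_L_J]; module
  case L.Gp m n => exact rel_L_Gp c m n
  case L.Gm m n => exact rel_L_Gm c m n
  case J.L m n => rw [swap _ _ _ (rel_L_J c n m), add_comm n m]; module
  case J.J m n => exact rel_J_J c m n
  case J.Gp m n => exact rel_J_Gp c m n
  case J.Gm m n => exact rel_J_Gm c m n
  case Gp.L m n => rw [swap _ _ _ (rel_L_Gp c n m), add_comm n m]; module
  case Gp.J m n => rw [swap _ _ _ (rel_J_Gp c n m), add_comm]
  case Gp.Gp m n => exact rel_Gp_Gp c m n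
  case Gp.Gm m n => exact rel_Gp_Gm c m n
  case Gm.L m n => rw [swap _ _ _ (rel_L_Gm c n m), add_comm n m]; module
  case Gm.J m n => rw [swap _ _ _ (rel_J_Gm c n m), add_comm, neg_neg]
  case Gm.Gp m n => rw [add_comm, rel_Gp_Gm, add_comm n m]
  case Gm.Gm m n => exact rel_Gm_Gm c m n

/-- A family of operators with the supercommutators of the modes respects the defining relations of
the mode algebra. -/
theorem lift_eq_of_supercommutator {A : Type*} [Ring A] [Algebra ℂ A] {f : Mode → A}
    (hf : ∀ x y, f x * f y - koszul x y • (f y * f x) = bracket f x y + cocycle c x y • (1 : A))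
    (x y : FreeAlgebra ℂ Mode) (h : N2Rel c x y) :
    FreeAlgebra.lift ℂ f x = FreeAlgebra.lift ℂ f y := by
  cases h
  case' L_L m n => have h := hf (.L m) (.L n)
  case' L_J m n => have h := hf (.L m) (.J n)
  case' L_Gp m n => have h := hf (.L m) (.Gp n)
  case' L_Gm m n => have h := hf (.L m) (.Gm n)
  case' J_J m n => have h := hf (.J m) (.J n)
  case' J_Gp m n => have h := hf (.J m) (.Gp n)
  case' J_Gm m n => have h := hf (.J m) (.Gm n)
  case' Gp_Gp m n => have h := hf (.Gp m) (.Gp n)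
  case' Gm_Gm m n => have h := hf (.Gm m) (.Gm n)
  case' Gp_Gm m n => have h := hf (.Gp m) (.Gm n)
  all_goals
    simp only [map_sub, map_add, map_neg, map_mul, map_smul, map_zero, FreeAlgebra.lift_ι_apply,
      map_central]
    simpa only [bracket, cocycle, koszul, Mode.parity, mul_zero, mul_one, pow_zero, pow_one,
      one_smul, neg_smul, sub_neg_eq_add, zero_smul, add_zero, zero_add] using h

end ModeRelations

/-- The creation modes `X₍ₙ₎` with `n < 0`. -/
def Mode.IsCreation : Mode → Prop
  | .L m => m ≤ -2
  | .J m => m ≤ -1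
  | .Gp m => m ≤ -2
  | .Gm m => m ≤ -2

theorem Gen.isCreation_mode (X : Gen) (n : ℤ) : (X.mode n).IsCreation ↔ n < 0 := by
  cases X <;> simp only [Gen.mode, Mode.IsCreation] <;> lia

section Creation

variable {M : Type*} [AddCommGroup M] [Module ℂ M] {x y : Mode}

theorem bracket_congr_creation {f g : Mode → M} (h : ∀ z : Mode, z.IsCreation → f z = g z)
    (hx : x.IsCreation) (hy : y.IsCreation) : bracket f x y = bracket g x y := by
  have hL : ∀ m ≤ -2, f (.L m) = g (.L m) := fun m hm => h _ hm
  have hJ : ∀ m ≤ -1, f (.J m) = g (.J m) := fun m hm => h _ hm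
  have hP : ∀ m ≤ -2, f (.Gp m) = g (.Gp m) := fun m hm => h _ hm
  have hM : ∀ m ≤ -2, f (.Gm m) = g (.Gm m) := fun m hm => h _ hm
  cases x <;> cases y <;> simp only [Mode.IsCreation] at hx hy <;>
    simp (discharger := lia) only [bracket, hL, hJ, hP, hM]

theorem cocycle_creation (c : ℂ) (hx : x.IsCreation) (hy : y.IsCreation) : cocycle c x y = 0 := by
  cases x <;> cases y <;> simp only [Mode.IsCreation] at hx hy <;> simp only [cocycle] <;>
    rw [if_neg (by lia)]

/-- The annihilation modes span a subalgebra. -/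
theorem bracket_annihilation {f : Mode → M} (h : ∀ z : Mode, ¬z.IsCreation → f z = 0)
    (hx : ¬x.IsCreation) (hy : ¬y.IsCreation) : bracket f x y = 0 := by
  have key : ∀ (a : ℂ) (z : Mode), (z.IsCreation → a = 0) → a • f z = 0 := fun a z ha => by
    by_cases hz : z.IsCreation
    · rw [ha hz, zero_smul]
    · rw [h z hz, smul_zero]
  cases x with
  | L m | J m | Gp m | Gm m =>
    cases y with
    | L n | J n | Gp n | Gm n =>
      simp only [Mode.IsCreation] at hx hy
      simp only [bracket] <;>
      first
      | (refine key _ _ fun hz => ?_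
         simp only [Mode.IsCreation] at hz
         -- The coefficient vanishes where the bracket would land among the creation modes.
         have hmn : (m = -1 ∧ n = -1) ∨ m = 0 ∨ n = 0 := by lia
         rcases hmn with ⟨rfl, rfl⟩ | rfl | rfl <;>
           first
           | (exfalso; lia)
           | norm_num)
      | exact h _ (by simp only [Mode.IsCreation]; lia)
      | exact neg_eq_zero.2 (h _ (by simp only [Mode.IsCreation]; lia))
      | (rw [h (.L (m + n + 1)) (by simp only [Mode.IsCreation]; lia), smul_zero, zero_add]
         refine key _ _ fun hz => ?_
         simp only [Mode.IsCreation] at hz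
         obtain rfl : m = -1 := by lia
         obtain rfl : n = -1 := by lia
         norm_num)

/-- The central extension splits over the annihilation modes. -/
theorem cocycle_annihilation (c : ℂ) (hx : ¬x.IsCreation) (hy : ¬y.IsCreation) :
    cocycle c x y = 0 := by
  have cube : ∀ m : ℤ, -1 ≤ m → m ≤ 1 → (m : ℂ) ^ 3 - m = 0 := fun m h₁ h₂ => by
    interval_cases m <;> norm_num
  have square : ∀ m : ℤ, -1 ≤ m → m ≤ 0 → ((m : ℂ) + 1 / 2) ^ 2 - 1 / 4 = 0 := fun m h₁ h₂ => by
    interval_cases m <;> norm_num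
  cases x <;> cases y <;> simp only [Mode.IsCreation] at hx hy <;> simp only [cocycle]
  case L.L m n =>
    split_ifs with h
    · rw [cube m (by lia) (by lia), mul_zero]
    · rfl
  case J.J m n =>
    split_ifs with h
    · obtain rfl : m = 0 := by lia
      simp
    · rfl
  case Gp.Gm m n =>
    split_ifs with h
    · rw [square m (by lia) (by lia), mul_zero]
    · rfl
  case Gm.Gp m n =>
    split_ifs with h
    · rw [square n (by lia) (by lia), mul_zero]
    · rfl

end Creation

/-! ### The enveloping algebra of the creation modes -/

/-- The relations of the enveloping algebra of the subalgebra spanned by the creation modes, on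
generators indexed by all modes, of which the annihilation modes are set to zero. -/
inductive CreationRel : FreeAlgebra ℂ Mode → FreeAlgebra ℂ Mode → Prop
  | supercommutator (x y : Mode) (hx : x.IsCreation) (hy : y.IsCreation) :
    CreationRel
      (FreeAlgebra.ι ℂ x * FreeAlgebra.ι ℂ y -
        koszul x y • (FreeAlgebra.ι ℂ y * FreeAlgebra.ι ℂ x))
      (bracket (FreeAlgebra.ι ℂ) x y)
  | annihilation (x : Mode) (hx : ¬x.IsCreation) : CreationRel (FreeAlgebra.ι ℂ x) 0

/-- The enveloping algebra `U(𝔤₋)` of the Lie superalgebra `𝔤₋` spanned by the creation modes. It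
does not depend on a central charge. -/
def CreationAlgebra : Type := RingQuot CreationRel

namespace CreationAlgebra

instance : Ring CreationAlgebra := inferInstanceAs (Ring (RingQuot CreationRel))

instance : Algebra ℂ CreationAlgebra := inferInstanceAs (Algebra ℂ (RingQuot CreationRel))

/-- The quotient map from the free algebra on the modes. -/
def mk : FreeAlgebra ℂ Mode →ₐ[ℂ] CreationAlgebra := RingQuot.mkAlgHom ℂ CreationRel

theorem mk_rel {a b : FreeAlgebra ℂ Mode} (h : CreationRel a b) : mk a = mk b :=
  RingQuot.mkAlgHom_rel ℂ h

theorem mk_surjective : Function.Surjective mk := RingQuot.mkAlgHom_surjective ℂ CreationRel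

/-- A creation mode as an element of `U(𝔤₋)`, and `0` for an annihilation mode. -/
def gen (x : Mode) : CreationAlgebra := mk (FreeAlgebra.ι ℂ x)

theorem gen_annihilation {x : Mode} (hx : ¬x.IsCreation) : gen x = 0 := by
  rw [gen, mk_rel (.annihilation x hx), map_zero]

theorem gen_supercommutator {x y : Mode} (hx : x.IsCreation) (hy : y.IsCreation) :
    gen x * gen y - koszul x y • (gen y * gen x) = bracket gen x y := by
  have h := mk_rel (.supercommutator x y hx hy)
  rw [map_sub, map_smul, map_mul, map_mul] at h
  exact h.trans (map_bracket mk.toLinearMap _ x y)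

open Classical in
/-- The algebra map out of `U(𝔤₋)` with prescribed images of the creation modes. -/
def lift {A : Type*} [Ring A] [Algebra ℂ A] (f : Mode → A)
    (hf : ∀ x y, x.IsCreation → y.IsCreation →
      f x * f y - koszul x y • (f y * f x) = bracket f x y) : CreationAlgebra →ₐ[ℂ] A :=
  RingQuot.liftAlgHom ℂ ⟨FreeAlgebra.lift ℂ fun x => if x.IsCreation then f x else 0, by
    intro a b h
    cases h with
    | supercommutator x y hx hy =>
      have e := map_bracket
        (FreeAlgebra.lift ℂ fun x : Mode => if x.IsCreation then f x else 0).toLinearMap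
        (FreeAlgebra.ι ℂ) x y
      simp only [AlgHom.toLinearMap_apply, FreeAlgebra.lift_ι_apply] at e
      rw [e, map_sub, map_smul, map_mul, map_mul, FreeAlgebra.lift_ι_apply,
        FreeAlgebra.lift_ι_apply, if_pos hx, if_pos hy, hf x y hx hy]
      exact bracket_congr_creation (fun z hz => (if_pos hz).symm) hx hy
    | annihilation x hx => rw [map_zero, FreeAlgebra.lift_ι_apply, if_neg hx]⟩

theorem lift_gen {A : Type*} [Ring A] [Algebra ℂ A] {f : Mode → A}
    {hf : ∀ x y, x.IsCreation → y.IsCreation →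
      f x * f y - koszul x y • (f y * f x) = bracket f x y} {x : Mode} (hx : x.IsCreation) :
    lift f hf (gen x) = f x := by
  have h : lift f hf (gen x) = FreeAlgebra.lift ℂ _ (FreeAlgebra.ι ℂ x) :=
    RingQuot.liftAlgHom_mkAlgHom_apply ..
  rw [h, FreeAlgebra.lift_ι_apply, if_pos hx]

theorem induction {P : CreationAlgebra → Prop} (u : CreationAlgebra) (one : P 1)
    (add : ∀ u v, P u → P v → P (u + v)) (smul : ∀ (a : ℂ) u, P u → P (a • u))
    (gen_mul : ∀ y u, y.IsCreation → P u → P (gen y * u)) : P u := by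
  obtain ⟨f, rfl⟩ := mk_surjective u
  have zero : P 0 := by simpa using smul 0 1 one
  suffices key : ∀ w : CreationAlgebra, P w → P (mk f * w) by
    have h := key 1 one
    rwa [mul_one] at h
  induction f using FreeAlgebra.induction with
  | grade0 r =>
    intro w hw
    rw [AlgHom.commutes, ← Algebra.smul_def]
    exact smul r w hw
  | grade1 x =>
    intro w hw
    by_cases hx : x.IsCreation
    · exact gen_mul x w hx hw
    · have h : mk (FreeAlgebra.ι ℂ x) * w = gen x * w := rfl
      rw [h, gen_annihilation hx, zero_mul]
      exact zero
  | mul a b ha hb =>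
    intro w hw
    rw [map_mul, mul_assoc]
    exact ha _ (hb _ hw)
  | add a b ha hb =>
    intro w hw
    rw [map_add, add_mul]
    exact add _ _ (ha _ hw) (hb _ hw)

/-- The augmentation of `U(𝔤₋)`, which kills all creation modes. -/
def augmentation : CreationAlgebra →ₐ[ℂ] ℂ :=
  lift (fun _ => 0) fun x y _ _ => by cases x <;> cases y <;> simp [bracket]

theorem augmentation_gen (x : Mode) : augmentation (gen x) = 0 := by
  by_cases hx : x.IsCreation
  · exact lift_gen hx
  · rw [gen_annihilation hx, map_zero]

section Coadjoint

variable (c : ℂ)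

/-- The action of a creation mode `y` on `Hom(𝔤, U(𝔤₋))`, where `𝔤` is the `N = 2` algebra with
its central element: `(y f)(x) = f([x, y]) + (-1)^{|x||y|} y f(x)`. A linear map is encoded by
its values on the modes together with an element `a`, such that its value on the central element is
`c a`. -/
def coadjoint (y : Mode) : Module.End ℂ ((Mode → CreationAlgebra) × CreationAlgebra) where
  toFun p := (fun x => bracket p.1 x y + cocycle c x y • p.2 + koszul x y • (gen y * p.1 x),
    gen y * p.2)
  map_add' p q := by
    refine Prod.ext (funext fun x => ?_) (mul_add _ _ _)
    simp only [Prod.fst_add, Prod.snd_add, Pi.add_apply]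
    rw [show p.1 + q.1 = fun z => p.1 z + q.1 z from rfl, bracket_add, mul_add]
    module
  map_smul' a p := by
    refine Prod.ext (funext fun x => ?_) (mul_smul_comm _ _ _)
    simp only [Prod.smul_fst, Prod.smul_snd, Pi.smul_apply, RingHom.id_apply]
    rw [show a • p.1 = fun z => a • p.1 z from rfl, bracket_smul, mul_smul_comm]
    module

theorem coadjoint_fst (y : Mode) (p : (Mode → CreationAlgebra) × CreationAlgebra) (x : Mode) :
    (coadjoint c y p).1 x =
      bracket p.1 x y + cocycle c x y • p.2 + koszul x y • (gen y * p.1 x) := rfl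

theorem coadjoint_snd (y : Mode) (p : (Mode → CreationAlgebra) × CreationAlgebra) :
    (coadjoint c y p).2 = gen y * p.2 := rfl

theorem coadjoint_coadjoint_fst (y w : Mode) (p : (Mode → CreationAlgebra) × CreationAlgebra)
    (x : Mode) : (coadjoint c y (coadjoint c w p)).1 x =
      bracket (fun z => bracket p.1 z w) x y + bracket (fun z => cocycle c z w) x y • p.2 +
        (koszul x w * koszul y w) • (gen w * bracket p.1 x y) + cocycle c x y • (gen w * p.2) +
        koszul x y • (gen y * bracket p.1 x w) + (koszul x y * cocycle c x w) • (gen y * p.2) +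
        (koszul x y * koszul x w) • (gen y * gen w * p.1 x) := by
  have e : (coadjoint c w p).1 = fun z => (bracket p.1 z w + cocycle c z w • p.2) +
      koszul z w • (gen w * p.1 z) := rfl
  have e' : bracket (fun z => gen w * p.1 z) x y = gen w * bracket p.1 x y :=
    (map_bracket (LinearMap.mulLeft ℂ (gen w)) p.1 x y).symm
  rw [coadjoint_fst, coadjoint_fst, coadjoint_snd, e, bracket_add, bracket_add, bracket_koszul,
    bracket_smul_const, e', mul_add, mul_add, mul_smul_comm, mul_smul_comm, mul_assoc]
  module

theorem cocycle_smul_koszul {M : Type*} [AddCommGroup M] [Module ℂ M] (x y w : Mode) (v : M) :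
    cocycle c x y • v = (koszul x w * koszul y w * cocycle c x y) • v := by
  rw [cocycle_koszul]

/-- The creation modes act on `Hom(𝔤, U(𝔤₋))` with the relations of `𝔤₋`, by the Jacobi identity. -/
theorem coadjoint_supercommutator {y w : Mode} (hy : y.IsCreation) (hw : w.IsCreation) :
    coadjoint c y * coadjoint c w - koszul y w • (coadjoint c w * coadjoint c y) =
      bracket (coadjoint c) y w := by
  refine LinearMap.ext fun p => Prod.ext (funext fun x => ?_) ?_
  · have e : (bracket (coadjoint c) y w p).1 x =
        bracket (fun z => bracket p.1 x z + cocycle c x z • p.2 + koszul z x • (gen z * p.1 x))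
          y w := by
      have h := map_bracket ((LinearMap.proj x ∘ₗ LinearMap.fst ℂ (Mode → CreationAlgebra)
        CreationAlgebra) ∘ₗ LinearMap.applyₗ (R := ℂ) p) (coadjoint c) y w
      refine h.trans ?_
      simp only [koszul_comm _ x]
      rfl
    have e' : bracket (fun z => gen z * p.1 x) y w = bracket gen y w * p.1 x :=
      (map_bracket (LinearMap.mulRight ℂ (p.1 x)) gen y w).symm
    have hk := koszul_mul_self y w
    rw [e, bracket_add, bracket_add, bracket_koszul, bracket_smul_const, e',
      ← gen_supercommutator hy hw, ← bracket_jacobi, ← cocycle_jacobi, koszul_comm y x,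
      koszul_comm w x]
    simp only [LinearMap.sub_apply, LinearMap.smul_apply, Module.End.mul_apply, Prod.fst_sub,
      Prod.smul_fst, Pi.sub_apply, Pi.smul_apply, coadjoint_coadjoint_fst]
    rw [koszul_comm w y, cocycle_smul_koszul c x y w, cocycle_smul_koszul c x w y]
    rw [koszul_comm w y]
    simp only [sub_mul, smul_mul_assoc]
    match_scalars
    all_goals
      first
      | ring1
      | linear_combination (-koszul x y) * hk
      | linear_combination (-koszul x y * cocycle c x w) * hk
  · have e : (bracket (coadjoint c) y w p).2 = bracket (fun z => gen z * p.2) y w :=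
      map_bracket ((LinearMap.snd ℂ (Mode → CreationAlgebra) CreationAlgebra) ∘ₗ
        LinearMap.applyₗ (R := ℂ) p) (coadjoint c) y w
    have e' : bracket (fun z => gen z * p.2) y w = bracket gen y w * p.2 :=
      (map_bracket (LinearMap.mulRight ℂ p.2) gen y w).symm
    rw [e, e', ← gen_supercommutator hy hw, sub_mul, smul_mul_assoc, mul_assoc, mul_assoc]
    rfl

/-- The action of `U(𝔤₋)` on `Hom(𝔤, U(𝔤₋))`. -/
def coadjointAction :
    CreationAlgebra →ₐ[ℂ] Module.End ℂ ((Mode → CreationAlgebra) × CreationAlgebra) :=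
  lift (coadjoint c) fun _ _ => coadjoint_supercommutator c

theorem coadjointAction_gen_mul {y : Mode} (hy : y.IsCreation) (u : CreationAlgebra)
    (p : (Mode → CreationAlgebra) × CreationAlgebra) :
    coadjointAction c (gen y * u) p = coadjoint c y (coadjointAction c u p) := by
  rw [map_mul, Module.End.mul_apply, coadjointAction, lift_gen hy]

theorem coadjointAction_snd (u : CreationAlgebra)
    (p : (Mode → CreationAlgebra) × CreationAlgebra) : (coadjointAction c u p).2 = u * p.2 := by
  induction u using CreationAlgebra.induction with
  | one => rw [map_one, Module.End.one_apply, one_mul]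
  | add u v hu hv => rw [map_add, LinearMap.add_apply, Prod.snd_add, hu, hv, add_mul]
  | smul a u hu => rw [map_smul, LinearMap.smul_apply, Prod.smul_snd, hu, smul_mul_assoc]
  | gen_mul y u hy hu => rw [coadjointAction_gen_mul c hy, coadjoint_snd, hu, mul_assoc]

/-- The operator by which the mode `x` acts on `U(𝔤₋)`, viewed as the vacuum module of central charge
`c`. For fixed `u` the map `x ↦ x u` is obtained by letting `u` act on the linear map that sends a
creation mode to itself, an annihilation mode to `0` and the central element to `c`. -/
def act (x : Mode) : Module.End ℂ CreationAlgebra where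
  toFun u := (coadjointAction c u (gen, 1)).1 x
  map_add' u v := by rw [map_add]; rfl
  map_smul' a u := by rw [map_smul]; rfl

theorem act_one (x : Mode) : act c x 1 = gen x := by
  change (coadjointAction c 1 (gen, 1)).1 x = gen x
  rw [map_one, Module.End.one_apply]

/-- The recursion `x (y u) = [x, y] u + (-1)^{|x||y|} y (x u)`. -/
theorem act_gen_mul (x : Mode) {y : Mode} (hy : y.IsCreation) (u : CreationAlgebra) :
    act c x (gen y * u) = bracket (fun z => act c z u) x y + cocycle c x y • u +
      koszul x y • (gen y * act c x u) := by
  change (coadjointAction c (gen y * u) (gen, 1)).1 x = _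
  rw [coadjointAction_gen_mul c hy, coadjoint_fst, coadjointAction_snd, mul_one]
  rfl

/-- Creation modes act by left multiplication. -/
theorem act_creation {x : Mode} (hx : x.IsCreation) (u : CreationAlgebra) :
    act c x u = gen x * u := by
  induction u using CreationAlgebra.induction generalizing x with
  | one => rw [act_one, mul_one]
  | add u v hu hv => rw [map_add, hu hx, hv hx, mul_add]
  | smul a u hu => rw [map_smul, hu hx, mul_smul_comm]
  | gen_mul y u hy hu =>
    have e : bracket (fun z => gen z * u) x y = bracket gen x y * u :=
      (map_bracket (LinearMap.mulRight ℂ u) gen x y).symm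
    rw [act_gen_mul c x hy, bracket_congr_creation (fun z hz => hu hz) hx hy, e,
      cocycle_creation c hx hy, hu hx, ← gen_supercommutator hx hy, sub_mul, smul_mul_assoc,
      mul_assoc, mul_assoc]
    module

theorem act_supercommutator_one (x y : Mode) :
    act c x (act c y 1) - koszul x y • act c y (act c x 1) =
      bracket (fun z => act c z 1) x y + cocycle c x y • (1 : CreationAlgebra) := by
  simp only [act_one]
  have right : ∀ {x y : Mode}, y.IsCreation →
      act c x (gen y) = bracket gen x y + cocycle c x y • 1 + koszul x y • (gen y * gen x) :=
    fun {x y} hy => by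
      have h := act_gen_mul c x hy 1
      simpa only [mul_one, act_one] using h
  by_cases hx : x.IsCreation
  · by_cases hy : y.IsCreation
    · rw [right hy, act_creation c hy]
      module
    · rw [gen_annihilation hy, map_zero, right hx, gen_annihilation hy, mul_zero, smul_zero,
        add_zero, bracket_swap gen x y, cocycle_swap c x y]
      have hk := koszul_mul_self x y
      match_scalars
      · linear_combination hk
      · linear_combination cocycle c x y * hk
  · by_cases hy : y.IsCreation
    · rw [right hy, gen_annihilation hx, map_zero, mul_zero, smul_zero, sub_zero, add_zero]
    · rw [gen_annihilation hx, gen_annihilation hy, map_zero, map_zero, smul_zero, sub_zero,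
        bracket_annihilation (fun z hz => gen_annihilation hz) hx hy,
        cocycle_annihilation c hx hy, zero_smul, add_zero]

/-- The modes act on `U(𝔤₋)` with the relations of the `N = 2` algebra of central charge `c`. -/
theorem act_supercommutator (x y : Mode) (u : CreationAlgebra) :
    act c x (act c y u) - koszul x y • act c y (act c x u) =
      bracket (fun z => act c z u) x y + cocycle c x y • u := by
  induction u using CreationAlgebra.induction generalizing x y with
  | one => exact act_supercommutator_one c x y
  | add u v hu hv =>
    have e := bracket_add (fun z => act c z u) (fun z => act c z v) x y
    simp only [map_add]
    rw [e, smul_add, smul_add, ← sub_eq_zero]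
    have h := congrArg₂ (· + ·) (sub_eq_zero.2 (hu x y)) (sub_eq_zero.2 (hv x y))
    simp only [add_zero] at h
    rw [← h]
    abel
  | smul a u hu =>
    have e := bracket_smul a (fun z => act c z u) x y
    simp only [map_smul]
    rw [e, smul_comm _ a, smul_comm _ a, ← smul_add, ← smul_sub, hu]
  | gen_mul w u hw hu =>
    set F : Mode → CreationAlgebra := fun z => act c z u with hF
    have hu' : ∀ x y, act c x (act c y u) =
        koszul x y • act c y (act c x u) + (bracket F x y + cocycle c x y • u) := fun x y => by
      rw [← hu]; abel
    -- By the recursion for `act` and the hypothesis for `u`, both sides become combinations of double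
    -- brackets, which agree by the Jacobi identity.
    have expand : ∀ x y, act c x (act c y (gen w * u)) =
        bracket (fun z => act c x (act c z u)) y w + cocycle c y w • act c x u +
          koszul y w • (bracket (fun z => act c z (act c y u)) x w + cocycle c x w • act c y u +
            koszul x w • (gen w * act c x (act c y u))) := fun x y => by
      rw [act_gen_mul c y hw, map_add, map_add, map_smul, map_smul, act_gen_mul c x hw,
        map_bracket (act c x)]
    have inner : ∀ x y, bracket (fun z => act c x (act c z u)) y w =
        (koszul y x * koszul w x) • bracket (fun z => act c z (act c x u)) y w +
          (bracket (fun z => bracket F x z) y w + bracket (fun z => cocycle c x z) y w • u) :=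
      fun x y => by
        rw [← bracket_koszul, ← bracket_smul_const, ← bracket_add, ← bracket_add]
        simp only [hu' x, koszul_comm x]
    have e₁ : bracket (fun z => act c z (gen w * u)) x y =
        bracket (fun z => bracket F z w) x y + bracket (fun z => cocycle c z w) x y • u +
          (koszul x w * koszul y w) • (gen w * bracket F x y) := by
      have e' : bracket (fun z => gen w * F z) x y = gen w * bracket F x y :=
        (map_bracket (LinearMap.mulLeft ℂ (gen w)) F x y).symm
      rw [← e', ← bracket_koszul, ← bracket_smul_const, ← bracket_add, ← bracket_add]
      simp only [act_gen_mul c _ hw, hF]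
    have e₂ : gen w * act c x (act c y u) = koszul x y • (gen w * act c y (act c x u)) +
        (gen w * bracket F x y + cocycle c x y • (gen w * u)) := by
      rw [hu' x y, mul_add, mul_add, mul_smul_comm, mul_smul_comm]
    have j₁ := bracket_jacobi F x y w
    have j₂ := cocycle_jacobi c x y w
    have hk := koszul_mul_self x y
    have s₁ : bracket (fun z => bracket F y z) x w =
        -(koszul x y * koszul y w) • bracket (fun z => bracket F z y) x w := by
      have e : (fun z => bracket F y z) = fun z => (-1 : ℂ) • koszul z y • bracket F z y :=
        funext fun z => by rw [bracket_swap F z y]; module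
      rw [e, bracket_smul, bracket_koszul, koszul_comm w y]
      module
    have s₂ : bracket (fun z => cocycle c y z) x w =
        -(koszul x y * koszul y w) * bracket (fun z => cocycle c z y) x w := by
      have e : (fun z => cocycle c y z) = fun z => (-1 : ℂ) • koszul z y • cocycle c z y :=
        funext fun z => by rw [cocycle_swap c z y]; simp
      rw [e, bracket_smul, bracket_koszul, koszul_comm w y]
      simp only [smul_eq_mul]
      ring
    rw [expand, expand, inner x y, inner y x, e₁, e₂, s₁, s₂, ← j₁, ← j₂]
    rw [koszul_comm y x, koszul_comm w x, koszul_comm w y]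
    have c₁ := cocycle_koszul c y w x
    rw [koszul_comm y x, koszul_comm w x] at c₁
    have c₂ := cocycle_koszul c x w y
    rw [koszul_comm w y] at c₂
    have c₃ := cocycle_koszul c x y w
    match_scalars
    all_goals
      first
      | ring1
      | linear_combination koszul y w * hk
      | linear_combination (-koszul y w) * hk
      | linear_combination koszul y w * bracket (fun z => cocycle c z y) x w * hk
      | linear_combination -c₁
      | linear_combination koszul x y * c₂ - koszul y w * cocycle c x w * hk
      | linear_combination c₃

end Coadjoint
end CreationAlgebra

/-! ### The vacuum module and the diagonal map -/

section VacuumStructure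

variable (c : ℂ)

/-- The action of the mode algebra of any central charge `c` on `U(𝔤₋)`. -/
def creationAction : N2Algebra c →ₐ[ℂ] Module.End ℂ CreationAlgebra :=
  N2Algebra.lift c (CreationAlgebra.act c) <| lift_eq_of_supercommutator c fun x y => by
    refine LinearMap.ext fun u => ?_
    have e := map_bracket (LinearMap.applyₗ (R := ℂ) u) (CreationAlgebra.act c) x y
    simp only [LinearMap.applyₗ_apply_apply] at e
    rw [LinearMap.add_apply, e]
    exact CreationAlgebra.act_supercommutator c x y u

theorem creationAction_mode (x : Mode) : creationAction c (mode c x) = CreationAlgebra.act c x :=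
  N2Algebra.lift_mode ..

/-- The map from the vacuum module to `U(𝔤₋)` that sends the vacuum to `1`. -/
def VacuumModule.toCreation : VacuumModule c →ₗ[ℂ] CreationAlgebra :=
  VacuumModule.lift c
    (LinearMap.applyₗ (R := ℂ) (1 : CreationAlgebra) ∘ₗ (creationAction c).toLinearMap) (by
    intro u hu
    change creationAction c u 1 = 0
    induction hu using Submodule.span_induction with
    | mem u hu =>
      obtain ⟨X, n, hn, rfl⟩ := hu
      rw [creationAction_mode, CreationAlgebra.act_one, CreationAlgebra.gen_annihilation]
      rw [Gen.isCreation_mode]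
      lia
    | zero => rw [map_zero, LinearMap.zero_apply]
    | add a b _ _ ha hb => rw [map_add, LinearMap.add_apply, ha, hb, add_zero]
    | smul a b _ hb => rw [smul_eq_mul, map_mul, Module.End.mul_apply, hb, map_zero])

theorem VacuumModule.toCreation_smul_vac (u : N2Algebra c) :
    toCreation c (u • vac c) = creationAction c u 1 :=
  lift_smul_vac ..

theorem VacuumModule.toCreation_vac : toCreation c (vac c) = 1 := by
  have h := toCreation_smul_vac c 1
  rw [one_smul, map_one (creationAction c)] at h
  exact h

theorem VacuumModule.toCreation_mode_smul (x : Mode) (v : VacuumModule c) :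
    toCreation c (mode c x • v) = CreationAlgebra.act c x (toCreation c v) := by
  obtain ⟨u, rfl⟩ := smul_vac_surjective c v
  rw [← mul_smul, toCreation_smul_vac, toCreation_smul_vac, map_mul, creationAction_mode]
  rfl

theorem VacuumModule.vac_ne_zero : vac c ≠ 0 := fun h => by
  have h₁ := congrArg (fun v => CreationAlgebra.augmentation (toCreation c v)) h
  simp [toCreation_vac] at h₁

/-- The inclusion of `U(𝔤₋)` into the mode algebra. -/
def ofCreation : CreationAlgebra →ₐ[ℂ] N2Algebra c :=
  CreationAlgebra.lift (mode c) fun x y hx hy => by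
    rw [mode_supercommutator, cocycle_creation c hx hy, zero_smul, add_zero]

theorem ofCreation_gen {x : Mode} (hx : x.IsCreation) :
    ofCreation c (CreationAlgebra.gen x) = mode c x :=
  CreationAlgebra.lift_gen hx

/-- The vacuum module is stable under all modes already as the span of the vectors `u vac` with `u` in
`U(𝔤₋)`, and there the modes act as on `U(𝔤₋)`. -/
theorem mode_smul_ofCreation_smul_vac (x : Mode) (u : CreationAlgebra) :
    mode c x • ofCreation c u • VacuumModule.vac c =
      ofCreation c (CreationAlgebra.act c x u) • VacuumModule.vac c := by
  induction u using CreationAlgebra.induction generalizing x with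
  | one =>
    rw [map_one, one_smul, CreationAlgebra.act_one]
    by_cases hx : x.IsCreation
    · rw [ofCreation_gen c hx]
    · obtain ⟨X, n, rfl⟩ := gen_mode_surj x
      rw [CreationAlgebra.gen_annihilation hx, map_zero, zero_smul]
      rw [Gen.isCreation_mode] at hx
      exact VacuumModule.mode_smul_vac c X (by lia)
  | add u v hu hv => rw [map_add, add_smul, smul_add, hu, hv, map_add, map_add, add_smul]
  | smul a u hu =>
    rw [map_smul, map_smul, map_smul, smul_assoc, smul_assoc, ← hu, smul_comm]
  | gen_mul y u hy hu =>
    have e := map_bracket ((LinearMap.toSpanSingleton (N2Algebra c) (VacuumModule c)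
      (ofCreation c u • VacuumModule.vac c)).restrictScalars ℂ) (mode c) x y
    have e' := map_bracket ((LinearMap.toSpanSingleton (N2Algebra c) (VacuumModule c)
      (VacuumModule.vac c)).restrictScalars ℂ ∘ₗ (ofCreation c).toLinearMap)
      (fun z => CreationAlgebra.act c z u) x y
    simp only [LinearMap.coe_restrictScalars, LinearMap.toSpanSingleton_apply, LinearMap.comp_apply,
      AlgHom.toLinearMap_apply, hu] at e e'
    have h := congrArg (· • ofCreation c u • VacuumModule.vac c) (mode_supercommutator c x y)
    simp only [sub_smul, add_smul, smul_assoc, one_smul, mul_smul] at h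
    rw [CreationAlgebra.act_gen_mul c x hy, map_add, map_add, map_mul, add_smul, add_smul, e',
      map_smul, map_smul, map_mul, ofCreation_gen c hy, smul_assoc, smul_assoc, mul_smul, mul_smul,
      ← hu, ← e, ← h]
    abel

/-- The vacuum module is generated from the vacuum by the creation modes. -/
theorem VacuumModule.exists_ofCreation_smul_vac (v : VacuumModule c) :
    ∃ u : CreationAlgebra, v = ofCreation c u • vac c := by
  refine VacuumModule.induction c
    (P := fun v => ∃ u : CreationAlgebra, v = ofCreation c u • vac c) v ?_ ?_ ?_ ?_
  · exact ⟨1, by rw [map_one, one_smul]⟩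
  · rintro _ _ ⟨u, rfl⟩ ⟨u', rfl⟩
    exact ⟨u + u', by rw [map_add, add_smul]⟩
  · rintro a _ ⟨u, rfl⟩
    exact ⟨a • u, by rw [map_smul, smul_assoc]⟩
  · rintro X n _ ⟨u, rfl⟩
    exact ⟨_, mode_smul_ofCreation_smul_vac c _ u⟩

end VacuumStructure

section TensorAction

variable (c c' : ℂ)

theorem parity_pow_parity_pow (p : ℕ) (v : VacuumModule c) :
    (VacuumModule.parity c ^ p) ((VacuumModule.parity c ^ p) v) = v := by
  have h : VacuumModule.parity c ^ 2 = 1 := LinearMap.ext fun v => by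
    rw [pow_two]; exact VacuumModule.parity_parity c v
  rw [← Module.End.mul_apply, ← pow_add, ← two_mul, pow_mul, h, one_pow, Module.End.one_apply]

theorem parity_pow_mode_smul (p : ℕ) (x : Mode) (v : VacuumModule c) :
    (VacuumModule.parity c ^ p) (mode c x • v) =
      (-1 : ℂ) ^ (p * x.parity) • mode c x • (VacuumModule.parity c ^ p) v := by
  induction p with
  | zero => simp
  | succ p ih =>
    obtain ⟨X, n, rfl⟩ := gen_mode_surj x
    rw [pow_succ', Module.End.mul_apply, ih, map_smul, VacuumModule.parity_mode_smul, smul_smul,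
      Module.End.mul_apply, ← pow_add, Gen.parity_mode, Nat.succ_mul]

theorem parity_pow_vac (p : ℕ) :
    (VacuumModule.parity c ^ p) (VacuumModule.vac c) = VacuumModule.vac c := by
  induction p with
  | zero => rfl
  | succ p ih => rw [pow_succ', Module.End.mul_apply, ih, VacuumModule.parity_vac]

/-- The diagonal action `x ⊗ 1 + 1 ⊗ x` of a mode on a tensor product of vacuum modules, with the
Koszul sign: `v ⊗ w ↦ x v ⊗ w + (-1)^{|x||v|} v ⊗ x w`. -/
def diagonalMode (x : Mode) : Module.End ℂ (VacuumModule c ⊗[ℂ] VacuumModule c') :=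
  TensorProduct.map (Module.toModuleEnd ℂ (VacuumModule c) (mode c x)) LinearMap.id +
    TensorProduct.map (VacuumModule.parity c ^ x.parity)
      (Module.toModuleEnd ℂ (VacuumModule c') (mode c' x))

theorem diagonalMode_tmul (x : Mode) (v : VacuumModule c) (w : VacuumModule c') :
    diagonalMode c c' x (v ⊗ₜ w) = (mode c x • v) ⊗ₜ w +
      ((VacuumModule.parity c ^ x.parity) v) ⊗ₜ (mode c' x • w) := rfl

theorem cocycle_add (x y : Mode) : cocycle (c + c') x y = cocycle c x y + cocycle c' x y := by
  cases x <;> cases y <;> simp only [cocycle, add_zero] <;> split_ifs <;> ring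

theorem diagonalMode_supercommutator (x y : Mode) :
    diagonalMode c c' x * diagonalMode c c' y -
        koszul x y • (diagonalMode c c' y * diagonalMode c c' x) =
      bracket (diagonalMode c c') x y + cocycle (c + c') x y • 1 := by
  refine TensorProduct.ext' fun v w => ?_
  have e := map_bracket (LinearMap.applyₗ (R := ℂ) (v ⊗ₜ[ℂ] w)) (diagonalMode c c') x y
  simp only [LinearMap.applyₗ_apply_apply, diagonalMode_tmul] at e
  have e₁ : bracket (fun z => (mode c z • v) ⊗ₜ[ℂ] w) x y = (bracket (mode c) x y • v) ⊗ₜ w :=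
    (map_bracket ((TensorProduct.mk ℂ (VacuumModule c) (VacuumModule c')).flip w ∘ₗ
      (LinearMap.toSpanSingleton (N2Algebra c) (VacuumModule c) v).restrictScalars ℂ)
      (mode c) x y).symm
  have e₂ : bracket (fun z => ((VacuumModule.parity c ^ z.parity) v) ⊗ₜ[ℂ] (mode c' z • w)) x y =
      ((VacuumModule.parity c ^ (x.parity + y.parity)) v) ⊗ₜ (bracket (mode c') x y • w) := by
    have h : VacuumModule.parity c ^ 2 = 1 := LinearMap.ext fun v => by
      rw [pow_two]; exact VacuumModule.parity_parity c v
    have h' := map_bracket (TensorProduct.mk ℂ (VacuumModule c) (VacuumModule c')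
        ((VacuumModule.parity c ^ (x.parity + y.parity)) v) ∘ₗ
      (LinearMap.toSpanSingleton (N2Algebra c') (VacuumModule c') w).restrictScalars ℂ)
      (mode c') x y
    refine Eq.trans ?_ h'.symm
    cases x <;> cases y <;> simp [bracket, Mode.parity, h]
  have e₃ : cocycle c' x y • (((VacuumModule.parity c ^ (x.parity + y.parity)) v) ⊗ₜ[ℂ] w) =
      cocycle c' x y • (v ⊗ₜ[ℂ] w) := by
    have h : VacuumModule.parity c ^ 2 = 1 := LinearMap.ext fun v => by
      rw [pow_two]; exact VacuumModule.parity_parity c v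
    cases x <;> cases y <;> simp [cocycle, Mode.parity, h]
  have k₁ := congrArg (fun a => (a • v) ⊗ₜ[ℂ] w) (mode_supercommutator c x y)
  have k₂ := congrArg (fun a => ((VacuumModule.parity c ^ (x.parity + y.parity)) v) ⊗ₜ[ℂ] (a • w))
    (mode_supercommutator c' x y)
  have hxy : ∀ v, (VacuumModule.parity c ^ x.parity) ((VacuumModule.parity c ^ y.parity) v) =
      (VacuumModule.parity c ^ (x.parity + y.parity)) v := fun v => by
    rw [pow_add, Module.End.mul_apply]
  have hyx : ∀ v, (VacuumModule.parity c ^ y.parity) ((VacuumModule.parity c ^ x.parity) v) =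
      (VacuumModule.parity c ^ (x.parity + y.parity)) v := fun v => by
    rw [add_comm, pow_add, Module.End.mul_apply]
  have hs : ∀ (a : ℂ) (v : VacuumModule c) (w : VacuumModule c'),
      (a • v) ⊗ₜ[ℂ] w = a • (v ⊗ₜ[ℂ] w) := fun a v w => (TensorProduct.smul_tmul' a v w).symm
  have hk := koszul_mul_self x y
  have e₄ : (-1 : ℂ) ^ (x.parity * y.parity) = koszul x y := rfl
  have e₅ : (-1 : ℂ) ^ (y.parity * x.parity) = koszul x y := koszul_comm y x
  simp only [sub_smul, add_smul, smul_assoc, one_smul, mul_smul, TensorProduct.sub_tmul,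
    TensorProduct.add_tmul, TensorProduct.tmul_sub, TensorProduct.tmul_add,
    TensorProduct.tmul_smul, hs, e₃] at k₁ k₂
  rw [LinearMap.add_apply, e, bracket_add, e₁, e₂, LinearMap.smul_apply, Module.End.one_apply,
    cocycle_add, LinearMap.sub_apply, LinearMap.smul_apply, Module.End.mul_apply,
    Module.End.mul_apply, diagonalMode_tmul, diagonalMode_tmul, map_add, map_add,
    diagonalMode_tmul, diagonalMode_tmul, diagonalMode_tmul, diagonalMode_tmul,
    parity_pow_mode_smul, parity_pow_mode_smul, hxy, hyx, e₄, e₅, hs, hs, add_smul,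
    add_add_add_comm ((bracket (mode c) x y • v) ⊗ₜ[ℂ] w), ← k₁, ← k₂]
  match_scalars
  all_goals
    first
    | ring1
    | linear_combination hk
    | linear_combination -hk

/-- The diagonal action of the mode algebra on a tensor product of vacuum modules: the central
charges add up. -/
def diagonalAction :
    N2Algebra (c + c') →ₐ[ℂ] Module.End ℂ (VacuumModule c ⊗[ℂ] VacuumModule c') :=
  N2Algebra.lift _ (diagonalMode c c') <|
    lift_eq_of_supercommutator _ (diagonalMode_supercommutator c c')

theorem diagonalAction_mode (x : Mode) :
    diagonalAction c c' (mode _ x) = diagonalMode c c' x :=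
  N2Algebra.lift_mode ..

theorem diagonalMode_vac (X : Gen) {n : ℤ} (hn : 0 ≤ n) :
    diagonalMode c c' (X.mode n) (VacuumModule.vac c ⊗ₜ VacuumModule.vac c') = 0 := by
  rw [diagonalMode_tmul, VacuumModule.mode_smul_vac c X hn, VacuumModule.mode_smul_vac c' X hn,
    TensorProduct.zero_tmul, TensorProduct.tmul_zero, add_zero]

/-- The diagonal map, as the map of modules over the mode algebra that preserves the vacuum. -/
def diagonalMap : VacuumModule (c + c') →ₗ[ℂ] VacuumModule c ⊗[ℂ] VacuumModule c' :=
  VacuumModule.lift _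
    (LinearMap.applyₗ (R := ℂ) (VacuumModule.vac c ⊗ₜ[ℂ] VacuumModule.vac c') ∘ₗ
      (diagonalAction c c').toLinearMap) (by
    intro u hu
    change diagonalAction c c' u (VacuumModule.vac c ⊗ₜ[ℂ] VacuumModule.vac c') = 0
    induction hu using Submodule.span_induction with
    | mem u hu =>
      obtain ⟨X, n, hn, rfl⟩ := hu
      rw [diagonalAction_mode, diagonalMode_vac c c' X hn]
    | zero => rw [map_zero, LinearMap.zero_apply]
    | add a b _ _ ha hb => rw [map_add, LinearMap.add_apply, ha, hb, add_zero]
    | smul a b _ hb => rw [smul_eq_mul, map_mul, Module.End.mul_apply, hb, map_zero])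

theorem diagonalMap_smul_vac (u : N2Algebra (c + c')) :
    diagonalMap c c' (u • VacuumModule.vac (c + c')) =
      diagonalAction c c' u (VacuumModule.vac c ⊗ₜ[ℂ] VacuumModule.vac c') :=
  VacuumModule.lift_smul_vac ..

theorem diagonalMap_vac : diagonalMap c c' (VacuumModule.vac _) =
    VacuumModule.vac c ⊗ₜ[ℂ] VacuumModule.vac c' := by
  have h := diagonalMap_smul_vac c c' (1 : N2Algebra (c + c'))
  rwa [one_smul, map_one, Module.End.one_apply] at h

theorem diagonalMap_mode_smul (x : Mode) (v : VacuumModule (c + c')) :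
    diagonalMap c c' (mode (c + c') x • v) = diagonalMode c c' x (diagonalMap c c' v) := by
  obtain ⟨u, rfl⟩ := VacuumModule.smul_vac_surjective _ v
  rw [← mul_smul, diagonalMap_smul_vac, diagonalMap_smul_vac, map_mul, diagonalAction_mode]
  rfl

/-- The map `v ⊗ w ↦ ε(w) v` to `U(𝔤₋)`, for `ε` the augmentation. -/
def contract : VacuumModule c ⊗[ℂ] VacuumModule c' →ₗ[ℂ] CreationAlgebra :=
  TensorProduct.lift ((LinearMap.lsmul ℂ CreationAlgebra).flip.compl₁₂
    (VacuumModule.toCreation c)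
    (CreationAlgebra.augmentation.toLinearMap ∘ₗ VacuumModule.toCreation c'))

theorem contract_tmul (v : VacuumModule c) (w : VacuumModule c') : contract c c' (v ⊗ₜ w) =
    CreationAlgebra.augmentation (VacuumModule.toCreation c' w) • VacuumModule.toCreation c v := rfl

theorem contract_diagonalMode {x : Mode} (hx : x.IsCreation)
    (t : VacuumModule c ⊗[ℂ] VacuumModule c') :
    contract c c' (diagonalMode c c' x t) = CreationAlgebra.gen x * contract c c' t := by
  induction t using TensorProduct.induction_on with
  | zero => rw [map_zero, map_zero, mul_zero]
  | tmul v w =>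
    rw [diagonalMode_tmul, map_add, contract_tmul, contract_tmul, contract_tmul,
      VacuumModule.toCreation_mode_smul, VacuumModule.toCreation_mode_smul,
      CreationAlgebra.act_creation c hx, CreationAlgebra.act_creation c' hx, map_mul,
      CreationAlgebra.augmentation_gen, zero_mul, zero_smul, add_zero, mul_smul_comm]
  | add s t hs ht => rw [map_add, map_add, hs, ht, map_add, mul_add]

/-- The diagonal map is injective: followed by the contraction with the augmentation of the second
factor it becomes the identification of the vacuum module with `U(𝔤₋)`. -/
theorem diagonalMap_injective : Function.Injective (diagonalMap c c') := by
  refine (injective_iff_map_eq_zero _).2 fun v hv => ?_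
  obtain ⟨u, rfl⟩ := VacuumModule.exists_ofCreation_smul_vac _ v
  have key : ∀ u, contract c c' (diagonalAction c c' (ofCreation _ u)
      (VacuumModule.vac c ⊗ₜ VacuumModule.vac c')) = u := fun u => by
    induction u using CreationAlgebra.induction with
    | one =>
      rw [map_one, map_one, Module.End.one_apply, contract_tmul, VacuumModule.toCreation_vac,
        VacuumModule.toCreation_vac, map_one, one_smul]
    | add u v hu hv => rw [map_add, map_add, LinearMap.add_apply, map_add, hu, hv]
    | smul a u hu => rw [map_smul, map_smul, LinearMap.smul_apply, map_smul, hu]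
    | gen_mul y u hy hu =>
      rw [map_mul, map_mul, Module.End.mul_apply, ofCreation_gen _ hy, diagonalAction_mode,
        contract_diagonalMode c c' hy, hu]
  rw [diagonalMap_smul_vac] at hv
  rw [← key u, hv, map_zero, map_zero, zero_smul]

end TensorAction

/-! ### Fields on a tensor product -/

section FieldAlgebra

variable {V W : Type*} [AddCommGroup V] [Module ℂ V] [AddCommGroup W] [Module ℂ W]

theorem comp_ncoeff (A : VertexOperator ℂ V) (s : V →ₗ[ℂ] V) (n : ℤ) (v : V) :
    ((A ∘ₗ s : VertexOperator ℂ V)[[n]]) v = (A[[n]]) (s v) := rfl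

theorem leftMul_add (A B : VertexOperator ℂ V) (m : ℤ) (C : VertexOperator ℂ V) :
    leftMul (A + B) m C = leftMul A m C + leftMul B m C := by
  refine field_ext fun k v => ?_
  obtain ⟨N, hN⟩ := exists_nat_bound C k v
  simp only [map_add, Pi.add_apply, LinearMap.add_apply, leftMul_apply, leftMode_eq hN, smul_add,
    Finset.sum_add_distrib]

theorem rightMul_add (A B : VertexOperator ℂ V) (m : ℤ) (C : VertexOperator ℂ V) :
    rightMul (A + B) m C = rightMul A m C + rightMul B m C := by
  refine field_ext fun k v => ?_
  obtain ⟨N₁, h₁⟩ := exists_nat_bound' A v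
  obtain ⟨N₂, h₂⟩ := exists_nat_bound' B v
  have h : ∀ j ≥ N₁ + N₂, ((A + B)[[((j : ℕ) : ℤ)]]) v = 0 := fun j hj => by
    rw [map_add, Pi.add_apply, LinearMap.add_apply, h₁ j (by lia), h₂ j (by lia), add_zero]
  rw [map_add, Pi.add_apply, LinearMap.add_apply, rightMul_apply, rightMul_apply, rightMul_apply,
    rightMode_eq h, rightMode_eq (N := N₁ + N₂) (fun j hj => h₁ j (by lia)),
    rightMode_eq (N := N₁ + N₂) (fun j hj => h₂ j (by lia)), ← Finset.sum_add_distrib]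
  simp only [map_add, Pi.add_apply, LinearMap.add_apply, smul_add]

theorem leftMul_comp (A C : VertexOperator ℂ V) (s : V →ₗ[ℂ] V) (m : ℤ) :
    leftMul A m (C ∘ₗ s : VertexOperator ℂ V) = (leftMul A m C ∘ₗ s : VertexOperator ℂ V) := by
  refine field_ext fun k v => ?_
  rw [comp_ncoeff, leftMul_apply, leftMul_apply]
  rfl

theorem rightMul_comp {A : VertexOperator ℂ V} {s : V →ₗ[ℂ] V} {z : ℂ}
    (hA : ∀ n v, s ((A[[n]]) v) = z • (A[[n]]) (s v)) (C : VertexOperator ℂ V) (m : ℤ) :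
    rightMul A m (C ∘ₗ s : VertexOperator ℂ V) =
      z • (rightMul A m C ∘ₗ s : VertexOperator ℂ V) := by
  refine field_ext fun k v => ?_
  obtain ⟨N₁, h₁⟩ := exists_nat_bound' A v
  obtain ⟨N₂, h₂⟩ := exists_nat_bound' A (s v)
  rw [map_smul, Pi.smul_apply, LinearMap.smul_apply, comp_ncoeff, rightMul_apply, rightMul_apply,
    rightMode_eq (N := N₁ + N₂) (fun j hj => h₁ j (by lia)),
    rightMode_eq (N := N₁ + N₂) (fun j hj => h₂ j (by lia)), Finset.smul_sum]
  refine Finset.sum_congr rfl fun j _ => ?_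
  rw [comp_ncoeff, hA, map_smul, smul_comm z]

theorem twist_pow (σ : V →ₗ[ℂ] V) (p : ℕ) : twist σ ^ p = twist (σ ^ p) := by
  induction p with
  | zero =>
    refine LinearMap.ext fun C => field_ext fun n v => ?_
    rw [twist_apply]
    rfl
  | succ p ih =>
    refine LinearMap.ext fun C => field_ext fun n v => ?_
    have h : ∀ v, σ ((σ ^ p) v) = (σ ^ p) (σ v) := fun v => by
      rw [← Module.End.mul_apply, ← pow_succ', pow_succ, Module.End.mul_apply]
    rw [pow_succ, Module.End.mul_apply, ih, twist_apply, twist_apply, twist_apply, pow_succ,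
      Module.End.mul_apply, Module.End.mul_apply, h]

/-- Every field is recovered from its `(-1)`-st product with the identity field. -/
theorem fieldProduct_neg_one_oneField {σ : V →ₗ[ℂ] V} (hσ : ∀ v, σ (σ v) = v) (p : ℕ)
    (A : VertexOperator ℂ V) : fieldProduct σ p A (-1) (oneField V) = A := by
  have htw : (twist σ ^ p) (oneField V) = oneField V := by
    induction p with
    | zero => rfl
    | succ p ih => rw [pow_succ', Module.End.mul_apply, ih, twist_oneField hσ]
  rw [fieldProduct_apply, htw]
  refine field_ext fun k v => ?_
  have hc : ∀ j : ℕ, Ring.choose (-1 : ℤ) j = (-1) ^ j := fun j => by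
    rw [Ring.choose_neg, show (1 : ℤ) + j - 1 = j by ring, Ring.choose_natCast, Nat.choose_self]
    simp [Int.negOnePow_def, Units.smul_def]
  rw [map_sub, Pi.sub_apply, LinearMap.sub_apply, leftMul_apply, rightMul_apply]
  obtain ⟨N, hN⟩ := exists_nat_bound (oneField V) k v
  obtain ⟨N', hN'⟩ := exists_nat_bound' A v
  rw [leftMode_eq (N := N + k.natAbs + 1) (fun j hj => hN j (by lia)),
    rightMode_eq (N := N' + k.natAbs + 1) (fun j hj => hN' j (by lia))]
  simp only [oneField_apply, hc]
  have sq : ∀ j : ℕ, ((-1 : ℤ) ^ j * (-1) ^ j) = 1 := fun j => by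
    rw [← mul_pow]; simp
  by_cases hk : 0 ≤ k
  · obtain ⟨i, rfl⟩ := Int.eq_ofNat_of_zero_le hk
    rw [Finset.sum_eq_zero, Finset.sum_eq_single_of_mem i (Finset.mem_range.2 (by lia)), if_pos (by ring)]
    · have e : (((-1 + i : ℤ)).negOnePow : ℤ) = -(-1) ^ i := by
        rw [add_comm, ← sub_eq_add_neg, Int.negOnePow_sub, Int.negOnePow_one]
        simp [Int.negOnePow_def]
      rw [e, neg_mul, sq]
      simp
    · intro j _ hj
      rw [if_neg (by lia), smul_zero]
    · intro j _
      rw [if_neg (by lia), map_zero, smul_zero]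
  · obtain ⟨i, rfl⟩ : ∃ i : ℕ, k = -1 - i := ⟨(-1 - k).toNat, by lia⟩
    rw [Finset.sum_eq_single_of_mem i (Finset.mem_range.2 (by lia)), Finset.sum_eq_zero, if_pos (by ring), sq,
      one_smul, sub_zero]
    · intro j _
      rw [if_neg (by lia), smul_zero]
    · intro j _ hj
      rw [if_neg (by lia), map_zero, smul_zero]

end FieldAlgebra

section Box

variable {V W : Type*} [AddCommGroup V] [Module ℂ V] [AddCommGroup W] [Module ℂ W]

/-- The mode `∑_l A₍ₗ₊ⱼ₎ v ⊗ B₍ₙ₋₁₋ₗ₋ⱼ₎ w`, with a shifted summation index, as a finite sum. -/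
theorem boxMode_eq_sum {A : VertexOperator ℂ V} {B : VertexOperator ℂ W} {n : ℤ} {v : V} {w : W}
    (j : ℤ) (S : Finset ℤ)
    (h : ∀ l ∉ S, (A[[l + j]]) v ⊗ₜ[ℂ] (B[[n - 1 - (l + j)]]) w = 0) :
    boxMode A B n v w = ∑ l ∈ S, (A[[l + j]]) v ⊗ₜ[ℂ] (B[[n - 1 - (l + j)]]) w := by
  rw [boxMode, ← finsum_comp_equiv (Equiv.addRight j)]
  apply finsum_eq_sum_of_support_subset
  intro l hl
  by_contra hlt
  exact hl (h l hlt)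

theorem exists_finset_boxMode (A : VertexOperator ℂ V) (B : VertexOperator ℂ W) (n j : ℤ) (v : V)
    (w : W) : ∃ S : Finset ℤ, ∀ l ∉ S, (A[[l + j]]) v ⊗ₜ[ℂ] (B[[n - 1 - (l + j)]]) w = 0 := by
  obtain ⟨M, hM⟩ := field_trunc A v
  obtain ⟨N, hN⟩ := field_trunc B w
  refine ⟨Finset.Icc (n - N - j) (M - j), fun l hl => ?_⟩
  rw [Finset.mem_Icc, not_and_or] at hl
  rcases hl with h | h
  · rw [hN _ (by lia), TensorProduct.tmul_zero]
  · rw [hM _ (by lia), TensorProduct.zero_tmul]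

/-- Finitely many shifted sums have a common finite index set. -/
theorem exists_common_finset {T : Type*} [Zero T] (N : ℕ) (F : ℕ → ℤ → T)
    (h : ∀ j, ∃ S : Finset ℤ, ∀ l ∉ S, F j l = 0) :
    ∃ S : Finset ℤ, ∀ j < N, ∀ l ∉ S, F j l = 0 := by
  choose S hS using h
  refine ⟨(Finset.range N).biUnion S, fun j hj l hl => hS j l fun hl' => hl ?_⟩
  exact Finset.mem_biUnion.2 ⟨j, Finset.mem_range.2 hj, hl'⟩

/-- The field `A(z) ⊗ 1`, with modes `A₍ₙ₎ ⊗ 1`. -/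
def fieldLeft (W : Type*) [AddCommGroup W] [Module ℂ W] (A : VertexOperator ℂ V) :
    VertexOperator ℂ (V ⊗[ℂ] W) :=
  mkField (fun n => TensorProduct.map (A[[n]]) LinearMap.id) (fun x => by
    induction x using TensorProduct.induction_on with
    | zero => exact ⟨0, fun n _ => map_zero _⟩
    | tmul v w =>
      obtain ⟨N, hN⟩ := field_trunc A v
      exact ⟨N, fun n hn => by rw [TensorProduct.map_tmul, hN n hn, TensorProduct.zero_tmul]⟩
    | add x y hx hy =>
      obtain ⟨M, hM⟩ := hx
      obtain ⟨N, hN⟩ := hy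
      exact ⟨max M N, fun n hn => by rw [map_add, hM n (by lia), hN n (by lia), add_zero]⟩)

/-- The field `s ⊗ B(z)`, with modes `s ⊗ B₍ₙ₎`, for a linear map `s`. -/
def fieldRight (s : V →ₗ[ℂ] V) (B : VertexOperator ℂ W) : VertexOperator ℂ (V ⊗[ℂ] W) :=
  mkField (fun n => TensorProduct.map s (B[[n]])) (fun x => by
    induction x using TensorProduct.induction_on with
    | zero => exact ⟨0, fun n _ => map_zero _⟩
    | tmul v w =>
      obtain ⟨N, hN⟩ := field_trunc B w
      exact ⟨N, fun n hn => by rw [TensorProduct.map_tmul, hN n hn, TensorProduct.tmul_zero]⟩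
    | add x y hx hy =>
      obtain ⟨M, hM⟩ := hx
      obtain ⟨N, hN⟩ := hy
      exact ⟨max M N, fun n hn => by rw [map_add, hM n (by lia), hN n (by lia), add_zero]⟩)

theorem fieldLeft_tmul (A : VertexOperator ℂ V) (n : ℤ) (v : V) (w : W) :
    ((fieldLeft W A)[[n]]) (v ⊗ₜ w) = ((A[[n]]) v) ⊗ₜ w := by
  rw [fieldLeft, mkField_ncoeff]; rfl

theorem fieldRight_tmul (s : V →ₗ[ℂ] V) (B : VertexOperator ℂ W) (n : ℤ) (v : V) (w : W) :
    ((fieldRight s B)[[n]]) (v ⊗ₜ w) = s v ⊗ₜ ((B[[n]]) w) := by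
  rw [fieldRight, mkField_ncoeff]; rfl

/-- The field `s A(z)`, for a linear map `s`. -/
def postcomp (s : V →ₗ[ℂ] V) (A : VertexOperator ℂ V) : VertexOperator ℂ V :=
  mkField (fun n => s ∘ₗ (A[[n]])) (fun v => by
    obtain ⟨N, hN⟩ := field_trunc A v
    exact ⟨N, fun n hn => by rw [LinearMap.comp_apply, hN n hn, map_zero]⟩)

theorem postcomp_apply (s : V →ₗ[ℂ] V) (A : VertexOperator ℂ V) (n : ℤ) (v : V) :
    ((postcomp s A)[[n]]) v = s ((A[[n]]) v) := by
  rw [postcomp, mkField_ncoeff]; rfl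

/-- For `j` large enough all summands of the modes `k + j` of `A(z) ⊗ B(z)` on `v ⊗ w` vanish. -/
theorem exists_boxMode_bound (A : VertexOperator ℂ V) (B : VertexOperator ℂ W) (k : ℤ) (v : V)
    (w : W) : ∃ J : ℕ, (∀ j ≥ J, boxMode A B (k + (j : ℕ)) v w = 0) ∧
      ∀ j ≥ J, ∀ i l : ℤ, i + l = k + (j : ℕ) - 1 → (A[[i]]) v = 0 ∨ (B[[l]]) w = 0 := by
  obtain ⟨M, hM⟩ := field_trunc A v
  obtain ⟨N, hN⟩ := field_trunc B w
  have h : ∀ j ≥ (M + N + 1 - k).toNat, ∀ i l : ℤ, i + l = k + (j : ℕ) - 1 →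
      (A[[i]]) v = 0 ∨ (B[[l]]) w = 0 := fun j hj i l hil => by
    by_cases hi : M ≤ i
    · exact Or.inl (hM i hi)
    · exact Or.inr (hN l (by lia))
  refine ⟨(M + N + 1 - k).toNat, fun j hj => ?_, h⟩
  rw [boxMode_eq_sum 0 ∅, Finset.sum_empty]
  intro l _
  rcases h j hj (l + 0) (k + j - 1 - (l + 0)) (by ring) with h | h
  · rw [h, TensorProduct.zero_tmul]
  · rw [h, TensorProduct.tmul_zero]

/-- Products with `P(z) ⊗ 1` act on the first factor of `A(z) ⊗ B(z)`; the sum over the modes of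
`A` is shifted by the summation index of the product. -/
theorem leftMul_fieldLeft_box (P A : VertexOperator ℂ V) (B : VertexOperator ℂ W) (m : ℤ) :
    leftMul (fieldLeft W P) m (box A B) = box (leftMul P m A) B := by
  refine field_ext_tmul fun k v w => ?_
  obtain ⟨J, hJ, hJ'⟩ := exists_boxMode_bound A B k v w
  obtain ⟨S, hS⟩ := exists_common_finset J
    (fun j l => (A[[l + j]]) v ⊗ₜ[ℂ] (B[[k + j - 1 - (l + j)]]) w)
    fun j => exists_finset_boxMode A B (k + j) j v w
  have e : ∀ l : ℤ, (((leftMul P m A)[[l]]) v) ⊗ₜ[ℂ] ((B[[k - 1 - l]]) w) =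
      ∑ j ∈ Finset.range J, ((-1) ^ j * Ring.choose m j : ℤ) •
        ((P[[m - j]]) ((A[[l + j]]) v) ⊗ₜ[ℂ] (B[[k + j - 1 - (l + j)]]) w) := fun l => by
    have hi : ∀ j : ℕ, k + j - 1 - (l + j) = k - 1 - l := fun j => by ring
    simp only [hi]
    by_cases hB : (B[[k - 1 - l]]) w = 0
    · simp only [hB, TensorProduct.tmul_zero, smul_zero, Finset.sum_const_zero]
    · rw [leftMul_apply, leftMode_eq (N := J), TensorProduct.sum_tmul]
      · rfl
      · exact fun j hj => (hJ' j hj (l + j) (k - 1 - l) (by ring)).resolve_right hB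
  rw [leftMul_apply, leftMode_eq (N := J) (fun j hj => by rw [box_apply, hJ j hj]), box_apply,
    boxMode_eq_sum 0 S]
  · simp only [add_zero, e]
    rw [Finset.sum_comm]
    refine Finset.sum_congr rfl fun j hj => ?_
    rw [box_apply, boxMode_eq_sum j S (hS j (Finset.mem_range.1 hj)), map_sum, Finset.smul_sum]
    simp only [fieldLeft_tmul]
  · intro l hl
    simp only [add_zero, e]
    refine Finset.sum_eq_zero fun j hj => ?_
    have h := congrArg (TensorProduct.map (P[[m - j]]) (LinearMap.id (R := ℂ) (M := W)))
      (hS j (Finset.mem_range.1 hj) l hl)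
    rw [TensorProduct.map_tmul, map_zero, LinearMap.id_apply] at h
    rw [h, smul_zero]

theorem leftMul_fieldRight_box (s : V →ₗ[ℂ] V) (A : VertexOperator ℂ V) (P B : VertexOperator ℂ W)
    (m : ℤ) : leftMul (fieldRight s P) m (box A B) = box (postcomp s A) (leftMul P m B) := by
  refine field_ext_tmul fun k v w => ?_
  obtain ⟨J, hJ, hJ'⟩ := exists_boxMode_bound A B k v w
  obtain ⟨S, hS⟩ := exists_common_finset J
    (fun j l => (A[[l + 0]]) v ⊗ₜ[ℂ] (B[[k + j - 1 - (l + 0)]]) w)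
    fun j => exists_finset_boxMode A B (k + j) 0 v w
  have e : ∀ l : ℤ, (((postcomp s A)[[l]]) v) ⊗ₜ[ℂ] (((leftMul P m B)[[k - 1 - l]]) w) =
      ∑ j ∈ Finset.range J, ((-1) ^ j * Ring.choose m j : ℤ) •
        (s ((A[[l + 0]]) v) ⊗ₜ[ℂ] (P[[m - j]]) ((B[[k + j - 1 - (l + 0)]]) w)) := fun l => by
    have hi : ∀ j : ℕ, k + j - 1 - l = k - 1 - l + j := fun j => by ring
    simp only [add_zero, hi, postcomp_apply]
    by_cases hA : (A[[l]]) v = 0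
    · simp only [hA, map_zero, TensorProduct.zero_tmul, smul_zero, Finset.sum_const_zero]
    · rw [leftMul_apply, leftMode_eq (N := J), TensorProduct.tmul_sum]
      · exact Finset.sum_congr rfl fun j _ => TensorProduct.tmul_smul _ _ _
      · exact fun j hj => (hJ' j hj l (k - 1 - l + j) (by ring)).resolve_left hA
  rw [leftMul_apply, leftMode_eq (N := J) (fun j hj => by rw [box_apply, hJ j hj]), box_apply,
    boxMode_eq_sum 0 S]
  · simp only [add_zero] at e ⊢
    simp only [e]
    rw [Finset.sum_comm]
    refine Finset.sum_congr rfl fun j hj => ?_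
    rw [box_apply, boxMode_eq_sum 0 S (hS j (Finset.mem_range.1 hj)), map_sum, Finset.smul_sum]
    simp only [fieldRight_tmul, add_zero]
  · intro l hl
    simp only [add_zero] at e hS ⊢
    rw [e]
    refine Finset.sum_eq_zero fun j hj => ?_
    have h := congrArg (TensorProduct.map s (P[[m - j]])) (hS j (Finset.mem_range.1 hj) l hl)
    rw [TensorProduct.map_tmul, map_zero] at h
    rw [h, smul_zero]

theorem rightMul_fieldLeft_box (P A : VertexOperator ℂ V) (B : VertexOperator ℂ W) (m : ℤ) :
    rightMul (fieldLeft W P) m (box A B) = box (rightMul P m A) B := by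
  refine field_ext_tmul fun k v w => ?_
  obtain ⟨J, hJ⟩ := exists_nat_bound' P v
  obtain ⟨S, hS⟩ := exists_common_finset J
    (fun j l => (A[[l + (m - j)]]) ((P[[(j : ℤ)]]) v) ⊗ₜ[ℂ]
      (B[[m + k - j - 1 - (l + (m - j))]]) w)
    fun j => exists_finset_boxMode A B (m + k - j) (m - j) ((P[[(j : ℤ)]]) v) w
  have hi : ∀ (l : ℤ) (j : ℕ), m + k - j - 1 - (l + (m - j)) = k - 1 - l := fun l j => by ring
  have hi' : ∀ (l : ℤ) (j : ℕ), l + (m - j) = m + l - j := fun l j => by ring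
  have e : ∀ l : ℤ, (((rightMul P m A)[[l]]) v) ⊗ₜ[ℂ] ((B[[k - 1 - l]]) w) =
      ∑ j ∈ Finset.range J, (((m + j).negOnePow : ℤ) * Ring.choose m j) •
        ((A[[l + (m - j)]]) ((P[[(j : ℤ)]]) v) ⊗ₜ[ℂ]
          (B[[m + k - j - 1 - (l + (m - j))]]) w) := fun l => by
    simp only [hi]
    simp only [hi']
    rw [rightMul_apply, rightMode_eq hJ, TensorProduct.sum_tmul]
    rfl
  rw [rightMul_apply, rightMode_eq (N := J) (fun j hj => by
    rw [fieldLeft_tmul, hJ j hj, TensorProduct.zero_tmul]), box_apply, boxMode_eq_sum 0 S]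
  · simp only [add_zero, e]
    rw [Finset.sum_comm]
    refine Finset.sum_congr rfl fun j hj => ?_
    rw [fieldLeft_tmul, box_apply, boxMode_eq_sum (m - j) S (hS j (Finset.mem_range.1 hj)),
      Finset.smul_sum]
  · intro l hl
    simp only [add_zero, e]
    exact Finset.sum_eq_zero fun j hj => by rw [hS j (Finset.mem_range.1 hj) l hl, smul_zero]

theorem rightMul_fieldRight_box (s : V →ₗ[ℂ] V) (A : VertexOperator ℂ V)
    (P B : VertexOperator ℂ W) (m : ℤ) :
    rightMul (fieldRight s P) m (box A B) =
      box (A ∘ₗ s : VertexOperator ℂ V) (rightMul P m B) := by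
  refine field_ext_tmul fun k v w => ?_
  obtain ⟨J, hJ⟩ := exists_nat_bound' P w
  obtain ⟨S, hS⟩ := exists_common_finset J
    (fun j l => (A[[l + 0]]) (s v) ⊗ₜ[ℂ] (B[[m + k - j - 1 - (l + 0)]]) ((P[[(j : ℤ)]]) w))
    fun j => exists_finset_boxMode A B (m + k - j) 0 (s v) ((P[[(j : ℤ)]]) w)
  have hi : ∀ (l : ℤ) (j : ℕ), m + k - j - 1 - (l + 0) = m + (k - 1 - l) - j := fun l j => by ring
  have e : ∀ l : ℤ, (((A ∘ₗ s : VertexOperator ℂ V)[[l]]) v) ⊗ₜ[ℂ]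
      (((rightMul P m B)[[k - 1 - l]]) w) =
      ∑ j ∈ Finset.range J, (((m + j).negOnePow : ℤ) * Ring.choose m j) •
        ((A[[l + 0]]) (s v) ⊗ₜ[ℂ]
          (B[[m + k - j - 1 - (l + 0)]]) ((P[[(j : ℤ)]]) w)) := fun l => by
    simp only [hi]
    rw [rightMul_apply, rightMode_eq hJ, TensorProduct.tmul_sum, comp_ncoeff, add_zero]
    exact Finset.sum_congr rfl fun j _ => TensorProduct.tmul_smul _ _ _
  rw [rightMul_apply, rightMode_eq (N := J) (fun j hj => by
    rw [fieldRight_tmul, hJ j hj, TensorProduct.tmul_zero]), box_apply, boxMode_eq_sum 0 S]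
  · simp only [add_zero] at e ⊢
    simp only [e]
    rw [Finset.sum_comm]
    refine Finset.sum_congr rfl fun j hj => ?_
    rw [fieldRight_tmul, box_apply, boxMode_eq_sum 0 S (hS j (Finset.mem_range.1 hj)),
      Finset.smul_sum]
    simp only [add_zero]
  · intro l hl
    simp only [add_zero] at e hS ⊢
    rw [e]
    exact Finset.sum_eq_zero fun j hj => by rw [hS j (Finset.mem_range.1 hj) l hl, smul_zero]

theorem twist_map_box (s : V →ₗ[ℂ] V) (t : W →ₗ[ℂ] W) (A : VertexOperator ℂ V)
    (B : VertexOperator ℂ W) :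
    twist (TensorProduct.map s t) (box A B) = box (twist s A) (twist t B) := by
  refine field_ext_tmul fun k v w => ?_
  obtain ⟨S, hS⟩ := exists_finset_boxMode A B k 0 (s v) (t w)
  rw [twist_apply, TensorProduct.map_tmul, box_apply, box_apply, boxMode_eq_sum 0 S hS,
    boxMode_eq_sum 0 S, map_sum]
  · simp only [twist_apply, TensorProduct.map_tmul]
  · intro l hl
    have h := congrArg (TensorProduct.map s t) (hS l hl)
    rw [TensorProduct.map_tmul, map_zero] at h
    rw [twist_apply, twist_apply, h]

end Box

/-! ### The state-field correspondence of a tensor product -/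

section Vacuum

variable (c : ℂ)

theorem genField_parity_pow (X : Gen) (p : ℕ) (n : ℤ) (v : VacuumModule c) :
    (VacuumModule.parity c ^ p) (((genField c X)[[n]]) v) =
      (-1 : ℂ) ^ (p * X.parity) • ((genField c X)[[n]]) ((VacuumModule.parity c ^ p) v) := by
  rw [genField_apply, genField_apply, parity_pow_mode_smul, Gen.parity_mode]

/-- The state-field correspondence of the vacuum module is even. -/
theorem VacuumModule.Y_parity (v : VacuumModule c) :
    Y c (parity c v) = twist (parity c) (Y c v) := by
  refine VacuumModule.induction c (P := fun v => Y c (parity c v) = twist (parity c) (Y c v)) v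
    ?_ ?_ ?_ ?_
  · rw [parity_vac, Y_vac, twist_oneField (parity_parity c)]
  · intro v w hv hw
    simp only [map_add, hv, hw]
  · intro a v hv
    simp only [map_smul, hv]
  · intro X n v hv
    have hs : (-1 : ℂ) ^ X.parity * (-1 : ℂ) ^ X.parity = 1 := by rw [← mul_pow]; simp
    have hc : twist (parity c) ((twist (parity c) ^ X.parity) (Y c v)) =
        (twist (parity c) ^ X.parity) (twist (parity c) (Y c v)) := by
      rw [← Module.End.mul_apply, ← pow_succ', pow_succ, Module.End.mul_apply]
    rw [parity_mode_smul, map_smul, Y_mode_smul, Y_mode_smul, hv, fieldProduct_apply,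
      fieldProduct_apply, map_sub, twist_leftMul (parity_genField c X),
      twist_rightMul hs (parity_genField c X), hc, smul_sub]

theorem VacuumModule.Y_parity_pow (p : ℕ) (v : VacuumModule c) :
    Y c ((parity c ^ p) v) = twist (parity c ^ p) (Y c v) := by
  rw [← twist_pow]
  induction p with
  | zero => rfl
  | succ p ih => rw [pow_succ', pow_succ', Module.End.mul_apply, Module.End.mul_apply, Y_parity, ih]

theorem VacuumModule.Y_genState (X : Gen) : Y c (genState c X) = genField c X := by
  rw [genState, Y_mode_smul, Y_vac, fieldProduct_neg_one_oneField (parity_parity c)]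

end Vacuum

section Iterate

variable (c c' : ℂ)

/-- The tensor product of two universal `N = 2` vertex operator superalgebras. -/
abbrev tensorData : VertexData (VacuumModule c ⊗[ℂ] VacuumModule c') :=
  (universalN2 c).tensor (universalN2 c')

/-- The diagonal field `X(z) ⊗ 1 + 1 ⊗ X(z)`, with the Koszul sign. -/
def diagonalField (X : Gen) : VertexOperator ℂ (VacuumModule c ⊗[ℂ] VacuumModule c') :=
  fieldLeft (VacuumModule c') (genField c X) +
    fieldRight (VacuumModule.parity c ^ X.parity) (genField c' X)

theorem diagonalField_apply (X : Gen) (n : ℤ) (t : VacuumModule c ⊗[ℂ] VacuumModule c') :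
    ((diagonalField c c' X)[[n]]) t = diagonalMode c c' (X.mode n) t := by
  induction t using TensorProduct.induction_on with
  | zero => rw [map_zero, map_zero]
  | tmul v w =>
    rw [diagonalField, map_add, Pi.add_apply, LinearMap.add_apply, fieldLeft_tmul, fieldRight_tmul,
      genField_apply, genField_apply, diagonalMode_tmul, Gen.parity_mode]
  | add s t hs ht => rw [map_add, map_add, hs, ht]

theorem parity_diagonalMode (X : Gen) (n : ℤ) (t : VacuumModule c ⊗[ℂ] VacuumModule c') :
    (tensorData c c').parity (diagonalMode c c' (X.mode n) t) =
      (-1 : ℂ) ^ X.parity • diagonalMode c c' (X.mode n) ((tensorData c c').parity t) := by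
  change TensorProduct.map (VacuumModule.parity c) (VacuumModule.parity c') _ =
    _ • diagonalMode c c' _ (TensorProduct.map (VacuumModule.parity c) (VacuumModule.parity c') _)
  induction t using TensorProduct.induction_on with
  | zero => simp only [map_zero, smul_zero]
  | tmul v w =>
    have hc : VacuumModule.parity c ((VacuumModule.parity c ^ X.parity) v) =
        (VacuumModule.parity c ^ X.parity) (VacuumModule.parity c v) := by
      rw [← Module.End.mul_apply, ← pow_succ', pow_succ, Module.End.mul_apply]
    rw [diagonalMode_tmul, TensorProduct.map_tmul, diagonalMode_tmul, map_add,
      TensorProduct.map_tmul, TensorProduct.map_tmul, VacuumModule.parity_mode_smul,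
      VacuumModule.parity_mode_smul, Gen.parity_mode, hc, TensorProduct.tmul_smul, smul_add]
    rfl
  | add s t hs ht => simp only [map_add, hs, ht, smul_add]

/-- On `v ⊗ w` with `w` homogeneous of parity `q`, the state-field correspondence of the tensor
product is `Y(v) σ^q ⊗ Y(w)`, where `σ` is the parity involution. -/
theorem tensorY_homogeneous (v : VacuumModule c) {w : VacuumModule c'} {q : ℕ}
    (hw : VacuumModule.parity c' w = (-1 : ℂ) ^ q • w) :
    (tensorData c c').Y (v ⊗ₜ w) =
      box (VacuumModule.Y c v ∘ₗ (VacuumModule.parity c ^ q) : VertexOperator ℂ (VacuumModule c))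
        (VacuumModule.Y c' w) := by
  have e : (tensorData c c').Y (v ⊗ₜ w) =
      box (VacuumModule.Y c v) (VacuumModule.Y c' ((universalN2 c').evenPart w)) +
      box (VacuumModule.Y c v ∘ₗ VacuumModule.parity c : VertexOperator ℂ (VacuumModule c))
        (VacuumModule.Y c' ((universalN2 c').oddPart w)) := rfl
  have he : (universalN2 c').evenPart w = (1 / 2 : ℂ) • (w + VacuumModule.parity c' w) := rfl
  have ho : (universalN2 c').oddPart w = (1 / 2 : ℂ) • (w - VacuumModule.parity c' w) := rfl
  have hσ : VacuumModule.parity c ^ 2 = 1 := LinearMap.ext fun v => by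
    rw [pow_two]; exact VacuumModule.parity_parity c v
  have hz : ∀ A : VertexOperator ℂ (VacuumModule c),
      box A (0 : VertexOperator ℂ (VacuumModule c')) = 0 := fun A => map_zero (boxBilin A)
  rw [e, he, ho, hw]
  rcases Nat.even_or_odd q with hq | hq
  · obtain ⟨r, rfl⟩ := hq
    rw [← two_mul, pow_mul, pow_mul, hσ, one_pow, neg_one_sq, one_pow, one_smul, sub_self,
      smul_zero, map_zero, hz, add_zero, ← two_smul ℂ w, smul_smul]
    norm_num
    rfl
  · obtain ⟨r, rfl⟩ := hq
    rw [pow_succ, pow_succ, pow_mul, pow_mul, hσ, one_pow, neg_one_sq, one_pow, one_mul, one_mul,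
      neg_one_smul, add_neg_cancel, smul_zero, map_zero, hz, zero_add, sub_neg_eq_add,
      ← two_smul ℂ w, smul_smul]
    norm_num

theorem tensorY_vac : (tensorData c c').Y (VacuumModule.vac c ⊗ₜ VacuumModule.vac c') =
    oneField _ := by
  rw [tensorY_homogeneous c c' (q := 0) _ (by
    rw [VacuumModule.parity_vac, pow_zero, one_smul]), VacuumModule.Y_vac, VacuumModule.Y_vac]
  refine field_ext_tmul fun k v w => ?_
  rw [box_apply, boxMode_eq_sum 0 {-1}, Finset.sum_singleton, comp_ncoeff, pow_zero,
    Module.End.one_apply, oneField_apply, oneField_apply, oneField_apply, if_pos (by ring)]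
  · by_cases hk : k = -1
    · rw [if_pos (by lia), if_pos hk]
    · rw [if_neg (by lia), if_neg hk, TensorProduct.tmul_zero]
  · intro l hl
    rw [Finset.mem_singleton] at hl
    rw [comp_ncoeff, oneField_apply, if_neg (by lia), TensorProduct.zero_tmul]

/-- The summand `X(z) ⊗ 1` acts on the first tensor factor of `Y(v) σ^q ⊗ Y(w)` and the summand
`σ^p ⊗ X(z)`, with `p` the parity of `X`, on the second; the signs from moving `X(z)` past `σ^q` and
from the parity of `w` cancel. -/
theorem tensorY_diagonalMode_homogeneous (X : Gen) (m : ℤ) (v : VacuumModule c)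
    {w : VacuumModule c'} {q : ℕ} (hw : VacuumModule.parity c' w = (-1 : ℂ) ^ q • w) :
    (tensorData c c').Y (diagonalMode c c' (X.mode m) (v ⊗ₜ w)) =
      fieldProduct (tensorData c c').parity X.parity (diagonalField c c' X) m
        ((tensorData c c').Y (v ⊗ₜ w)) := by
  have hXw : VacuumModule.parity c' (mode c' (X.mode m) • w) =
      (-1 : ℂ) ^ (X.parity + q) • mode c' (X.mode m) • w := by
    rw [VacuumModule.parity_mode_smul, hw, smul_comm _ ((-1 : ℂ) ^ q), smul_smul, pow_add]
  have hYw : twist (VacuumModule.parity c' ^ X.parity) (VacuumModule.Y c' w) =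
      (-1 : ℂ) ^ (q * X.parity) • VacuumModule.Y c' w := by
    have h : ∀ p : ℕ, (VacuumModule.parity c' ^ p) w = (-1 : ℂ) ^ (q * p) • w := fun p => by
      induction p with
      | zero => simp
      | succ p ih =>
        rw [pow_succ', Module.End.mul_apply, ih, map_smul, hw, smul_smul, ← pow_add, mul_add,
          mul_one]
    rw [← VacuumModule.Y_parity_pow, h, map_smul]
  have htw : ∀ A B, ((twist (tensorData c c').parity) ^ X.parity) (box A B) =
      box (twist (VacuumModule.parity c ^ X.parity) A)
        (twist (VacuumModule.parity c' ^ X.parity) B) := fun A B => by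
    rw [twist_pow, ← twist_map_box, ← TensorProduct.map_pow]
    rfl
  set s := VacuumModule.parity c ^ X.parity with hs
  set t := VacuumModule.parity c ^ q with ht
  have hst : ∀ v, s (t v) = t (s v) := fun v => by
    rw [hs, ht, ← Module.End.mul_apply, ← Module.End.mul_apply, ← pow_add, ← pow_add, add_comm]
  have hss : ∀ v, s (s v) = v := parity_pow_parity_pow c _
  have hX : VacuumModule.Y c (mode c (X.mode m) • v) =
      leftMul (genField c X) m (VacuumModule.Y c v) -
        rightMul (genField c X) m (twist s (VacuumModule.Y c v)) := by
    rw [VacuumModule.Y_mode_smul, fieldProduct_apply, twist_pow]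
  have hX' : VacuumModule.Y c' (mode c' (X.mode m) • w) =
      leftMul (genField c' X) m (VacuumModule.Y c' w) -
        (-1 : ℂ) ^ (q * X.parity) • rightMul (genField c' X) m (VacuumModule.Y c' w) := by
    rw [VacuumModule.Y_mode_smul, fieldProduct_apply, twist_pow, hYw, map_smul]
  set A := VacuumModule.Y c v with hA
  set B := VacuumModule.Y c' w with hB
  have b₁ : ∀ A A' : VertexOperator ℂ (VacuumModule c), ∀ B : VertexOperator ℂ (VacuumModule c'),
      box (A - A') B = box A B - box A' B := fun A A' B =>
    congrArg (fun φ => φ B) (map_sub boxBilin A A')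
  have b₂ : ∀ A : VertexOperator ℂ (VacuumModule c), ∀ B B' : VertexOperator ℂ (VacuumModule c'),
      box A (B - B') = box A B - box A B' := fun A B B' => map_sub (boxBilin A) B B'
  have b₃ : ∀ (z : ℂ) (A : VertexOperator ℂ (VacuumModule c))
      (B : VertexOperator ℂ (VacuumModule c')), box (z • A) B = z • box A B := fun z A B =>
    congrArg (fun φ => φ B) (map_smul boxBilin z A)
  have b₄ : ∀ (z : ℂ) (A : VertexOperator ℂ (VacuumModule c))
      (B : VertexOperator ℂ (VacuumModule c')), box A (z • B) = z • box A B := fun z A B =>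
    map_smul (boxBilin A) z B
  have f₁ : twist s (A ∘ₗ t : VertexOperator ℂ (VacuumModule c)) =
      (twist s A ∘ₗ t : VertexOperator ℂ (VacuumModule c)) := field_ext fun n v => by
    rw [twist_apply, comp_ncoeff, comp_ncoeff, twist_apply, hst]
  have f₂ : (twist s A ∘ₗ (VacuumModule.parity c ^ (X.parity + q)) :
      VertexOperator ℂ (VacuumModule c)) =
      postcomp s (A ∘ₗ t : VertexOperator ℂ (VacuumModule c)) := field_ext fun n v => by
    rw [comp_ncoeff, twist_apply, postcomp_apply, comp_ncoeff, pow_add, Module.End.mul_apply, hss]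
  have f₃ : ((twist s A ∘ₗ t : VertexOperator ℂ (VacuumModule c)) ∘ₗ s :
      VertexOperator ℂ (VacuumModule c)) =
      postcomp s (A ∘ₗ t : VertexOperator ℂ (VacuumModule c)) := field_ext fun n v => by
    rw [comp_ncoeff, comp_ncoeff, twist_apply, postcomp_apply, comp_ncoeff, hst, hss]
  have f₄ : ∀ C C' : VertexOperator ℂ (VacuumModule c),
      ((C - C') ∘ₗ t : VertexOperator ℂ (VacuumModule c)) =
        (C ∘ₗ t : VertexOperator ℂ (VacuumModule c)) -
          (C' ∘ₗ t : VertexOperator ℂ (VacuumModule c)) := fun C C' => LinearMap.sub_comp _ _ _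
  have sq : (-1 : ℂ) ^ (q * X.parity) * (-1 : ℂ) ^ (q * X.parity) = 1 := by
    rw [← mul_pow]; simp
  rw [diagonalMode_tmul, map_add, tensorY_homogeneous c c' _ hw, tensorY_homogeneous c c' _ hXw,
    tensorY_homogeneous c c' _ hw, Gen.parity_mode, VacuumModule.Y_parity_pow, hX, hX', ← hs, ← hA,
    ← hB, ← ht, f₂, fieldProduct_apply, htw, f₁, hYw, diagonalField, leftMul_add, rightMul_add,
    ← hs, leftMul_fieldLeft_box, leftMul_fieldRight_box, b₄, map_smul, map_smul,
    rightMul_fieldLeft_box, rightMul_fieldRight_box, f₃, leftMul_comp,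
    rightMul_comp (genField_parity_pow c X q), f₄, b₁, b₂, b₃, b₄, smul_smul, sq, one_smul]
  abel

/-- The state-field correspondence of the tensor product intertwines the diagonal action of the modes
with the products with the diagonal fields. -/
theorem tensorY_diagonalMode (X : Gen) (m : ℤ) (t : VacuumModule c ⊗[ℂ] VacuumModule c') :
    (tensorData c c').Y (diagonalMode c c' (X.mode m) t) =
      fieldProduct (tensorData c c').parity X.parity (diagonalField c c' X) m
        ((tensorData c c').Y t) := by
  induction t using TensorProduct.induction_on with
  | zero => simp only [map_zero]
  | tmul v w =>
    have h₀ : VacuumModule.parity c' (w + VacuumModule.parity c' w) =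
        (-1 : ℂ) ^ 0 • (w + VacuumModule.parity c' w) := by
      rw [map_add, VacuumModule.parity_parity, pow_zero, one_smul, add_comm]
    have h₁ : VacuumModule.parity c' (w - VacuumModule.parity c' w) =
        (-1 : ℂ) ^ 1 • (w - VacuumModule.parity c' w) := by
      rw [map_sub, VacuumModule.parity_parity, pow_one, neg_one_smul, neg_sub]
    have hw : w = (1 / 2 : ℂ) • (w + VacuumModule.parity c' w) +
        (1 / 2 : ℂ) • (w - VacuumModule.parity c' w) := by module
    rw [hw, TensorProduct.tmul_add, TensorProduct.tmul_smul, TensorProduct.tmul_smul]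
    simp only [map_add, map_smul, tensorY_diagonalMode_homogeneous c c' X m v h₀,
      tensorY_diagonalMode_homogeneous c c' X m v h₁]
  | add s t hs ht => simp only [map_add, hs, ht]

theorem tensorY_diagonal_genState (X : Gen) :
    (tensorData c c').Y (genState c X ⊗ₜ VacuumModule.vac c' +
      VacuumModule.vac c ⊗ₜ genState c' X) = diagonalField c c' X := by
  have h := tensorY_diagonalMode c c' X (-1) (VacuumModule.vac c ⊗ₜ VacuumModule.vac c')
  rw [diagonalMode_tmul, parity_pow_vac, tensorY_vac, fieldProduct_neg_one_oneField] at h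
  · exact h
  · intro t
    induction t using TensorProduct.induction_on with
    | zero => simp only [map_zero]
    | tmul v w =>
      change VacuumModule.parity c (VacuumModule.parity c v) ⊗ₜ
        VacuumModule.parity c' (VacuumModule.parity c' w) = _
      rw [VacuumModule.parity_parity, VacuumModule.parity_parity]
    | add s t hs ht => simp only [map_add, hs, ht]

end Iterate

/-! ### Maps that intertwine fields -/

section Intertwine

variable {V W : Type*} [AddCommGroup V] [Module ℂ V] [AddCommGroup W] [Module ℂ W]

/-- A linear map intertwines a field on its domain with a field on its codomain. -/
def Intertwines (f : V →ₗ[ℂ] W) (A : VertexOperator ℂ V) (B : VertexOperator ℂ W) : Prop :=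
  ∀ n v, f ((A[[n]]) v) = (B[[n]]) (f v)

variable {f : V →ₗ[ℂ] W} {A C : VertexOperator ℂ V} {B D : VertexOperator ℂ W}

theorem Intertwines.leftMul (hA : Intertwines f A B) (hC : Intertwines f C D) (m : ℤ) :
    Intertwines f (leftMul A m C) (leftMul B m D) := fun k v => by
  obtain ⟨N, hN⟩ := exists_nat_bound C k v
  rw [leftMul_apply, leftMul_apply, leftMode_eq hN,
    leftMode_eq (N := N) (fun j hj => by rw [← hC, hN j hj, map_zero]), map_sum]
  exact Finset.sum_congr rfl fun j _ => by rw [map_zsmul, hA, hC]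

theorem Intertwines.rightMul (hA : Intertwines f A B) (hC : Intertwines f C D) (m : ℤ) :
    Intertwines f (rightMul A m C) (rightMul B m D) := fun k v => by
  obtain ⟨N, hN⟩ := exists_nat_bound' A v
  rw [rightMul_apply, rightMul_apply, rightMode_eq hN,
    rightMode_eq (N := N) (fun j hj => by rw [← hA, hN j hj, map_zero]), map_sum]
  exact Finset.sum_congr rfl fun j _ => by rw [map_zsmul, hC, hA]

theorem Intertwines.twist_pow {σ : V →ₗ[ℂ] V} {τ : W →ₗ[ℂ] W} (hf : ∀ v, f (σ v) = τ (f v))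
    (hC : Intertwines f C D) (p : ℕ) :
    Intertwines f ((twist σ ^ p) C) ((twist τ ^ p) D) := by
  induction p with
  | zero => exact hC
  | succ p ih =>
    intro n v
    rw [pow_succ', pow_succ', Module.End.mul_apply, Module.End.mul_apply, twist_apply, twist_apply,
      hf, ih, hf]

theorem Intertwines.fieldProduct {σ : V →ₗ[ℂ] V} {τ : W →ₗ[ℂ] W} (hf : ∀ v, f (σ v) = τ (f v))
    (hA : Intertwines f A B) (hC : Intertwines f C D) (p : ℕ) (m : ℤ) :
    Intertwines f (fieldProduct σ p A m C) (fieldProduct τ p B m D) := fun n v => by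
  rw [fieldProduct_apply, fieldProduct_apply, map_sub, map_sub, Pi.sub_apply, Pi.sub_apply,
    LinearMap.sub_apply, LinearMap.sub_apply, map_sub, hA.leftMul hC,
    hA.rightMul (hC.twist_pow hf p)]

end Intertwine

/-! ### The diagonal embedding -/

section Embedding

variable (c c' : ℂ)

theorem diagonalMap_parity (v : VacuumModule (c + c')) :
    diagonalMap c c' (VacuumModule.parity _ v) =
      (tensorData c c').parity (diagonalMap c c' v) := by
  refine VacuumModule.induction _ (P := fun v => diagonalMap c c' (VacuumModule.parity _ v) =
    (tensorData c c').parity (diagonalMap c c' v)) v ?_ ?_ ?_ ?_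
  · rw [VacuumModule.parity_vac, diagonalMap_vac]
    change _ = VacuumModule.parity c _ ⊗ₜ VacuumModule.parity c' _
    rw [VacuumModule.parity_vac, VacuumModule.parity_vac]
  · intro v w hv hw
    simp only [map_add, hv, hw]
  · intro a v hv
    simp only [map_smul, hv]
  · intro X n v hv
    rw [VacuumModule.parity_mode_smul, map_smul, diagonalMap_mode_smul, diagonalMap_mode_smul,
      parity_diagonalMode, hv]

theorem diagonalMap_intertwines (v : VacuumModule (c + c')) :
    Intertwines (diagonalMap c c') (VacuumModule.Y _ v)
      ((tensorData c c').Y (diagonalMap c c' v)) := by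
  refine VacuumModule.induction _ (P := fun v => Intertwines (diagonalMap c c')
    (VacuumModule.Y _ v) ((tensorData c c').Y (diagonalMap c c' v))) v ?_ ?_ ?_ ?_
  · intro n w
    rw [VacuumModule.Y_vac, diagonalMap_vac, tensorY_vac, oneField_apply, oneField_apply]
    split
    · rfl
    · exact map_zero _
  · intro v w hv hw n u
    simp only [map_add, Pi.add_apply, LinearMap.add_apply, hv n u, hw n u]
  · intro a v hv n u
    simp only [map_smul, Pi.smul_apply, LinearMap.smul_apply, hv n u]
  · intro X m v hv
    rw [VacuumModule.Y_mode_smul, diagonalMap_mode_smul, tensorY_diagonalMode]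
    refine Intertwines.fieldProduct (diagonalMap_parity c c') (fun n u => ?_) hv _ _
    rw [genField_apply, diagonalMap_mode_smul, diagonalField_apply]

theorem diagonalMap_genState (X : Gen) : diagonalMap c c' (genState _ X) =
    genState c X ⊗ₜ VacuumModule.vac c' + VacuumModule.vac c ⊗ₜ genState c' X := by
  rw [genState, diagonalMap_mode_smul, diagonalMap_vac, diagonalMode_tmul, parity_pow_vac]
  rfl

theorem diagonalMap_isConformalEmbedding :
    VertexData.IsConformalEmbedding (universalN2 (c + c')) (tensorData c c')
      (diagonalMap c c') where
  injective := diagonalMap_injective c c'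
  map_parity := diagonalMap_parity c c'
  map_vac := diagonalMap_vac c c'
  map_conformal := diagonalMap_genState c c' .T
  map_product a b n := diagonalMap_intertwines c c' a n b

/-- The product `J₍₁₎J = c / 3` on the two sides of the diagonal map shows that the central charges
add up. -/
theorem eq_add_of_isConformalEmbedding {c₁ c₂ c₃ : ℂ}
    {f : VacuumModule c₁ →ₗ[ℂ] VacuumModule c₂ ⊗[ℂ] VacuumModule c₃}
    (hf : VertexData.IsConformalEmbedding (universalN2 c₁) (tensorData c₂ c₃) f)
    (hJ : f (genState c₁ .J) =
      genState c₂ .J ⊗ₜ VacuumModule.vac c₃ + VacuumModule.vac c₂ ⊗ₜ genState c₃ .J) :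
    c₁ = c₂ + c₃ := by
  have hone : ∀ c, mode c (.J 1) • mode c (.J (-1)) • VacuumModule.vac c =
      (c / 3) • VacuumModule.vac c := fun c => by
    have h := congrArg (· • VacuumModule.vac c) (rel_J_J c 1 (-1))
    have h₁ : mode c (.J 1) • VacuumModule.vac c = 0 :=
      VacuumModule.mode_smul_vac c .J zero_le_one
    simpa [sub_smul, mul_smul, h₁] using h
  have hvac : f (VacuumModule.vac c₁) = VacuumModule.vac c₂ ⊗ₜ VacuumModule.vac c₃ := hf.map_vac
  have hdiag : f (genState c₁ .J) =
      diagonalMap c₂ c₃ (mode _ (.J (-1)) • VacuumModule.vac (c₂ + c₃)) :=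
    hJ.trans (diagonalMap_genState c₂ c₃ .J).symm
  have h := hf.map_product (genState c₁ .J) (genState c₁ .J) 1
  change f (((VacuumModule.Y c₁ (genState c₁ .J))[[1]]) (genState c₁ .J)) = _ at h
  rw [hJ, tensorY_diagonal_genState, ← hJ, hdiag, diagonalField_apply, VacuumModule.Y_genState,
    genField_apply] at h
  change f (mode c₁ (.J 1) • mode c₁ (.J (-1)) • VacuumModule.vac c₁) =
    diagonalMode c₂ c₃ (.J 1) _ at h
  rw [← diagonalMap_mode_smul, hone, hone, map_smul, map_smul, diagonalMap_vac, ← hvac,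
    ← sub_eq_zero, ← sub_smul, smul_eq_zero] at h
  have hne : f (VacuumModule.vac c₁) ≠ 0 := fun h₀ =>
    VacuumModule.vac_ne_zero c₁ (hf.injective (h₀.trans (map_zero f).symm))
  linear_combination 3 * h.resolve_right hne

theorem diagonalIsConformalEmbedding_iff (d₁ d₂ d₃ : ℕ) :
    DiagonalIsConformalEmbedding d₁ d₂ d₃ ↔
      centralCharge d₁ = centralCharge d₂ + centralCharge d₃ := by
  refine ⟨fun ⟨f, hf, hX⟩ => eq_add_of_isConformalEmbedding hf (hX .J), fun h => ?_⟩
  unfold DiagonalIsConformalEmbedding universalVOA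
  rw [h]
  exact ⟨diagonalMap _ _, diagonalMap_isConformalEmbedding _ _, diagonalMap_genState _ _⟩

end Embedding

/-! ### The equation between the central charges -/

section Arithmetic

theorem centralCharge_eq_add_iff (d₁ d₂ d₃ : ℕ) :
    centralCharge d₁ = centralCharge d₂ + centralCharge d₃ ↔
      (1 / (d₂ : ℚ) + 1 / (d₃ : ℚ) - 1 / (d₁ : ℚ) = 1 / 2) := by
  have h : centralCharge d₁ - (centralCharge d₂ + centralCharge d₃) =
      ((6 * (1 / (d₂ : ℚ) + 1 / (d₃ : ℚ) - 1 / (d₁ : ℚ) - 1 / 2) : ℚ) : ℂ) := by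
    simp only [centralCharge]
    push_cast
    ring
  rw [← sub_eq_zero, h, Rat.cast_eq_zero, mul_eq_zero, sub_eq_zero]
  norm_num

theorem eq_of_unit_fractions {a b : ℕ}
    (h : 1 / (2 : ℚ) + 1 / (b : ℚ) - 1 / (a : ℚ) = 1 / 2) : a = b := by
  have h₁ : (1 / (a : ℚ)) = 1 / b := by linear_combination -h
  simpa using h₁

theorem unit_fractions_of_le {a b d : ℕ} (hd : 2 ≤ d) (ha : 3 ≤ a) (hab : a ≤ b)
    (h : 1 / (a : ℚ) + 1 / (b : ℚ) - 1 / (d : ℚ) = 1 / 2) :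
    a = 3 ∧ ((d = 6 ∧ b = 3) ∨ (d = 12 ∧ b = 4) ∨ (d = 30 ∧ b = 5)) := by
  have hd₀ : (0 : ℚ) < d := by exact_mod_cast (by lia : 0 < d)
  have ha₀ : (0 : ℚ) < a := by exact_mod_cast (by lia : 0 < a)
  have hb₀ : (0 : ℚ) < b := by exact_mod_cast (by lia : 0 < b)
  have key : 2 * b * d + 2 * a * d = 2 * a * b + a * b * d := by
    field_simp at h
    have h' : (2 * b * d + 2 * a * d : ℚ) = 2 * a * b + a * b * d := by linear_combination h
    exact_mod_cast h'
  -- If `4 ≤ a ≤ b` then `1/a + 1/b ≤ 1/2`, and if `a = 3` and `6 ≤ b` then again `1/a + 1/b ≤ 1/2`.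
  have ha₃ : a = 3 := by
    by_contra hne
    have h₄ : 4 ≤ a := by lia
    have h₅ : 4 * b ≤ a * b := Nat.mul_le_mul_right b h₄
    have h₆ : 4 * a ≤ a * b := by nlinarith
    have h₇ : 0 < a * b := Nat.mul_pos (by lia) (by lia)
    nlinarith
  subst ha₃
  have hb₆ : b < 6 := by
    by_contra hb
    nlinarith
  interval_cases b <;> lia

theorem unit_fractions_iff {a b d : ℕ} (hd : 2 ≤ d) (ha : 3 ≤ a) (hb : 3 ≤ b) :
    1 / (a : ℚ) + 1 / (b : ℚ) - 1 / (d : ℚ) = 1 / 2 ↔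
      (a = 3 ∧ ((d = 6 ∧ b = 3) ∨ (d = 12 ∧ b = 4) ∨ (d = 30 ∧ b = 5))) ∨
        (b = 3 ∧ ((d = 6 ∧ a = 3) ∨ (d = 12 ∧ a = 4) ∨ (d = 30 ∧ a = 5))) := by
  constructor
  · intro h
    rcases le_total a b with hab | hab
    · exact Or.inl (unit_fractions_of_le hd ha hab h)
    · exact Or.inr (unit_fractions_of_le hd hb hab (by rw [add_comm, h]))
  · rintro (⟨rfl, ⟨rfl, rfl⟩ | ⟨rfl, rfl⟩ | ⟨rfl, rfl⟩⟩ |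
      ⟨rfl, ⟨rfl, rfl⟩ | ⟨rfl, rfl⟩ | ⟨rfl, rfl⟩⟩) <;> norm_num

end Arithmetic

end SuperVOA

end
theorem mainTheorem2 (d₁ d₂ d₃ : ℕ) (h₁ : 2 ≤ d₁) (h₂ : 2 ≤ d₂) (h₃ : 2 ≤ d₃) :
    (SuperVOA.DiagonalIsConformalEmbedding d₁ d₂ d₃ ↔
      SuperVOA.centralCharge d₁ = SuperVOA.centralCharge d₂ + SuperVOA.centralCharge d₃) ∧
    (SuperVOA.centralCharge d₁ = SuperVOA.centralCharge d₂ + SuperVOA.centralCharge d₃ ↔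
      (1 / (d₂ : ℚ) + 1 / (d₃ : ℚ) - 1 / (d₁ : ℚ) = 1 / 2)) ∧
    (3 ≤ d₂ → 3 ≤ d₃ →
      (SuperVOA.DiagonalIsConformalEmbedding d₁ d₂ d₃ ↔
        (d₂ = 3 ∧ ((d₁ = 6 ∧ d₃ = 3) ∨ (d₁ = 12 ∧ d₃ = 4) ∨ (d₁ = 30 ∧ d₃ = 5))) ∨
        (d₃ = 3 ∧ ((d₁ = 6 ∧ d₂ = 3) ∨ (d₁ = 12 ∧ d₂ = 4) ∨ (d₁ = 30 ∧ d₂ = 5))))) ∧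
    (d₂ = 2 → (SuperVOA.DiagonalIsConformalEmbedding d₁ d₂ d₃ ↔ d₁ = d₃)) ∧
    (d₃ = 2 → (SuperVOA.DiagonalIsConformalEmbedding d₁ d₂ d₃ ↔ d₁ = d₂)) := by
  have h := SuperVOA.diagonalIsConformalEmbedding_iff d₁ d₂ d₃
  have h' := SuperVOA.centralCharge_eq_add_iff d₁ d₂ d₃
  refine ⟨h, h', fun h₂' h₃' => ?_, fun h₂' => ?_, fun h₃' => ?_⟩
  · rw [h, h']
    exact SuperVOA.unit_fractions_iff h₁ h₂' h₃'
  · subst h₂'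
    rw [h, h']
    refine ⟨fun e => SuperVOA.eq_of_unit_fractions (by exact_mod_cast e), ?_⟩
    rintro rfl
    norm_num
  · subst h₃'
    rw [h, h']
    refine ⟨fun e => SuperVOA.eq_of_unit_fractions ?_, ?_⟩
    · rw [add_comm]
      exact_mod_cast e
    · rintro rfl
      norm_num
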